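/- **Lemma 2 (K and W algorithm).** The input consists of $n$ projectors, each given by four colors $K_i,R_i,G_i,B_i\in\mathbb R^3$, whose gamut is the parallelepiped $\{K_i+\alpha(R_i-K_i)+\beta(G_i-K_i)+\gamma(B_i-K_i):\alpha,\beta,\gamma\in[0,1]\}$, and of coefficients $a_1,a_2,a_3>0$ of the luminosity $L(x)=a_1x_1+a_2x_2+a_3x_3$. Let $P$ be the intersection of the $n$ gamuts. Assume that $P$ has nonempty interior and that $L>0$ on $P$. The *chromaticity* of $x$ with $L(x)>0$ is $x/L(x)$, its central projection from the origin to the plane $L=1$ (the chromaticity diagram). Let $P^-$ be the set of the facets of $P$ visible from the origin (the origin lies strictly on the other side of the facet plane from $P$), and $P^+$ the set of the facets on the far side (the origin lies strictly on the same side of the facet plane as $P$); facets whose plane contains the origin are in neither set. Consider the following algorithm. 1. Construct the facets, edges and vertices of $P$ by cutting the gamut of the first projector successively by the six halfspaces of each other gamut (cutting every facet and every edge, and adding the new facet on the cutting plane); form $P^-$ and $P^+$. 2. For each vertex $v$ of a facet in $P^-$, intersect the ray from the origin through $v$ with the planes through the facets in $P^+$; let $w$ be the intersection point nearest to the origin,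 and record the pair $(v,w)$. 3. For each vertex $w$ of a facet in $P^+$, intersect the ray from the origin through $w$ with the planes through the facets in $P^-$; let $v$ be the intersection point farthest from the origin, and record the pair $(v,w)$. 4. For each edge $s$ of a facet in $P^-$ and each edge $t$ of a facet in $P^+$ whose projections to the chromaticity diagram are not parallel and meet in a point $c$, record the pair of the points of $s$ and of $t$ with chromaticity $c$. 5. Output a recorded pair $(K,W)$ with the largest luminosity ratio $L(W)/L(K)$. Then step 1 produces a correct representation of $P$ by its facets and their edges; the algorithm outputs optimal $K$ and $W$, that is, points $K,W\in P$ of equal chromaticity such that $L(W')/L(K')\le L(W)/L(K)$ for all $K',W'\in P$ of equal chromaticity; and its running time is $O(n^2)$: there is a constant $C$, independent of $n$ and of the input, such that the number of steps (arithmetic operations and comparisons of real numbers, created list cells, and loop iterations) is at most $Cn^2$. -/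

import Mathlib

/-! ## Step counting

A computation is a value together with the number of elementary steps used to obtain it
(real-arithmetic model).  Every field operation, every comparison of two numbers, every
list cell that is created in a loop and every loop iteration costs one step.  The algorithm below
is written only in terms of these primitives, of records of constant size, and of case distinctions
on their outcomes.  It is written over an arbitrary ordered field and applied to `ℝ`. -/

/-- A value together with the number of elementary steps spent on computing it. -/
structure Timed (α : Type) where
  val : α
  time : ℕ

instance : Monad Timed where
  pure a := ⟨a, 0⟩
  bind m f := ⟨(f m.val).val, m.time + (f m.val).time⟩

namespace Timed

def add {F : Type} [Field F] (x y : F) : Timed F := ⟨x + y, 1⟩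
def sub {F : Type} [Field F] (x y : F) : Timed F := ⟨x - y, 1⟩
def mul {F : Type} [Field F] (x y : F) : Timed F := ⟨x * y, 1⟩
def div {F : Type} [Field F] (x y : F) : Timed F := ⟨x / y, 1⟩
def lt {F : Type} [LinearOrder F] (x y : F) : Timed Bool := ⟨decide (x < y), 1⟩
def le {F : Type} [LinearOrder F] (x y : F) : Timed Bool := ⟨decide (x ≤ y), 1⟩
def eq {F : Type} [LinearOrder F] (x y : F) : Timed Bool := ⟨decide (x = y), 1⟩

/-- Put an element in front of a list. -/
def push {α : Type} (a : α) (l : List α) : Timed (List α) := ⟨a :: l, 1⟩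

/-- One elementary step without a result. -/
def tick : Timed Unit := ⟨(), 1⟩

/-- The loop "for each `a` in the list, update the state by `f`". -/
def forEach {α σ : Type} (f : σ → α → Timed σ) : List α → σ → Timed σ
  | [], s => do
      tick
      return s
  | a :: l, s => do
      tick
      let s' ← f s a
      forEach f l s'

end Timed

/-! ## Vectors of the three-dimensional colour space -/

namespace Timed

variable {F : Type} [Field F]

def vadd (a b : Fin 3 → F) : Timed (Fin 3 → F) := do
  let x ← add (a 0) (b 0)
  let y ← add (a 1) (b 1)
  let z ← add (a 2) (b 2)
  return ![x, y, z]

def vsub (a b : Fin 3 → F) : Timed (Fin 3 → F) := do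
  let x ← sub (a 0) (b 0)
  let y ← sub (a 1) (b 1)
  let z ← sub (a 2) (b 2)
  return ![x, y, z]

def vscale (t : F) (a : Fin 3 → F) : Timed (Fin 3 → F) := do
  let x ← mul t (a 0)
  let y ← mul t (a 1)
  let z ← mul t (a 2)
  return ![x, y, z]

/-- Inner product. -/
def dot (a b : Fin 3 → F) : Timed F := do
  let x ← mul (a 0) (b 0)
  let y ← mul (a 1) (b 1)
  let z ← mul (a 2) (b 2)
  let s ← add x y
  add s z

/-- `x₁ y₂ - x₂ y₁`. -/
def det2 (x₁ x₂ y₁ y₂ : F) : Timed F := do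
  let a ← mul x₁ y₂
  let b ← mul x₂ y₁
  sub a b

/-- Cross product. -/
def cross (a b : Fin 3 → F) : Timed (Fin 3 → F) := do
  let x ← det2 (a 1) (a 2) (b 1) (b 2)
  let y ← det2 (a 2) (a 0) (b 2) (b 0)
  let z ← det2 (a 0) (a 1) (b 0) (b 1)
  return ![x, y, z]

/-- Equality test. -/
def veq [LinearOrder F] (a b : Fin 3 → F) : Timed Bool := do
  let x ← eq (a 0) (b 0)
  let y ← eq (a 1) (b 1)
  let z ← eq (a 2) (b 2)
  return x && y && z

end Timed

/-! ## Data -/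

/-- A projector is given by four of the extremal colours of its gamut: black, red, green, blue. -/
structure Projector (F : Type) where
  K : Fin 3 → F
  R : Fin 3 → F
  G : Fin 3 → F
  B : Fin 3 → F

/-- The halfspace of all `x` with `⟨normal, x⟩ ≤ offset`. -/
structure Halfspace (F : Type) where
  normal : Fin 3 → F
  offset : F

/-- A facet of a polyhedron: the halfspace that it bounds, and its edges, each given by its two
endpoints (in no particular order). -/
structure Facet (F : Type) where
  half : Halfspace F
  edges : List ((Fin 3 → F) × (Fin 3 → F))

/-! ## The algorithm -/

section Algorithm

open Timed

variable {F : Type} [Field F] [LinearOrder F]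

/-! ### Step 1: constructing the polyhedron

The polyhedron is represented by the list of its facets.  The gamut of the first
projector is cut successively by the six halfspaces of every other gamut. -/

/-- For a parallelepiped with corner `k` and edge vectors `u, v, w`: the two halfspaces
`0 ≤ α` and `α ≤ 1`, where `x = k + α u + β v + γ w`. -/
def slab (k u v w : Fin 3 → F) : Timed (Halfspace F × Halfspace F) := do
  let m ← cross v w
  let d ← dot u m
  let i ← div 1 d
  let a ← vscale i m
  let a' ← vscale (-1) a
  let b ← dot a k
  let b' ← mul (-1) b
  let b₁ ← add b 1
  return (⟨a', b'⟩, ⟨a, b₁⟩)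

/-- The four edges of the parallelogram with corner `o` and edge vectors `v, w`. -/
def parallelogramEdges (o v w : Fin 3 → F) : Timed (List ((Fin 3 → F) × (Fin 3 → F))) := do
  let p ← vadd o v
  let q ← vadd o w
  let r ← vadd p w
  return [(o, p), (o, q), (p, r), (q, r)]

/-- The two facets of the parallelepiped that are parallel to `v` and `w`. -/
def facetPair (k u v w : Fin 3 → F) : Timed (Facet F × Facet F) := do
  let h ← slab k u v w
  let k' ← vadd k u
  let e ← parallelogramEdges k v w
  let e' ← parallelogramEdges k' v w
  return (⟨h.1, e⟩, ⟨h.2, e'⟩)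

/-- The boundary of the gamut of a single projector. -/
def gamutFacets (p : Projector F) : Timed (List (Facet F)) := do
  let u ← vsub p.R p.K
  let v ← vsub p.G p.K
  let w ← vsub p.B p.K
  let f ← facetPair p.K u v w
  let g ← facetPair p.K v w u
  let h ← facetPair p.K w u v
  return [f.1, f.2, g.1, g.2, h.1, h.2]

/-- The six halfspaces whose intersection is the gamut of a projector. -/
def gamutHalfspaces (p : Projector F) : Timed (List (Halfspace F)) := do
  let u ← vsub p.R p.K
  let v ← vsub p.G p.K
  let w ← vsub p.B p.K
  let f ← slab p.K u v w
  let g ← slab p.K v w u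
  let h ← slab p.K w u v
  return [f.1, f.2, g.1, g.2, h.1, h.2]

/-- Positive in the interior of the halfspace, zero on the bounding plane, negative outside. -/
def slack (h : Halfspace F) (x : Fin 3 → F) : Timed F := do
  let y ← dot h.normal x
  sub h.offset y

/-- The point of the segment from `p` to `q` on the bounding plane, where `s > 0 ≥ r` are the slacks
of `p` and `q`. -/
def cutPoint (p q : Fin 3 → F) (s r : F) : Timed (Fin 3 → F) := do
  let d ← sub s r
  let t ← div s d
  let v ← vsub q p
  let tv ← vscale t v
  vadd p tv

/-- Cut an edge by a halfspace: the part that remains (`none` if no point of the edge has positive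
slack), and the point of this part on the bounding plane, if there is one. -/
def cutEdge (h : Halfspace F) (e : (Fin 3 → F) × (Fin 3 → F)) :
    Timed (Option ((Fin 3 → F) × (Fin 3 → F)) × Option (Fin 3 → F)) := do
  let s ← slack h e.1
  let r ← slack h e.2
  let sPos ← lt 0 s
  let rPos ← lt 0 r
  match sPos, rPos with
  | true, true => return (some e, none)
  | true, false => do
      let x ← cutPoint e.1 e.2 s r
      return (some (e.1, x), some x)
  | false, true => do
      let x ← cutPoint e.2 e.1 r s
      return (some (x, e.2), some x)
  | false, false => return (none, none)

/-- Cut all edges of a facet: the list of the remaining parts and the list of their points on the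
bounding plane. -/
def cutEdges (h : Halfspace F) (es : List ((Fin 3 → F) × (Fin 3 → F))) :
    Timed (List ((Fin 3 → F) × (Fin 3 → F)) × List (Fin 3 → F)) :=
  forEach (fun (st : List ((Fin 3 → F) × (Fin 3 → F)) × List (Fin 3 → F)) e => do
    let c ← cutEdge h e
    let kept ← (match c.1 with
      | some e' => push e' st.1
      | none => pure st.1)
    let pts ← (match c.2 with
      | some x => push x st.2
      | none => pure st.2)
    return (kept, pts)) es ([], [])

/-- Cut a facet by a halfspace: the remaining facet (`none` if nothing two-dimensional remains), and
its edge on the bounding plane, if there is one. -/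
def cutFacet (h : Halfspace F) (f : Facet F) :
    Timed (Option (Facet F) × Option ((Fin 3 → F) × (Fin 3 → F))) := do
  let c ← cutEdges h f.edges
  match c.1 with
  | [] => return (none, none)
  | _ :: _ =>
    match c.2 with
    | [x, y] => do
        let same ← veq x y
        match same with
        | true => return (some ⟨f.half, c.1⟩, none)
        | false => do
            let es ← push (x, y) c.1
            return (some ⟨f.half, es⟩, some (x, y))
    | _ => return (some ⟨f.half, c.1⟩, none)

/-- Does some vertex of the polyhedron lie outside the halfspace? -/
def isViolated (h : Halfspace F) (l : List (Facet F)) : Timed Bool :=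
  forEach (fun (b : Bool) (f : Facet F) =>
    forEach (fun (b : Bool) (e : (Fin 3 → F) × (Fin 3 → F)) => do
      let s ← slack h e.1
      let r ← slack h e.2
      let sNeg ← lt s 0
      let rNeg ← lt r 0
      return b || sNeg || rNeg) f.edges b) l false

/-- Intersect a polyhedron with a halfspace.  If the halfspace cuts something off, then every facet
is cut, and the edges that arise on the bounding plane are the edges of a new facet. -/
def cutPolyhedron (l : List (Facet F)) (h : Halfspace F) : Timed (List (Facet F)) := do
  let viol ← isViolated h l
  match viol with
  | false => return l
  | true => do
      let r ← forEach
        (fun (st : List (Facet F) × List ((Fin 3 → F) × (Fin 3 → F))) (f : Facet F) => do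
          let c ← cutFacet h f
          let fs ← (match c.1 with
            | some f' => push f' st.1
            | none => pure st.1)
          let es ← (match c.2 with
            | some e => push e st.2
            | none => pure st.2)
          return (fs, es)) l ([], [])
      push ⟨h, r.2⟩ r.1

/-- Step 1: the facets, edges and vertices of the intersection of all gamuts. -/
def constructPolyhedron : List (Projector F) → Timed (List (Facet F))
  | [] => return []
  | p :: ps => do
      let l ← gamutFacets p
      forEach (fun (l : List (Facet F)) (q : Projector F) => do
        let hs ← gamutHalfspaces q
        forEach cutPolyhedron hs l) ps l

/-- Step 1, continued: the facets visible from the origin (the origin is strictly outside the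
halfspace of the facet) and those on the far side (the origin is strictly inside).  Facets whose
plane passes through the origin are in neither list. -/
def partitionFacets (l : List (Facet F)) : Timed (List (Facet F) × List (Facet F)) :=
  forEach (fun (st : List (Facet F) × List (Facet F)) (f : Facet F) => do
    let neg ← lt f.half.offset 0
    let pos ← lt 0 f.half.offset
    match neg, pos with
    | true, _ => do
        let near ← push f st.1
        return (near, st.2)
    | false, true => do
        let far ← push f st.2
        return (st.1, far)
    | false, false => return st) l ([], [])

/-! ### Steps 2 to 5 -/

/-- All edges of the given facets (an edge of two of these facets is listed twice). -/
def allEdges (l : List (Facet F)) : Timed (List ((Fin 3 → F) × (Fin 3 → F))) :=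
  forEach (fun (acc : List ((Fin 3 → F) × (Fin 3 → F))) (f : Facet F) =>
    forEach (fun (acc : List ((Fin 3 → F) × (Fin 3 → F))) e => push e acc) f.edges acc) l []

/-- All vertices of the given facets (with repetitions). -/
def allVertices (l : List (Facet F)) : Timed (List (Fin 3 → F)) :=
  forEach (fun (acc : List (Fin 3 → F)) (f : Facet F) =>
    forEach (fun (acc : List (Fin 3 → F)) (e : (Fin 3 → F) × (Fin 3 → F)) => do
      let acc' ← push e.1 acc
      push e.2 acc') f.edges acc) l []

/-- The chromaticity of a colour `x`: the point of the line through the origin and `x` on the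
plane of luminosity one. -/
def chroma (luma x : Fin 3 → F) : Timed (Fin 3 → F) := do
  let y ← dot luma x
  let i ← div 1 y
  vscale i x

/-- The `t > 0` for which `t c` lies on the plane through the facet, if there is one. -/
def rayPlane (c : Fin 3 → F) (f : Facet F) : Timed (Option F) := do
  let d ← dot f.half.normal c
  let zero ← eq d 0
  match zero with
  | true => return none
  | false => do
      let t ← div f.half.offset d
      let pos ← lt 0 t
      match pos with
      | true => return (some t)
      | false => return none

/-- The smallest `t > 0` for which `t c` lies on a plane through one of the facets. -/
def nearestOnRay (c : Fin 3 → F) (l : List (Facet F)) : Timed (Option F) :=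
  forEach (fun (best : Option F) (f : Facet F) => do
    let t? ← rayPlane c f
    match best, t? with
    | none, t? => return t?
    | some b, none => return (some b)
    | some b, some t => do
        let less ← lt t b
        match less with
        | true => return (some t)
        | false => return (some b)) l none

/-- The largest `t > 0` for which `t c` lies on a plane through one of the facets. -/
def farthestOnRay (c : Fin 3 → F) (l : List (Facet F)) : Timed (Option F) :=
  forEach (fun (best : Option F) (f : Facet F) => do
    let t? ← rayPlane c f
    match best, t? with
    | none, t? => return t?
    | some b, none => return (some b)
    | some b, some t => do
        let less ← lt b t
        match less with
        | true => return (some t)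
        | false => return (some b)) l none

/-- Step 2: for every vertex `v` of a near facet, the pair of `v` and the nearest intersection point
of the ray through `v` with the planes through the far facets. -/
def nearVertexPairs (luma : Fin 3 → F) (near far : List (Facet F))
    (acc : List ((Fin 3 → F) × (Fin 3 → F))) : Timed (List ((Fin 3 → F) × (Fin 3 → F))) := do
  let vs ← allVertices near
  forEach (fun (acc : List ((Fin 3 → F) × (Fin 3 → F))) v => do
    let c ← chroma luma v
    let t? ← nearestOnRay c far
    match t? with
    | none => return acc
    | some t => do
        let w ← vscale t c
        push (v, w) acc) vs acc

/-- Step 3: for every vertex `w` of a far facet, the pair of `w` and the farthest intersection point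
of the ray through `w` with the planes through the near facets. -/
def farVertexPairs (luma : Fin 3 → F) (near far : List (Facet F))
    (acc : List ((Fin 3 → F) × (Fin 3 → F))) : Timed (List ((Fin 3 → F) × (Fin 3 → F))) := do
  let ws ← allVertices far
  forEach (fun (acc : List ((Fin 3 → F) × (Fin 3 → F))) w => do
    let c ← chroma luma w
    let t? ← farthestOnRay c near
    match t? with
    | none => return acc
    | some t => do
        let v ← vscale t c
        push (v, w) acc) ws acc

/-- The point with chromaticity `c = (1 - σ) p' + σ q'` on the segment from `p` to `q`, where
`p'`, `q'` are the chromaticities of `p`, `q`. -/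
def pointOnEdge (luma p q c : Fin 3 → F) (σ : F) : Timed (Fin 3 → F) := do
  let lp ← dot luma p
  let lq ← dot luma q
  let ρ ← sub 1 σ
  let x ← div ρ lp
  let y ← div σ lq
  let z ← add x y
  let t ← div 1 z
  vscale t c

/-- If the projections of the edges `s` and `t` into the chromaticity diagram cross in
a single point `c`: the points of `s` and of `t` with chromaticity `c`.  The first two coordinates
are used as coordinates of the chromaticity diagram, which lies in the plane of luminosity one. -/
def crossingPair (luma : Fin 3 → F) (s t : (Fin 3 → F) × (Fin 3 → F)) :
    Timed (Option ((Fin 3 → F) × (Fin 3 → F))) := do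
  let p ← chroma luma s.1
  let q ← chroma luma s.2
  let r ← chroma luma t.1
  let u ← chroma luma t.2
  let a ← vsub q p
  let b ← vsub u r
  let d ← vsub r p
  let den ← det2 (a 0) (a 1) (b 0) (b 1)
  let par ← eq den 0
  match par with
  | true => return none
  | false => do
      let σn ← det2 (d 0) (d 1) (b 0) (b 1)
      let σ ← div σn den
      let τn ← det2 (d 0) (d 1) (a 0) (a 1)
      let τ ← div τn den
      let σ₀ ← le 0 σ
      let σ₁ ← le σ 1
      let τ₀ ← le 0 τ
      let τ₁ ← le τ 1
      match σ₀ && σ₁ && τ₀ && τ₁ with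
      | false => return none
      | true => do
          let σa ← vscale σ a
          let c ← vadd p σa
          let v ← pointOnEdge luma s.1 s.2 c σ
          let w ← pointOnEdge luma t.1 t.2 c τ
          return (some (v, w))

/-- Step 4: the crossings of all projected near edges with all projected far edges. -/
def crossingPairs (luma : Fin 3 → F) (near far : List (Facet F))
    (acc : List ((Fin 3 → F) × (Fin 3 → F))) : Timed (List ((Fin 3 → F) × (Fin 3 → F))) := do
  let ss ← allEdges near
  let ts ← allEdges far
  forEach (fun (acc : List ((Fin 3 → F) × (Fin 3 → F))) s =>
    forEach (fun (acc : List ((Fin 3 → F) × (Fin 3 → F))) t => do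
      let c ← crossingPair luma s t
      match c with
      | none => return acc
      | some vw => push vw acc) ts acc) ss acc

/-- The luminosity ratio of a pair. -/
def lumaRatio (luma : Fin 3 → F) (vw : (Fin 3 → F) × (Fin 3 → F)) : Timed F := do
  let x ← dot luma vw.1
  let y ← dot luma vw.2
  div y x

/-- Step 5: a pair with the largest luminosity ratio. -/
def bestPair (luma : Fin 3 → F) (l : List ((Fin 3 → F) × (Fin 3 → F))) :
    Timed (Option ((Fin 3 → F) × (Fin 3 → F))) :=
  forEach (fun (best : Option ((Fin 3 → F) × (Fin 3 → F))) vw =>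
    match best with
    | none => return (some vw)
    | some b => do
        let x ← lumaRatio luma b
        let y ← lumaRatio luma vw
        let less ← lt x y
        match less with
        | true => return (some vw)
        | false => return (some b)) l none

/-- The overlay algorithm.  The input is the vector of the coefficients of the luminosity
and the list of the projectors; the output is the pair `(K, W)`. -/
def overlayAlgorithm (luma : Fin 3 → F) (ps : List (Projector F)) :
    Timed (Option ((Fin 3 → F) × (Fin 3 → F))) := do
  let l ← constructPolyhedron ps
  let nf ← partitionFacets l
  let c₁ ← nearVertexPairs luma nf.1 nf.2 []
  let c₂ ← farVertexPairs luma nf.1 nf.2 c₁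
  let c₃ ← crossingPairs luma nf.1 nf.2 c₂
  bestPair luma c₃

end Algorithm

/-! ## What the algorithm is supposed to compute -/

/-- The gamut of a projector: the parallelepiped with corner `K` and neighbouring
corners `R`, `G`, `B`. -/
def Projector.gamut (p : Projector ℝ) : Set (Fin 3 → ℝ) :=
  {x | ∃ α ∈ Set.Icc (0 : ℝ) 1, ∃ β ∈ Set.Icc (0 : ℝ) 1, ∃ γ ∈ Set.Icc (0 : ℝ) 1,
    x = p.K + α • (p.R - p.K) + β • (p.G - p.K) + γ • (p.B - p.K)}

/-- The intersection of the gamuts of all projectors. -/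
def gamutIntersection (ps : List (Projector ℝ)) : Set (Fin 3 → ℝ) :=
  {x | ∀ p ∈ ps, x ∈ p.gamut}

/-- The luminosity of a colour. -/
def luminosity (luma x : Fin 3 → ℝ) : ℝ := ∑ i, luma i * x i

/-- The central projection from the origin to the plane of luminosity one. -/
noncomputable def chromaticity (luma x : Fin 3 → ℝ) : Fin 3 → ℝ := (luminosity luma x)⁻¹ • x

/-- `K` and `W` are points of `P` of the same chromaticity, and the ratio of the luminosities
of `W` and `K` is the largest possible for such points. -/
structure IsOptimalBlackWhite (P : Set (Fin 3 → ℝ)) (luma K W : Fin 3 → ℝ) : Prop where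
  black_mem : K ∈ P
  white_mem : W ∈ P
  same_chromaticity : chromaticity luma K = chromaticity luma W
  optimal : ∀ K' ∈ P, ∀ W' ∈ P, chromaticity luma K' = chromaticity luma W' →
    luminosity luma W' / luminosity luma K' ≤ luminosity luma W / luminosity luma K

/-- The part of `P` on the plane through a facet. -/
def Facet.face (f : Facet ℝ) (P : Set (Fin 3 → ℝ)) : Set (Fin 3 → ℝ) :=
  {x ∈ P | ∑ i, f.half.normal i * x i = f.half.offset}

/-- A list of facets represents the three-dimensional convex polyhedron `P`: the
halfspaces of the facets intersect in `P`, every listed facet is a two-dimensional face of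
`P`, no facet is listed twice, and the list of the edges of a facet contains exactly, and exactly
once, each one-dimensional intersection of it with another facet. -/
structure IsBoundaryRepresentation (P : Set (Fin 3 → ℝ)) (l : List (Facet ℝ)) : Prop where
  eq_inter : P = {x | ∀ f ∈ l, ∑ i, f.half.normal i * x i ≤ f.half.offset}
  two_dim : ∀ f ∈ l, Module.finrank ℝ (vectorSpan ℝ (f.face P)) = 2
  distinct : l.Pairwise fun f g => f.face P ≠ g.face P
  edges : ∀ f ∈ l, ∀ S : Set (Fin 3 → ℝ),
    (∃ e ∈ f.edges, S = segment ℝ e.1 e.2) ↔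
      ∃ g ∈ l, g.face P ≠ f.face P ∧ S = f.face P ∩ g.face P ∧ S.Nontrivial
  edges_distinct : ∀ f ∈ l, f.edges.Pairwise fun e e' => segment ℝ e.1 e.2 ≠ segment ℝ e'.1 e'.2

/-! The construction is governed by one invariant, `IsRepresentation`. The listed halfspaces are
distinct and have a common interior point `c`, their intersection is bounded, every facet plane has
a point strictly inside all other halfspaces (so no facet is redundant), and the edges of a facet
are, without repetition, its nondegenerate intersections with the other facets. A parallelepiped
satisfies it (`Projector.isRepresentation_gamutFacets`), and cutting by a violated halfspace
preserves it (`IsRepresentation.cut`).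

The heart of a cut is planar. If a facet has a point on the positive side and meets the cutting
plane, then exactly two of its edges, among those with a point on the positive side, meet that
plane, and their points on it span the section (`facet_section`). So the new edge of a facet can be
found from its own edges alone. No general position is assumed: the section may be a single vertex
or an old edge. The planar convexity needed is reduced to two tools: a segment that leaves a
polyhedron does so through a listed facet (`exists_exit`), and a plane has no three directions each
supported by a functional that is negative on the other two (`no_three_supported`).

The number of edges is linear in the number of facets (`sum_length_edges_le`). Instead of Euler's
formula a double count is used: for a generic linear function each vertex is on at least three
facets, but is strictly between the lowest and the highest level of at most two of them. Hence each
of the `O(n)` cuts touches `O(n)` edges, and steps 2 to 4 combine `O(n)` objects with `O(n)`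
objects.

For optimality, consider the rays `t • c` with `c` in the chromaticity diagram that meet a fixed
near face `f` at parameter `κ` and a fixed far face `g` at parameter `μ`. Since `κ • c` and `μ • c`
lie on the two planes, `1 / κ` and `1 / μ` are linear in `c`. So `μ / κ ≥ M` says that the linear
function `1 / κ - M / μ` is nonnegative. If this holds somewhere on the polygon of such directions,
it holds at a vertex of the polygon (`exists_vertex_ge`). At such a vertex `κ • c` is a vertex of
`f`, or `μ • c` is a vertex of `g`, or two projected edges cross there: these are the situations of
steps 2, 3 and 4 (`exists_recordedPairs_of_vertex`). Conversely all recorded pairs consist of points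
of the polyhedron with equal chromaticity (`mem_of_mem_recordedPairs`), so the best of them is
optimal. -/

/-! ### Halfspaces and polyhedra -/

/-- The slack of a point, as an affine function: nonnegative exactly on the halfspace. -/
def Halfspace.gap (h : Halfspace ℝ) (x : Fin 3 → ℝ) : ℝ := h.offset - dotProduct h.normal x

/-- The intersection of the halfspaces of a list of facets. -/
def polyhedron (l : List (Facet ℝ)) : Set (Fin 3 → ℝ) := {x | ∀ f ∈ l, 0 ≤ f.half.gap x}

namespace Halfspace

variable (h : Halfspace ℝ)

theorem gap_lineMap (x y : Fin 3 → ℝ) (t : ℝ) :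
    h.gap (x + t • (y - x)) = (1 - t) * h.gap x + t * h.gap y := by
  simp only [gap, dotProduct_add, dotProduct_smul, dotProduct_sub, smul_eq_mul]; ring

theorem gap_add_smul (x d : Fin 3 → ℝ) (t : ℝ) :
    h.gap (x + t • d) = h.gap x - t * dotProduct h.normal d := by
  simp only [gap, dotProduct_add, dotProduct_smul, smul_eq_mul]; ring

theorem dotProduct_normal_sub (x y : Fin 3 → ℝ) :
    dotProduct h.normal (y - x) = h.gap x - h.gap y := by
  simp only [gap, dotProduct_sub]; ring

theorem continuous_gap : Continuous h.gap := by
  unfold gap dotProduct; fun_prop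

end Halfspace

theorem mem_segment_iff_lineMap {p q x : Fin 3 → ℝ} :
    x ∈ segment ℝ p q ↔ ∃ t : ℝ, 0 ≤ t ∧ t ≤ 1 ∧ x = p + t • (q - p) := by
  rw [segment_eq_image']
  constructor
  · rintro ⟨t, ⟨h0, h1⟩, rfl⟩; exact ⟨t, h0, h1, rfl⟩
  · rintro ⟨t, h0, h1, rfl⟩; exact ⟨t, ⟨h0, h1⟩, rfl⟩

theorem mem_face_polyhedron {l : List (Facet ℝ)} {f : Facet ℝ} {x : Fin 3 → ℝ} :
    x ∈ f.face (polyhedron l) ↔ x ∈ polyhedron l ∧ f.half.gap x = 0 := by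
  have : (∑ i, f.half.normal i * x i = f.half.offset) ↔ f.half.gap x = 0 := by
    unfold Halfspace.gap dotProduct
    constructor <;> intro h <;> linarith
  unfold Facet.face
  simp only [Set.mem_ofPred_eq, this]

theorem convex_polyhedron (l : List (Facet ℝ)) : Convex ℝ (polyhedron l) := by
  intro x hx y hy a b ha hb hab f hf
  have : f.half.gap (a • x + b • y) = a * f.half.gap x + b * f.half.gap y := by
    simp only [Halfspace.gap, dotProduct_add, dotProduct_smul, smul_eq_mul]
    linear_combination (-f.half.offset) * hab
  rw [this]
  exact add_nonneg (mul_nonneg ha (hx f hf)) (mul_nonneg hb (hy f hf))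

theorem mem_polyhedron_of_strict {l : List (Facet ℝ)} {f : Facet ℝ} {z : Fin 3 → ℝ} (hz : f.half.gap z = 0)
    (hstr : ∀ g ∈ l, g.half ≠ f.half → 0 < g.half.gap z) : z ∈ polyhedron l := by
  intro g hg
  by_cases h : g.half = f.half
  · rw [h, hz]
  · exact (hstr g hg h).le

/-! ### Leaving a polyhedron along a segment -/

/-- This is the ratio test of the simplex method. A value going from `a i ≥ 0` to `b i < 0` vanishes
at `a i / (a i - b i)`; the least of these parameters keeps all values nonnegative, and values with
a nonnegative end never become negative. -/
theorem exists_max_ratio {ι : Type*} (l : List ι) (a b : ι → ℝ) (ha : ∀ i ∈ l, 0 ≤ a i)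
    (hb : ∃ i ∈ l, b i < 0) :
    ∃ t : ℝ, 0 ≤ t ∧ t < 1 ∧ (∀ i ∈ l, 0 ≤ (1 - t) * a i + t * b i) ∧
      ∃ i ∈ l, (1 - t) * a i + t * b i = 0 ∧ b i < 0 := by
  classical
  obtain ⟨i₀, hi₀, hb₀⟩ := hb
  obtain ⟨i, hi, hmin⟩ := Finset.exists_min_image (l.toFinset.filter fun i => b i < 0)
    (fun i => a i / (a i - b i)) ⟨i₀, by simp [hi₀, hb₀]⟩
  simp only [Finset.mem_filter, List.mem_toFinset] at hi hmin
  have hd : 0 < a i - b i := by linarith [ha i hi.1]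
  have ht0 : 0 ≤ a i / (a i - b i) := div_nonneg (ha i hi.1) hd.le
  have ht1 : a i / (a i - b i) < 1 := by rw [div_lt_one hd]; linarith
  refine ⟨a i / (a i - b i), ht0, ht1, ?_, i, hi.1, ?_, hi.2⟩
  · intro j hj
    rcases lt_or_ge (b j) 0 with hbj | hbj
    · have hdj : 0 < a j - b j := by linarith [ha j hj]
      have := hmin j ⟨hj, hbj⟩
      rw [le_div_iff₀ hdj] at this
      linarith
    · have := mul_nonneg ht0 hbj
      have := mul_nonneg (sub_nonneg.2 ht1.le) (ha j hj)
      linarith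
  · field_simp; ring

/-- A segment that leaves a polyhedron does so through the plane of a facet. -/
theorem exists_exit {l : List (Facet ℝ)} {x y : Fin 3 → ℝ} (hx : x ∈ polyhedron l)
    (hy : y ∉ polyhedron l) :
    ∃ t : ℝ, 0 ≤ t ∧ t < 1 ∧ x + t • (y - x) ∈ polyhedron l ∧
      ∃ g ∈ l, g.half.gap (x + t • (y - x)) = 0 ∧ g.half.gap y < 0 := by
  have hy' : ∃ f ∈ l, f.half.gap y < 0 := by
    by_contra! H
    exact hy H
  obtain ⟨t, h0, h1, hall, g, hg, hg0, hgy⟩ :=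
    exists_max_ratio l (fun f => f.half.gap x) (fun f => f.half.gap y) hx hy'
  refine ⟨t, h0, h1, ?_, g, hg, ?_, hgy⟩
  · intro f hf
    rw [Halfspace.gap_lineMap]
    exact hall f hf
  · rw [Halfspace.gap_lineMap]; exact hg0

/-- Small steps keep the inactive constraints inactive. -/
theorem exists_small_step (l : List (Facet ℝ)) (x d : Fin 3 → ℝ) :
    ∃ ε : ℝ, 0 < ε ∧ ∀ t : ℝ, 0 ≤ t → t ≤ ε → ∀ g ∈ l, 0 < g.half.gap x → 0 < g.half.gap (x + t • d) := by
  induction l with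
  | nil => exact ⟨1, one_pos, by simp⟩
  | cons f l ih =>
    obtain ⟨ε, hε, H⟩ := ih
    by_cases hf : 0 < f.half.gap x
    · set m := dotProduct f.half.normal d
      have hm : 0 < |m| + 1 := by positivity
      -- The gap drops by at most `t * |m|`, hence by at most half of its value; the summand `1`
      -- covers `m = 0`.
      refine ⟨min ε (f.half.gap x / (2 * (|m| + 1))), by positivity, fun t t0 t1 g hg hgx => ?_⟩
      rcases List.mem_cons.1 hg with rfl | hg
      · rw [Halfspace.gap_add_smul]
        have h2 := t1.trans (min_le_right _ _)
        rw [le_div_iff₀ (by positivity)] at h2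
        have h3 : t * m ≤ t * |m| := mul_le_mul_of_nonneg_left (le_abs_self m) t0
        change 0 < _ - t * m
        nlinarith
      · exact H t t0 (t1.trans (min_le_left _ _)) g hg hgx
    · refine ⟨ε, hε, fun t t0 t1 g hg hgx => ?_⟩
      rcases List.mem_cons.1 hg with rfl | hg
      · exact absurd hgx hf
      · exact H t t0 t1 g hg hgx

/-! ### Linear algebra in a plane -/

/-- Three vectors orthogonal to a nonzero vector are linearly dependent. -/
theorem exists_dependency {n r₁ r₂ r₃ : Fin 3 → ℝ} (hn : n ≠ 0) (h₁ : dotProduct n r₁ = 0)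
    (h₂ : dotProduct n r₂ = 0) (h₃ : dotProduct n r₃ = 0) :
    ∃ a b c : ℝ, (a ≠ 0 ∨ b ≠ 0 ∨ c ≠ 0) ∧ a • r₁ + b • r₂ + c • r₃ = 0 := by
  let M : Matrix (Fin 3) (Fin 3) ℝ := Matrix.of ![r₁, r₂, r₃]
  -- `M` maps `n` to zero, so it is singular, and a vector of its left kernel provides the
  -- coefficients.
  have hM : M.det = 0 := by
    rw [← Matrix.exists_mulVec_eq_zero_iff]
    refine ⟨n, hn, ?_⟩
    ext i
    fin_cases i <;> simp [M, Matrix.mulVec, dotProduct_comm _ n, h₁, h₂, h₃]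
  obtain ⟨v, hv, hvM⟩ := Matrix.exists_vecMul_eq_zero_iff.2 hM
  refine ⟨v 0, v 1, v 2, ?_, ?_⟩
  · by_contra! H
    apply hv
    ext i
    fin_cases i <;> simp [H]
  · ext i
    have := congrFun hvM i
    simp [M, Matrix.vecMul, dotProduct, Fin.sum_univ_three] at this
    simpa using this

/-- Three vectors in a plane cannot each lie on its own supporting line of a convex cone that
contains the two others in its interior side. -/
theorem no_three_supported {n r₁ r₂ r₃ n₁ n₂ n₃ : Fin 3 → ℝ} (hn : n ≠ 0)
    (h₁ : dotProduct n r₁ = 0) (h₂ : dotProduct n r₂ = 0) (h₃ : dotProduct n r₃ = 0)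
    (h11 : dotProduct n₁ r₁ = 0) (h22 : dotProduct n₂ r₂ = 0) (h33 : dotProduct n₃ r₃ = 0)
    (h12 : dotProduct n₁ r₂ < 0) (h13 : dotProduct n₁ r₃ < 0) (h21 : dotProduct n₂ r₁ < 0)
    (h23 : dotProduct n₂ r₃ < 0) (h31 : dotProduct n₃ r₁ < 0) (h32 : dotProduct n₃ r₂ < 0) :
    False := by
  obtain ⟨a, b, c, habc, H⟩ := exists_dependency hn h₁ h₂ h₃
  have e (m : Fin 3 → ℝ) :
      a * dotProduct m r₁ + b * dotProduct m r₂ + c * dotProduct m r₃ = 0 := by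
    have := congrArg (dotProduct m) H
    simpa [dotProduct_add, dotProduct_smul] using this
  have e1 := e n₁
  have e2 := e n₂
  have e3 := e n₃
  rw [h11, mul_zero, zero_add] at e1
  rw [h22, mul_zero, add_zero] at e2
  rw [h33, mul_zero, add_zero] at e3
  -- The functional `n₁` annihilates `r₁` and is negative on `r₂` and `r₃`, so it forces opposite
  -- signs on `b` and `c`; likewise for the other two pairs.
  have opp : ∀ {u v p q : ℝ}, p < 0 → q < 0 → u * p + v * q = 0 → u * v ≤ 0 ∧ (u = 0 → v = 0) := by
    intro u v p q hp hq h
    constructor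
    · by_contra! hc
      have : u * (u * p) + u * v * q = 0 := by linear_combination u * h
      nlinarith [mul_self_nonneg u, mul_neg_of_pos_of_neg hc hq]
    · rintro rfl
      have : v * q = 0 := by linarith
      rcases mul_eq_zero.1 this with h | h
      · exact h
      · exact absurd h hq.ne
  obtain ⟨bc, bc0⟩ := opp h12 h13 e1
  obtain ⟨ac, ac0⟩ := opp h21 h23 e2
  obtain ⟨ab, ab0⟩ := opp h31 h32 e3
  -- Three nonzero numbers cannot have pairwise opposite signs: the product of the three pairwise
  -- products is the square of `a * b * c`. So one coefficient vanishes, and the others follow.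
  have hprod : (a * b) * (b * c) * (a * c) ≤ 0 :=
    mul_nonpos_of_nonneg_of_nonpos (mul_nonneg_of_nonpos_of_nonpos ab bc) ac
  have hz : a * b * c = 0 := by nlinarith [mul_self_nonneg (a * b * c)]
  have hzero : a = 0 ∧ b = 0 ∧ c = 0 := by
    rcases mul_eq_zero.1 hz with h | h
    · rcases mul_eq_zero.1 h with h | h
      · exact ⟨h, ab0 h, ac0 h⟩
      · have : a * dotProduct n₃ r₁ = 0 := by rw [h] at e3; linarith
        have ha : a = 0 := (mul_eq_zero.1 this).resolve_right h31.ne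
        exact ⟨ha, h, bc0 h⟩
    · have : a * dotProduct n₂ r₁ = 0 := by rw [h] at e2; linarith
      have ha : a = 0 := (mul_eq_zero.1 this).resolve_right h21.ne
      exact ⟨ha, ab0 ha, h⟩
  rcases habc with h | h | h
  exacts [h hzero.1, h hzero.2.1, h hzero.2.2]

/-- For every nonzero vector `r` orthogonal to `n ≠ 0` the plane orthogonal to `n` contains a nonzero
vector orthogonal to `r`. -/
theorem exists_orthogonal_pair {n r : Fin 3 → ℝ} (hn : n ≠ 0) (hr : r ≠ 0)
    (hnr : dotProduct n r = 0) :
    ∃ w, w ≠ 0 ∧ dotProduct n w = 0 ∧ dotProduct r w = 0 := by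
  refine ⟨crossProduct n r, ?_, dot_self_cross n r, dot_cross_self n r⟩
  intro h
  -- Lagrange's identity: for orthogonal vectors the squared length of the cross product is the
  -- product of the squared lengths.
  have := cross_dot_cross n r n r
  rw [h, zero_dotProduct, dotProduct_comm r n, hnr, mul_zero, sub_zero] at this
  rcases mul_eq_zero.1 this.symm with h | h
  · exact hn (dotProduct_self_eq_zero.1 h)
  · exact hr (dotProduct_self_eq_zero.1 h)

/-- Any two vectors are orthogonal to a common nonzero vector. -/
theorem exists_orthogonal (m n : Fin 3 → ℝ) :
    ∃ w, w ≠ 0 ∧ dotProduct m w = 0 ∧ dotProduct n w = 0 := by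
  -- The zero row makes the matrix singular. Unlike the cross product, this also yields a nonzero
  -- vector when `m` and `n` are parallel.
  have hM : (Matrix.of ![m, n, 0] : Matrix (Fin 3) (Fin 3) ℝ).det = 0 := by
    simp [Matrix.det_fin_three]
  obtain ⟨w, hw, H⟩ := Matrix.exists_mulVec_eq_zero_iff.2 hM
  refine ⟨w, hw, ?_, ?_⟩
  · simpa [Matrix.mulVec] using congrFun H 0
  · simpa [Matrix.mulVec] using congrFun H 1

theorem exists_add_smul_notMem {P : Set (Fin 3 → ℝ)} (hP : Bornology.IsBounded P)
    (x : Fin 3 → ℝ) {d : Fin 3 → ℝ} (hd : d ≠ 0) : ∃ t : ℝ, 0 < t ∧ x + t • d ∉ P := by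
  obtain ⟨R, hR⟩ := hP.exists_norm_le
  have hd' : 0 < ‖d‖ := norm_pos_iff.2 hd
  refine ⟨(|R| + ‖x‖ + 1) / ‖d‖, by positivity, fun h => ?_⟩
  have h1 := hR _ h
  have h2 : ‖((|R| + ‖x‖ + 1) / ‖d‖) • d‖ = |R| + ‖x‖ + 1 := by
    rw [norm_smul, Real.norm_of_nonneg (by positivity)]; field_simp
  have h3 := norm_sub_norm_le (((|R| + ‖x‖ + 1) / ‖d‖) • d) (-x)
  rw [sub_neg_eq_add, norm_neg, add_comm (_ • d), h2] at h3
  linarith [le_abs_self R]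

/-! ### The invariant and the edges of a facet -/

/-- The loop invariant of the construction: the list describes the polyhedron completely and without
redundancy, and `c` is a point in its interior. -/
structure IsRepresentation (c : Fin 3 → ℝ) (l : List (Facet ℝ)) : Prop where
  nodup : l.Pairwise fun f g => f.half ≠ g.half
  center : ∀ f ∈ l, 0 < f.half.gap c
  bounded : Bornology.IsBounded (polyhedron l)
  strict : ∀ f ∈ l, ∃ z, f.half.gap z = 0 ∧ ∀ g ∈ l, g.half ≠ f.half → 0 < g.half.gap z
  edge_ne : ∀ f ∈ l, ∀ e ∈ f.edges, e.1 ≠ e.2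
  edge_eq : ∀ f ∈ l, ∀ e ∈ f.edges, ∃ g ∈ l, g.half ≠ f.half ∧
    segment ℝ e.1 e.2 = f.face (polyhedron l) ∩ g.face (polyhedron l)
  complete : ∀ f ∈ l, ∀ g ∈ l, g.half ≠ f.half →
    (f.face (polyhedron l) ∩ g.face (polyhedron l)).Nontrivial →
    ∃ e ∈ f.edges, segment ℝ e.1 e.2 = f.face (polyhedron l) ∩ g.face (polyhedron l)
  distinct : ∀ f ∈ l, f.edges.Pairwise fun e e' => segment ℝ e.1 e.2 ≠ segment ℝ e'.1 e'.2

namespace IsRepresentation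

variable {c : Fin 3 → ℝ} {l : List (Facet ℝ)} (H : IsRepresentation c l)
include H

theorem eq_of_half_eq {f g : Facet ℝ} (hf : f ∈ l) (hg : g ∈ l) (h : f.half = g.half) : f = g := by
  by_contra hne
  have : Std.Symm fun f g : Facet ℝ => f.half ≠ g.half := ⟨fun _ _ h => h.symm⟩
  exact H.nodup.forall hf hg hne h

theorem eq_of_segment_eq {f : Facet ℝ} (hf : f ∈ l) {e e' : (Fin 3 → ℝ) × (Fin 3 → ℝ)}
    (he : e ∈ f.edges) (he' : e' ∈ f.edges) (h : segment ℝ e.1 e.2 = segment ℝ e'.1 e'.2) :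
    e = e' := by
  by_contra hne
  have : Std.Symm fun e e' : (Fin 3 → ℝ) × (Fin 3 → ℝ) =>
      segment ℝ e.1 e.2 ≠ segment ℝ e'.1 e'.2 := ⟨fun _ _ h => h.symm⟩
  exact (H.distinct f hf).forall he he' hne h

theorem normal_ne_zero {f : Facet ℝ} (hf : f ∈ l) : f.half.normal ≠ 0 := by
  intro h0
  obtain ⟨z, hz, -⟩ := H.strict f hf
  have h1 := H.center f hf
  simp only [Halfspace.gap, h0, zero_dotProduct] at hz h1
  linarith

/-- If two planes meet the plane of a facet in sets with two common points, then they meet it in the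
same line. -/
theorem gap_eq_zero_of_line {f : Facet ℝ} (hf : f ∈ l) {g g' : Halfspace ℝ}
    {x y z q : Fin 3 → ℝ} (hz : f.half.gap z = 0) (hzg : g.gap z ≠ 0) (hxy : x ≠ y)
    (fx : f.half.gap x = 0) (gx : g.gap x = 0) (gx' : g'.gap x = 0)
    (fy : f.half.gap y = 0) (gy : g.gap y = 0) (gy' : g'.gap y = 0)
    (fq : f.half.gap q = 0) (gq : g.gap q = 0) : g'.gap q = 0 := by
  -- All three differences are parallel to the plane of `f`. The functional of `g` vanishes on the
  -- last two but not on `z - x`, so the first coefficient is zero. Then `g'` must vanish at `q`,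
  -- since otherwise only a multiple of `y - x ≠ 0` is left in the relation.
  obtain ⟨a, b, c, habc, he⟩ := exists_dependency (H.normal_ne_zero hf) (r₁ := z - x) (r₂ := q - x)
    (r₃ := y - x) (by rw [f.half.dotProduct_normal_sub]; linarith)
    (by rw [f.half.dotProduct_normal_sub]; linarith) (by rw [f.half.dotProduct_normal_sub]; linarith)
  have e (m : Halfspace ℝ) : a * (m.gap x - m.gap z) + b * (m.gap x - m.gap q)
      + c * (m.gap x - m.gap y) = 0 := by
    have := congrArg (dotProduct m.normal) he
    simpa only [dotProduct_add, dotProduct_smul, m.dotProduct_normal_sub, smul_eq_mul,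
      dotProduct_zero] using this
  have e1 := e g
  rw [gx, gq, gy] at e1
  have ha : a = 0 := by
    have : a * g.gap z = 0 := by linarith
    exact (mul_eq_zero.1 this).resolve_right hzg
  have e2 := e g'
  rw [gx', gy', ha] at e2
  have hb : b * g'.gap q = 0 := by linarith
  refine (mul_eq_zero.1 hb).resolve_left fun hb => ?_
  subst ha hb
  rw [zero_smul, zero_smul, zero_add, zero_add] at he
  have hc : c ≠ 0 := by simpa using habc
  exact hxy (sub_eq_zero.1 ((smul_eq_zero.1 he).resolve_left hc)).symm

theorem gap_eq_zero_of_two_points {f g : Facet ℝ} {g' : Halfspace ℝ} (hf : f ∈ l) (hg : g ∈ l)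
    (hgf : g.half ≠ f.half) {x y q : Fin 3 → ℝ} (hxy : x ≠ y)
    (fx : f.half.gap x = 0) (gx : g.half.gap x = 0) (gx' : g'.gap x = 0)
    (fy : f.half.gap y = 0) (gy : g.half.gap y = 0) (gy' : g'.gap y = 0)
    (fq : f.half.gap q = 0) (gq : g.half.gap q = 0) : g'.gap q = 0 := by
  obtain ⟨z, hz, hstr⟩ := H.strict f hf
  exact H.gap_eq_zero_of_line hf hz (hstr g hg hgf).ne' hxy fx gx gx' fy gy gy' fq gq

/-- A point in which two facets meet lies on an edge of the first one. -/
theorem exists_edge_of_mem {f g : Facet ℝ} (hf : f ∈ l) (hg : g ∈ l) (hgf : g.half ≠ f.half)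
    {x : Fin 3 → ℝ} (hx : x ∈ polyhedron l) (fx : f.half.gap x = 0) (gx : g.half.gap x = 0) :
    ∃ e ∈ f.edges, x ∈ segment ℝ e.1 e.2 := by
  obtain ⟨z, hz, hstr⟩ := H.strict f hf
  set r := z - x with hr
  have hnr : dotProduct f.half.normal r = 0 := by
    rw [hr, Halfspace.dotProduct_normal_sub]; linarith
  have hgr : dotProduct g.half.normal r < 0 := by
    rw [hr, Halfspace.dotProduct_normal_sub]; linarith [hstr g hg hgf]
  have hr0 : r ≠ 0 := by rintro h; rw [h, dotProduct_zero] at hgr; exact lt_irrefl _ hgr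
  -- Near `x` a short segment is drawn in the plane of `f`, from the strict point `x + δ r` to the
  -- outside point `x + δ (-r + η w)`. The sideways component `w` keeps it from passing through `x`,
  -- and `η` is small enough that `g` is still violated at its end.
  obtain ⟨w, hw, hnw, hrw⟩ := exists_orthogonal_pair (H.normal_ne_zero hf) hr0 hnr
  obtain ⟨η, hη, hgη⟩ : ∃ η : ℝ, 0 < η ∧ 0 < dotProduct g.half.normal (-r + η • w) := by
    set m := dotProduct g.half.normal w
    refine ⟨-dotProduct g.half.normal r / (2 * (|m| + 1)), by
      have : 0 < -dotProduct g.half.normal r := by linarith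
      positivity, ?_⟩
    rw [dotProduct_add, dotProduct_neg, dotProduct_smul, smul_eq_mul]
    change 0 < -dotProduct g.half.normal r + _ * m
    rw [div_mul_eq_mul_div, ← sub_neg_eq_add, sub_pos, neg_div', div_lt_iff₀ (by positivity)]
    nlinarith [neg_abs_le m, abs_nonneg m]
  obtain ⟨ε, hε, hstep⟩ := exists_small_step l x (-r + η • w)
  set δ := min ε 1
  have hδ : 0 < δ := by positivity
  have hδ1 : δ ≤ 1 := min_le_right _ _
  have hstep' := hstep δ hδ.le (min_le_left _ _)
  have hgz (a : Facet ℝ) : a.half.gap (x + δ • r) = (1 - δ) * a.half.gap x + δ * a.half.gap z := by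
    rw [hr, Halfspace.gap_lineMap]
  have hzpos : ∀ a ∈ l, a.half ≠ f.half → 0 < a.half.gap (x + δ • r) := by
    intro a ha haf
    rw [hgz]
    have := mul_pos hδ (hstr a ha haf)
    have := mul_nonneg (sub_nonneg.2 hδ1) (hx a ha)
    linarith
  have hfz : f.half.gap (x + δ • r) = 0 := by rw [hgz, hz, fx]; ring
  have hyout : x + δ • (-r + η • w) ∉ polyhedron l := by
    intro h
    have := h g hg
    rw [Halfspace.gap_add_smul, gx] at this
    nlinarith
  obtain ⟨t, t0, t1, hp, a, ha, hap, hay⟩ :=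
    exists_exit (mem_polyhedron_of_strict hfz hzpos) hyout
  -- Constraints that are inactive at `x` stay positive at the end of the segment, so the one
  -- through which it exits is active at `x`.
  have ax : a.half.gap x = 0 := by
    by_contra hne
    have := hstep' a ha (lt_of_le_of_ne (hx a ha) (Ne.symm hne))
    linarith
  have haf : a.half ≠ f.half := by
    intro h
    rw [h, Halfspace.gap_add_smul, dotProduct_add, dotProduct_neg, hnr, dotProduct_smul, hnw, fx]
      at hay
    simp at hay
  set p := x + δ • r + t • (x + δ • (-r + η • w) - (x + δ • r)) with hpdef
  have ht : t ≠ 0 := by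
    rintro rfl
    rw [hpdef, zero_smul, add_zero] at hap
    exact (hzpos a ha haf).ne' hap
  -- The component of `p - x` along `w` is nonzero. So `f` and `a` share two points, and `complete`
  -- supplies an edge through `x`.
  have hpx : p ≠ x := by
    intro h
    have h2 : dotProduct w (p - x) = t * δ * η * dotProduct w w := by
      rw [hpdef]
      simp only [dotProduct_add, dotProduct_sub, dotProduct_smul, dotProduct_neg,
        dotProduct_comm w r, hrw, smul_eq_mul]
      ring
    rw [h, sub_self, dotProduct_zero] at h2
    have h3 : dotProduct w w ≠ 0 := fun h => hw (dotProduct_self_eq_zero.1 h)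
    exact mul_ne_zero (mul_ne_zero (mul_ne_zero ht hδ.ne') hη.ne') h3 h2.symm
  have hfp : f.half.gap p = 0 := by
    rw [hpdef, Halfspace.gap_lineMap, hfz, Halfspace.gap_add_smul, dotProduct_add, dotProduct_neg,
      hnr, dotProduct_smul, hnw, fx]
    simp
  have hxmem : x ∈ f.face (polyhedron l) ∩ a.face (polyhedron l) :=
    ⟨mem_face_polyhedron.2 ⟨hx, fx⟩, mem_face_polyhedron.2 ⟨hx, ax⟩⟩
  obtain ⟨e, he, hseg⟩ := H.complete f hf a ha haf
    ⟨p, ⟨mem_face_polyhedron.2 ⟨hp, hfp⟩, mem_face_polyhedron.2 ⟨hp, hap⟩⟩, x, hxmem, hpx⟩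
  exact ⟨e, he, hseg ▸ hxmem⟩

/-- An affine function that is positive at a point of a facet is positive at an endpoint of an edge. -/
theorem exists_edge_pos {f : Facet ℝ} (hf : f ∈ l) (h : Halfspace ℝ) {x : Fin 3 → ℝ}
    (hx : x ∈ polyhedron l) (fx : f.half.gap x = 0) (hpos : 0 < h.gap x) :
    ∃ e ∈ f.edges, 0 < h.gap e.1 ∨ 0 < h.gap e.2 := by
  -- Moving along `d` changes neither the gap of `f` nor that of `h`. The exit point is therefore on
  -- another facet, hence on an edge of `f`, and still has the positive value of `h`; so one end of
  -- that edge is positive.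
  obtain ⟨d, hd, hfd, hhd⟩ : ∃ d : Fin 3 → ℝ, d ≠ 0 ∧ dotProduct f.half.normal d = 0 ∧
      dotProduct h.normal d = 0 := exists_orthogonal _ _
  obtain ⟨t, ht, hout⟩ := exists_add_smul_notMem H.bounded x hd
  obtain ⟨s, s0, s1, hp, g, hg, hgp, hgy⟩ := exists_exit hx hout
  set p := x + s • (x + t • d - x) with hpdef
  have hval : ∀ k : Halfspace ℝ, dotProduct k.normal d = 0 → k.gap p = k.gap x := by
    intro k hk
    rw [hpdef, Halfspace.gap_lineMap, Halfspace.gap_add_smul, hk]; ring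
  have hgf : g.half ≠ f.half := by
    intro hh
    rw [hh, Halfspace.gap_add_smul, hfd, fx] at hgy
    simp at hgy
  obtain ⟨e, he, hpe⟩ := H.exists_edge_of_mem hf hg hgf hp ((hval _ hfd).trans fx) hgp
  refine ⟨e, he, ?_⟩
  obtain ⟨u, u0, u1, hu⟩ := mem_segment_iff_lineMap.1 hpe
  have h1 := hval h hhd
  rw [hu, Halfspace.gap_lineMap] at h1
  by_contra! hc
  have := mul_nonpos_of_nonneg_of_nonpos (sub_nonneg.2 u1) hc.1
  have := mul_nonpos_of_nonneg_of_nonpos u0 hc.2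
  linarith

/-- A negative value of an affine function on the polyhedron implies one at an endpoint of an edge. -/
theorem exists_edge_neg (h : Halfspace ℝ) {x : Fin 3 → ℝ}
    (hx : x ∈ polyhedron l) (hneg : h.gap x < 0) :
    ∃ f ∈ l, ∃ e ∈ f.edges, h.gap e.1 < 0 ∨ h.gap e.2 < 0 := by
  obtain ⟨d, hd, hhd, -⟩ := exists_orthogonal h.normal h.normal
  obtain ⟨t, ht, hout⟩ := exists_add_smul_notMem H.bounded x hd
  obtain ⟨s, s0, s1, hp, g, hg, hgp, hgy⟩ := exists_exit hx hout
  have hval : h.gap (x + s • (x + t • d - x)) = h.gap x := by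
    rw [Halfspace.gap_lineMap, Halfspace.gap_add_smul, hhd]; ring
  -- The exit point has the same negative gap as `x`, and the result on positive values is applied
  -- to the opposite halfspace.
  obtain ⟨e, he, hpos⟩ := H.exists_edge_pos hg ⟨-h.normal, -h.offset⟩ hp hgp (by
    have : (⟨-h.normal, -h.offset⟩ : Halfspace ℝ).gap (x + s • (x + t • d - x)) = - h.gap x := by
      rw [← hval]; simp only [Halfspace.gap, neg_dotProduct]; ring
    rw [this]; linarith)
  refine ⟨g, hg, e, he, ?_⟩
  have hn (y : Fin 3 → ℝ) : (⟨-h.normal, -h.offset⟩ : Halfspace ℝ).gap y = - h.gap y := by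
    simp only [Halfspace.gap, neg_dotProduct]; ring
  rw [hn, hn] at hpos
  rcases hpos with h | h
  · exact Or.inl (by linarith)
  · exact Or.inr (by linarith)

end IsRepresentation

/-! ### Sections of a facet by a plane -/

/-- The edge `e` has a point with positive gap, and `q` is its point on the plane. -/
structure CutsAt (h : Halfspace ℝ) (e : (Fin 3 → ℝ) × (Fin 3 → ℝ)) (q : Fin 3 → ℝ) : Prop where
  mem : q ∈ segment ℝ e.1 e.2
  gap_eq : h.gap q = 0
  exists_pos : ∃ p ∈ segment ℝ e.1 e.2, 0 < h.gap p

theorem gap_eq_zero_of_openSegment {h : Halfspace ℝ} {x y : Fin 3 → ℝ} {t : ℝ} (t0 : 0 < t)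
    (t1 : t < 1) (hx : 0 ≤ h.gap x) (hy : 0 ≤ h.gap y) (hq : h.gap (x + t • (y - x)) = 0) :
    h.gap x = 0 ∧ h.gap y = 0 := by
  rw [Halfspace.gap_lineMap] at hq
  constructor
  · by_contra hne
    have : 0 < h.gap x := lt_of_le_of_ne hx (Ne.symm hne)
    nlinarith [mul_nonneg t0.le hy, mul_pos (sub_pos.2 t1) this]
  · by_contra hne
    have : 0 < h.gap y := lt_of_le_of_ne hy (Ne.symm hne)
    nlinarith [mul_nonneg (sub_nonneg.2 t1.le) hx, mul_pos t0 this]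

/-- An affine function with two zeros on a line vanishes on all of it, which the point `p` excludes.
-/
theorem eq_of_gap_eq_zero {h : Halfspace ℝ} {u v p x y : Fin 3 → ℝ} (hp : p ∈ segment ℝ u v)
    (hpos : 0 < h.gap p) (hx : x ∈ segment ℝ u v) (hy : y ∈ segment ℝ u v)
    (hx0 : h.gap x = 0) (hy0 : h.gap y = 0) : x = y := by
  obtain ⟨r, -, -, rfl⟩ := mem_segment_iff_lineMap.1 hp
  obtain ⟨s, -, -, rfl⟩ := mem_segment_iff_lineMap.1 hx
  obtain ⟨t, -, -, rfl⟩ := mem_segment_iff_lineMap.1 hy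
  rw [Halfspace.gap_lineMap] at hpos hx0 hy0
  have h1 : (s - t) * (h.gap v - h.gap u) = 0 := by linear_combination hx0 - hy0
  rcases mul_eq_zero.1 h1 with h2 | h2
  · rw [sub_eq_zero.1 h2]
  · have h3 : h.gap v = h.gap u := by linarith
    rw [h3] at hpos hx0
    exact absurd hpos (by linarith)

theorem CutsAt.unique {h : Halfspace ℝ} {e : (Fin 3 → ℝ) × (Fin 3 → ℝ)} {x y : Fin 3 → ℝ}
    (hx : CutsAt h e x) (hy : CutsAt h e y) : x = y := by
  obtain ⟨p, hp, hpos⟩ := hx.exists_pos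
  exact eq_of_gap_eq_zero hp hpos hx.mem hy.mem hx.gap_eq hy.gap_eq

namespace IsRepresentation

variable {c : Fin 3 → ℝ} {l : List (Facet ℝ)} (H : IsRepresentation c l)
include H

theorem edge_spec {f : Facet ℝ} (hf : f ∈ l) {e : (Fin 3 → ℝ) × (Fin 3 → ℝ)} (he : e ∈ f.edges) :
    ∃ g ∈ l, g.half ≠ f.half ∧ ∀ x, x ∈ segment ℝ e.1 e.2 ↔
      x ∈ polyhedron l ∧ f.half.gap x = 0 ∧ g.half.gap x = 0 := by
  obtain ⟨g, hg, hne, hs⟩ := H.edge_eq f hf e he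
  refine ⟨g, hg, hne, fun x => ?_⟩
  rw [hs, Set.mem_inter_iff, mem_face_polyhedron, mem_face_polyhedron]
  tauto

theorem mem_of_mem_edge {f : Facet ℝ} (hf : f ∈ l) {e : (Fin 3 → ℝ) × (Fin 3 → ℝ)}
    (he : e ∈ f.edges) {x : Fin 3 → ℝ} (hx : x ∈ segment ℝ e.1 e.2) :
    x ∈ polyhedron l ∧ f.half.gap x = 0 := by
  obtain ⟨g, -, -, hs⟩ := H.edge_spec hf he
  exact ⟨((hs x).1 hx).1, ((hs x).1 hx).2.1⟩

/-- The planes of both neighbours meet the plane of `f` in the line through the two common points,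
so the two segments are the same part of the polyhedron, and a facet lists no segment twice. -/
theorem edge_eq_of_two_points {f : Facet ℝ} (hf : f ∈ l) {e e' : (Fin 3 → ℝ) × (Fin 3 → ℝ)}
    (he : e ∈ f.edges) (he' : e' ∈ f.edges) {x y : Fin 3 → ℝ} (hxy : x ≠ y)
    (hx : x ∈ segment ℝ e.1 e.2) (hy : y ∈ segment ℝ e.1 e.2)
    (hx' : x ∈ segment ℝ e'.1 e'.2) (hy' : y ∈ segment ℝ e'.1 e'.2) : e = e' := by
  obtain ⟨g, hg, hgf, hs⟩ := H.edge_spec hf he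
  obtain ⟨g', hg', hgf', hs'⟩ := H.edge_spec hf he'
  apply H.eq_of_segment_eq hf he he'
  ext q
  obtain ⟨-, fx, gx⟩ := (hs x).1 hx
  obtain ⟨-, fy, gy⟩ := (hs y).1 hy
  obtain ⟨-, -, gx'⟩ := (hs' x).1 hx'
  obtain ⟨-, -, gy'⟩ := (hs' y).1 hy'
  rw [hs, hs']
  constructor
  · rintro ⟨q1, q2, q3⟩
    exact ⟨q1, q2, H.gap_eq_zero_of_two_points hf hg hgf hxy fx gx gx' fy gy gy' q2 q3⟩
  · rintro ⟨q1, q2, q3⟩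
    exact ⟨q1, q2, H.gap_eq_zero_of_two_points hf hg' hgf' hxy fx gx' gx fy gy' gy q2 q3⟩

/-- At most two edges of a facet meet in a point. -/
theorem no_three_edges {f : Facet ℝ} (hf : f ∈ l) {e₁ e₂ e₃ : (Fin 3 → ℝ) × (Fin 3 → ℝ)}
    (he₁ : e₁ ∈ f.edges) (he₂ : e₂ ∈ f.edges) (he₃ : e₃ ∈ f.edges) (h12 : e₁ ≠ e₂)
    (h13 : e₁ ≠ e₃) (h23 : e₂ ≠ e₃) {v : Fin 3 → ℝ} (hv₁ : v ∈ segment ℝ e₁.1 e₁.2)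
    (hv₂ : v ∈ segment ℝ e₂.1 e₂.2) (hv₃ : v ∈ segment ℝ e₃.1 e₃.2) : False := by
  -- A second point is chosen on each edge through `v`. The normal of the neighbour along this edge
  -- supports the direction to that point, and it is strictly negative on the directions of other
  -- edges, as two edges with two common points are equal.
  have key : ∀ e ∈ f.edges, v ∈ segment ℝ e.1 e.2 → ∃ g : Halfspace ℝ, ∃ p : Fin 3 → ℝ,
      dotProduct f.half.normal (p - v) = 0 ∧ dotProduct g.normal (p - v) = 0 ∧ p ≠ v ∧
      p ∈ segment ℝ e.1 e.2 ∧ ∀ e' ∈ f.edges, ∀ p' ∈ segment ℝ e'.1 e'.2, p' ≠ v →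
        v ∈ segment ℝ e'.1 e'.2 → e ≠ e' → dotProduct g.normal (p' - v) < 0 := by
    intro e he hv
    obtain ⟨g, hg, hgf, hs⟩ := H.edge_spec hf he
    obtain ⟨p, hp, hpv⟩ : ∃ p ∈ segment ℝ e.1 e.2, p ≠ v := by
      by_cases h : e.1 = v
      · exact ⟨e.2, right_mem_segment _ _ _, fun h' => H.edge_ne f hf e he (h.trans h'.symm)⟩
      · exact ⟨e.1, left_mem_segment _ _ _, h⟩
    obtain ⟨-, fv, gv⟩ := (hs v).1 hv
    obtain ⟨-, fp, gp⟩ := (hs p).1 hp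
    refine ⟨g.half, p, by rw [Halfspace.dotProduct_normal_sub, fv, fp, sub_zero],
      by rw [Halfspace.dotProduct_normal_sub, gv, gp, sub_zero], hpv, hp, ?_⟩
    intro e' he' p' hp' hpv' hv' hne
    rw [Halfspace.dotProduct_normal_sub, gv, zero_sub, neg_lt_zero]
    obtain ⟨hpP, fp'⟩ := H.mem_of_mem_edge hf he' hp'
    refine lt_of_le_of_ne (hpP g hg) fun h0 => hne ?_
    exact H.edge_eq_of_two_points hf he he' hpv' ((hs p').2 ⟨hpP, fp', h0.symm⟩) hv hp' hv'
  obtain ⟨g₁, p₁, a1, b1, c1, d1, k1⟩ := key e₁ he₁ hv₁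
  obtain ⟨g₂, p₂, a2, b2, c2, d2, k2⟩ := key e₂ he₂ hv₂
  obtain ⟨g₃, p₃, a3, b3, c3, d3, k3⟩ := key e₃ he₃ hv₃
  exact no_three_supported (H.normal_ne_zero hf) a1 a2 a3 b1 b2 b3
    (k1 _ he₂ _ d2 c2 hv₂ h12) (k1 _ he₃ _ d3 c3 hv₃ h13) (k2 _ he₁ _ d1 c1 hv₁ h12.symm)
    (k2 _ he₃ _ d3 c3 hv₃ h23) (k3 _ he₁ _ d1 c1 hv₁ h13.symm) (k3 _ he₂ _ d2 c2 hv₂ h23.symm)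

/-- If two edges of a facet are cut in the same point, then the facet has only this point on the
cutting plane. -/
theorem eq_of_cutsAt_same {f : Facet ℝ} (hf : f ∈ l) {h : Halfspace ℝ}
    {e e' : (Fin 3 → ℝ) × (Fin 3 → ℝ)} (he : e ∈ f.edges) (he' : e' ∈ f.edges) (hne : e ≠ e')
    {q : Fin 3 → ℝ} (hq : CutsAt h e q) (hq' : CutsAt h e' q) {y : Fin 3 → ℝ}
    (hy : y ∈ polyhedron l) (fy : f.half.gap y = 0) (hy0 : h.gap y = 0) : y = q := by
  by_contra hyq
  have key : ∀ e ∈ f.edges, CutsAt h e q → ∃ g : Halfspace ℝ, ∃ p : Fin 3 → ℝ,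
      dotProduct f.half.normal (p - q) = 0 ∧ dotProduct g.normal (p - q) = 0 ∧
      dotProduct g.normal (y - q) < 0 ∧ dotProduct h.normal (p - q) < 0 ∧ p ≠ q ∧
      p ∈ segment ℝ e.1 e.2 ∧ ∀ e' ∈ f.edges, ∀ p' ∈ segment ℝ e'.1 e'.2, p' ≠ q →
        q ∈ segment ℝ e'.1 e'.2 → e ≠ e' → dotProduct g.normal (p' - q) < 0 := by
    intro e he hq
    obtain ⟨g, hg, hgf, hs⟩ := H.edge_spec hf he
    obtain ⟨p, hp, hpos⟩ := hq.exists_pos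
    obtain ⟨-, fv, gv⟩ := (hs q).1 hq.mem
    obtain ⟨-, fp, gp⟩ := (hs p).1 hp
    refine ⟨g.half, p, by rw [Halfspace.dotProduct_normal_sub, fv, fp, sub_zero],
      by rw [Halfspace.dotProduct_normal_sub, gv, gp, sub_zero], ?_,
      by rw [Halfspace.dotProduct_normal_sub, hq.gap_eq]; linarith, ?_, hp, ?_⟩
    · rw [Halfspace.dotProduct_normal_sub, gv, zero_sub, neg_lt_zero]
      refine lt_of_le_of_ne (hy g hg) fun h0 => hyq ?_
      exact eq_of_gap_eq_zero hp hpos ((hs y).2 ⟨hy, fy, h0.symm⟩) hq.mem hy0 hq.gap_eq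
    · rintro rfl
      exact hpos.ne' hq.gap_eq
    · intro e' he' p' hp' hpv' hv' hne
      rw [Halfspace.dotProduct_normal_sub, gv, zero_sub, neg_lt_zero]
      obtain ⟨hpP, fp'⟩ := H.mem_of_mem_edge hf he' hp'
      refine lt_of_le_of_ne (hpP g hg) fun h0 => hne ?_
      exact H.edge_eq_of_two_points hf he he' hpv' ((hs p').2 ⟨hpP, fp', h0.symm⟩) hq.mem hp' hv'
  obtain ⟨g₁, p₁, a1, b1, y1, z1, c1, d1, k1⟩ := key e he hq
  obtain ⟨g₂, p₂, a2, b2, y2, z2, c2, d2, k2⟩ := key e' he' hq'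
  have fq := (H.mem_of_mem_edge hf he hq.mem).2
  -- The third supported direction is `y - q`: it is parallel to the cutting plane, whereas both
  -- edges run from `q` strictly into the halfspace.
  exact no_three_supported (H.normal_ne_zero hf) a1 a2 (r₃ := y - q)
    (by rw [Halfspace.dotProduct_normal_sub, fq, fy, sub_zero]) b1 b2 (n₃ := h.normal)
    (by rw [Halfspace.dotProduct_normal_sub, hq.gap_eq, hy0, sub_zero])
    (k1 _ he' _ d2 c2 hq'.mem hne) y1 (k2 _ he _ d1 c1 hq.mem hne.symm) y2 z1 z2

theorem exists_strict_pos {f : Facet ℝ} (hf : f ∈ l) {h : Halfspace ℝ} {p : Fin 3 → ℝ}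
    (hp : p ∈ polyhedron l) (fp : f.half.gap p = 0) (hpos : 0 < h.gap p) :
    ∃ z, f.half.gap z = 0 ∧ (∀ g ∈ l, g.half ≠ f.half → 0 < g.half.gap z) ∧ 0 < h.gap z := by
  obtain ⟨z, fz, hz⟩ := H.strict f hf
  -- The halfspace `h` belongs to no facet of `l`, so it enters as a one-element list with a dummy
  -- edge list. A short step from `p` towards a strict point gains strictness and keeps `h`
  -- positive.
  obtain ⟨ε, hε, hstep⟩ := exists_small_step [⟨h, []⟩] p (z - p)
  have hδ : 0 < min ε 1 := by positivity
  refine ⟨p + min ε 1 • (z - p), ?_, fun g hg hgf => ?_, ?_⟩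
  · rw [Halfspace.gap_lineMap, fp, fz]; ring
  · rw [Halfspace.gap_lineMap]
    have := mul_nonneg (sub_nonneg.2 (min_le_right ε 1)) (hp g hg)
    have := mul_pos hδ (hz g hg hgf)
    linarith
  · exact hstep _ hδ.le (min_le_left _ _) ⟨h, []⟩ (by simp) hpos

/-- At an end of the section of a facet by a plane there is an edge that enters the halfspace. -/
theorem exists_cut_edge {f g : Facet ℝ} (hf : f ∈ l) {h : Halfspace ℝ} {x d z : Fin 3 → ℝ}
    (hx : x ∈ polyhedron l) (fx : f.half.gap x = 0) (hx0 : h.gap x = 0)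
    (fd : dotProduct f.half.normal d = 0) (hd : dotProduct h.normal d = 0)
    (fz : f.half.gap z = 0) (hz : ∀ g ∈ l, g.half ≠ f.half → 0 < g.half.gap z) (hz0 : 0 < h.gap z)
    (hg : g ∈ l) (gx : g.half.gap x = 0) (gd : 0 < dotProduct g.half.normal d) :
    ∃ e ∈ f.edges, CutsAt h e x ∧ ∃ α β : ℝ, 0 < α ∧ 0 < β ∧
      x + α • (z - x) + β • d ∈ segment ℝ e.1 e.2 := by
  -- As in `exists_edge_of_mem`, a short segment leaves the facet near `x`, now from `x + δ (z - x)`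
  -- to `x + δ d`. The gap of `h` decreases along it to zero, reached only at the outer end, so the
  -- exit point has positive gap.
  obtain ⟨ε, hε, hstep⟩ := exists_small_step l x d
  set δ := min ε 1
  have hδ : 0 < δ := by positivity
  have hδ1 : δ ≤ 1 := min_le_right _ _
  have hstep' := hstep δ hδ.le (min_le_left _ _)
  have hzpos : ∀ a ∈ l, a.half ≠ f.half → 0 < a.half.gap (x + δ • (z - x)) := by
    intro a ha haf
    rw [Halfspace.gap_lineMap]
    have := mul_pos hδ (hz a ha haf)
    have := mul_nonneg (sub_nonneg.2 hδ1) (hx a ha)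
    linarith
  have hfz : f.half.gap (x + δ • (z - x)) = 0 := by rw [Halfspace.gap_lineMap, fz, fx]; ring
  have hfd : f.half.gap (x + δ • d) = 0 := by rw [Halfspace.gap_add_smul, fx, fd]; ring
  have hout : x + δ • d ∉ polyhedron l := by
    intro hmem
    have := hmem g hg
    rw [Halfspace.gap_add_smul, gx] at this
    nlinarith
  obtain ⟨t, t0, t1, hp, a, ha, hap, hay⟩ :=
    exists_exit (mem_polyhedron_of_strict hfz hzpos) hout
  have ax : a.half.gap x = 0 := by
    by_contra hne
    have := hstep' a ha (lt_of_le_of_ne (hx a ha) (Ne.symm hne))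
    linarith
  have haf : a.half ≠ f.half := by
    intro hh
    rw [hh, hfd] at hay
    exact lt_irrefl _ hay
  set p := x + δ • (z - x) + t • (x + δ • d - (x + δ • (z - x))) with hpdef
  have ht : 0 < t := by
    refine lt_of_le_of_ne t0 ?_
    rintro rfl
    rw [hpdef, zero_smul, add_zero] at hap
    exact (hzpos a ha haf).ne' hap
  -- The two positive coefficients are part of the conclusion because they serve to distinguish the
  -- edges found at the two ends of a section.
  have hpeq : p = x + (δ * (1 - t)) • (z - x) + (δ * t) • d := by
    rw [hpdef]; module
  have hfp : f.half.gap p = 0 := by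
    rw [hpdef, Halfspace.gap_lineMap, hfz, hfd]; ring
  have hhp : 0 < h.gap p := by
    rw [hpdef, Halfspace.gap_lineMap, Halfspace.gap_lineMap, Halfspace.gap_add_smul, hd, hx0]
    have := mul_pos (mul_pos (sub_pos.2 t1) hδ) hz0
    linarith
  have hxp : p ≠ x := by
    rintro hh
    rw [hh, hx0] at hhp
    exact lt_irrefl _ hhp
  have hpm : p ∈ f.face (polyhedron l) ∩ a.face (polyhedron l) :=
    ⟨mem_face_polyhedron.2 ⟨hp, hfp⟩, mem_face_polyhedron.2 ⟨hp, hap⟩⟩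
  have hxm : x ∈ f.face (polyhedron l) ∩ a.face (polyhedron l) :=
    ⟨mem_face_polyhedron.2 ⟨hx, fx⟩, mem_face_polyhedron.2 ⟨hx, ax⟩⟩
  obtain ⟨e, he, hseg⟩ := H.complete f hf a ha haf ⟨p, hpm, x, hxm, hxp⟩
  rw [← hseg] at hpm hxm
  refine ⟨e, he, ⟨hxm, hx0, p, hpm, hhp⟩, δ * (1 - t), δ * t, mul_pos hδ (sub_pos.2 t1),
    mul_pos hδ ht, ?_⟩
  rw [← hpeq]
  exact hpm

/-- The section of a facet by a plane, if the facet has a point on the positive side of the plane: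
exactly two edges are cut, and their points on the plane span the section. -/
theorem facet_section {f : Facet ℝ} (hf : f ∈ l) {h : Halfspace ℝ} {p x₀ : Fin 3 → ℝ}
    (hp : p ∈ polyhedron l) (fp : f.half.gap p = 0) (hpos : 0 < h.gap p)
    (hx₀ : x₀ ∈ polyhedron l) (fx₀ : f.half.gap x₀ = 0) (hx₀0 : h.gap x₀ = 0) :
    ∃ e₁ ∈ f.edges, ∃ e₂ ∈ f.edges, e₁ ≠ e₂ ∧ ∃ x y, CutsAt h e₁ x ∧ CutsAt h e₂ y ∧
      (∀ q, q ∈ segment ℝ x y ↔ q ∈ polyhedron l ∧ f.half.gap q = 0 ∧ h.gap q = 0) ∧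
      ∀ e ∈ f.edges, ∀ q, CutsAt h e q → e = e₁ ∨ e = e₂ := by
  obtain ⟨z, fz, hz, hz0⟩ := H.exists_strict_pos hf hp fp hpos
  obtain ⟨d, hd, fd, hhd⟩ := exists_orthogonal f.half.normal h.normal
  -- The line of the section is followed from `x₀` until it leaves the polyhedron, once in each
  -- direction.
  have ends : ∀ d : Fin 3 → ℝ, d ≠ 0 → ∃ τ : ℝ, 0 ≤ τ ∧ x₀ + τ • d ∈ polyhedron l ∧
      ∃ g ∈ l, g.half.gap (x₀ + τ • d) = 0 ∧ 0 < dotProduct g.half.normal d := by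
    intro d hd
    obtain ⟨T, hT, hout⟩ := exists_add_smul_notMem H.bounded x₀ hd
    obtain ⟨t, t0, t1, hmem, g, hg, hg0, hgy⟩ := exists_exit hx₀ hout
    have heq : x₀ + t • (x₀ + T • d - x₀) = x₀ + (t * T) • d := by module
    rw [heq] at hmem hg0
    refine ⟨t * T, by positivity, hmem, g, hg, hg0, ?_⟩
    rw [Halfspace.gap_add_smul] at hgy
    have := hx₀ g hg
    by_contra! hc
    nlinarith
  obtain ⟨τ, τ0, hxP, g, hg, gx, gd⟩ := ends d hd
  obtain ⟨σ, σ0, hyP, g', hg', gy, gd'⟩ := ends (-d) (neg_ne_zero.2 hd)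
  set x := x₀ + τ • d with hxdef
  set y := x₀ + σ • (-d) with hydef
  have fx : f.half.gap x = 0 := by rw [hxdef, Halfspace.gap_add_smul, fd, fx₀]; ring
  have hx0 : h.gap x = 0 := by rw [hxdef, Halfspace.gap_add_smul, hhd, hx₀0]; ring
  have fy : f.half.gap y = 0 := by
    rw [hydef, Halfspace.gap_add_smul, dotProduct_neg, fd, fx₀]; ring
  have hy0 : h.gap y = 0 := by
    rw [hydef, Halfspace.gap_add_smul, dotProduct_neg, hhd, hx₀0]; ring
  obtain ⟨e₁, he₁, hc₁, α₁, β₁, hα₁, hβ₁, hm₁⟩ :=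
    H.exists_cut_edge hf hxP fx hx0 fd hhd fz hz hz0 hg gx gd
  obtain ⟨e₂, he₂, hc₂, α₂, β₂, hα₂, hβ₂, hm₂⟩ :=
    H.exists_cut_edge hf hyP fy hy0 (d := -d) (by rw [dotProduct_neg, fd, neg_zero])
      (by rw [dotProduct_neg, hhd, neg_zero]) fz hz hz0 hg' gy gd'
  have hsec : ∀ q, q ∈ segment ℝ x y ↔ q ∈ polyhedron l ∧ f.half.gap q = 0 ∧ h.gap q = 0 := by
    intro q
    constructor
    · intro hq
      refine ⟨(convex_polyhedron l).segment_subset hxP hyP hq, ?_⟩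
      obtain ⟨t, -, -, rfl⟩ := mem_segment_iff_lineMap.1 hq
      rw [Halfspace.gap_lineMap, Halfspace.gap_lineMap, fx, fy, hx0, hy0]
      constructor <;> ring
    · rintro ⟨hq, fq, hq0⟩
      -- Since `h` is positive at `z`, the point `q` must be `x₀` plus a multiple of `d`; the two
      -- exit facets bound this multiple from both sides.
      obtain ⟨a, b, k, habk, he⟩ := exists_dependency (H.normal_ne_zero hf) (r₁ := z - x₀)
        (r₂ := q - x₀) (r₃ := d) (by rw [f.half.dotProduct_normal_sub]; linarith)
        (by rw [f.half.dotProduct_normal_sub]; linarith) fd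
      have ha : a = 0 := by
        have := congrArg (dotProduct h.normal) he
        simp only [dotProduct_add, dotProduct_smul, h.dotProduct_normal_sub, smul_eq_mul,
          dotProduct_zero, hhd, hq0, hx₀0] at this
        have h2 : a * h.gap z = 0 := by linarith
        exact (mul_eq_zero.1 h2).resolve_right hz0.ne'
      subst ha
      rw [zero_smul, zero_add] at he
      have hb : b ≠ 0 := by
        rintro rfl
        rw [zero_smul, zero_add] at he
        have hk : k ≠ 0 := by simpa using habk
        exact hd ((smul_eq_zero.1 he).resolve_left hk)
      obtain ⟨s, hs⟩ : ∃ s : ℝ, q = x₀ + s • d := by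
        refine ⟨-(k / b), ?_⟩
        have h2 : b⁻¹ • (b • (q - x₀) + k • d) = 0 := by rw [he, smul_zero]
        rw [smul_add, smul_smul, inv_mul_cancel₀ hb, one_smul, smul_smul] at h2
        have h3 : q = x₀ - (b⁻¹ * k) • d := by
          rw [← sub_eq_zero, ← h2]; abel
        rw [h3, sub_eq_add_neg, ← neg_smul]
        congr 2
        field_simp
      have h1 := hq g hg
      have h2 := hq g' hg'
      rw [hs, Halfspace.gap_add_smul] at h1
      rw [hs, Halfspace.gap_add_smul] at h2
      rw [hxdef, Halfspace.gap_add_smul] at gx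
      rw [hydef, Halfspace.gap_add_smul] at gy
      rw [dotProduct_neg] at gy gd'
      have hsτ : s ≤ τ := by
        by_contra! hlt
        nlinarith
      have hsσ : -σ ≤ s := by
        by_contra! hlt
        nlinarith
      rw [mem_segment_iff_lineMap]
      -- The section may be a single point, where the parameter `(τ - s) / (τ + σ)` has no meaning.
      rcases eq_or_lt_of_le (add_nonneg τ0 σ0) with h0 | h0
      · have hτ : τ = 0 := by linarith
        have hs0 : s = 0 := by linarith
        refine ⟨0, le_rfl, zero_le_one, ?_⟩
        rw [hs, hxdef, hτ, hs0]; simp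
      · refine ⟨(τ - s) / (τ + σ), div_nonneg (by linarith) h0.le,
          (div_le_one h0).2 (by linarith), ?_⟩
        rw [hs, hxdef, hydef]
        have : (τ - s) / (τ + σ) * (τ + σ) = τ - s := by field_simp
        have h4 : x₀ + s • d = x₀ + (τ - (τ - s) / (τ + σ) * (τ + σ)) • d := by
          rw [this]; congr 2; ring
        rw [h4]
        module
  -- If one edge served both ends, then `x = y` and its neighbouring plane would contain `x`, `x +
  -- α₁ (z - x) + β₁ d` and `x + α₂ (z - x) - β₂ d`. Eliminating `d` puts the strict point `z` on
  -- that plane.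
  have hne : e₁ ≠ e₂ := by
    rintro rfl
    have hxy := hc₁.unique hc₂
    obtain ⟨a, ha, haf, hs⟩ := H.edge_spec hf he₁
    obtain ⟨-, -, ax⟩ := (hs x).1 hc₁.mem
    obtain ⟨-, -, a1⟩ := (hs _).1 hm₁
    obtain ⟨-, -, a2⟩ := (hs _).1 hm₂
    rw [← hxy] at a2
    rw [Halfspace.gap_add_smul, Halfspace.gap_lineMap, ax] at a1 a2
    rw [dotProduct_neg] at a2
    have h1 : (α₁ * β₂ + α₂ * β₁) * a.half.gap z = 0 := by linear_combination β₂ * a1 + β₁ * a2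
    exact mul_ne_zero (by positivity) (hz a ha haf).ne' h1
  refine ⟨e₁, he₁, e₂, he₂, hne, x, y, hc₁, hc₂, hsec, ?_⟩
  intro e he q hq
  -- A third cut edge would meet the section at an end or in between. At an end, the section shrinks
  -- to this point and three edges pass through it. In between, the neighbouring plane contains both
  -- ends, so `x` and `q` are distinct zeros of `h` on an edge that has a positive point.
  by_contra! hcon
  obtain ⟨hn1, hn2⟩ := hcon
  obtain ⟨hqP, fq⟩ := H.mem_of_mem_edge hf he hq.mem
  have hthree : q = x → q = y → False := by
    rintro rfl hqy
    rw [← hqy] at hc₂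
    exact H.no_three_edges hf he he₁ he₂ hn1 hn2 hne hq.mem hc₁.mem hc₂.mem
  by_cases hqx : q = x
  · subst hqx
    exact hthree rfl (H.eq_of_cutsAt_same hf he he₁ hn1 hq hc₁ hyP fy hy0).symm
  by_cases hqy : q = y
  · rw [hqy] at hq
    exact hthree (hqy.trans (H.eq_of_cutsAt_same hf he he₂ hn2 hq hc₂ hxP fx hx0).symm) hqy
  obtain ⟨t, t0, t1, ht⟩ := mem_segment_iff_lineMap.1 ((hsec q).2 ⟨hqP, fq, hq.gap_eq⟩)
  have t0' : 0 < t := lt_of_le_of_ne t0 (by rintro rfl; simp [hqx] at ht)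
  have t1' : t < 1 := lt_of_le_of_ne t1 (by rintro rfl; simp [hqy] at ht)
  obtain ⟨a, ha, haf, hs⟩ := H.edge_spec hf he
  have aq := ((hs q).1 hq.mem).2.2
  rw [ht] at aq
  have ax := (gap_eq_zero_of_openSegment t0' t1' (hxP a ha) (hyP a ha) aq).1
  obtain ⟨p', hp', hpos'⟩ := hq.exists_pos
  exact hqx (eq_of_gap_eq_zero hp' hpos' hq.mem ((hs x).2 ⟨hxP, fx, ax⟩) hq.gap_eq hx0)

end IsRepresentation

/-! ### Values of the primitives and of the cutting routines -/

namespace Timed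

@[simp] theorem val_bind {α β : Type} (m : Timed α) (f : α → Timed β) :
    (m >>= f).val = (f m.val).val := rfl

@[simp] theorem val_pure {α : Type} (a : α) : (pure a : Timed α).val = a := rfl

@[simp] theorem time_bind {α β : Type} (m : Timed α) (f : α → Timed β) :
    (m >>= f).time = m.time + (f m.val).time := rfl

@[simp] theorem time_pure {α : Type} (a : α) : (pure a : Timed α).time = 0 := rfl

@[simp] theorem val_push {α : Type} (a : α) (l : List α) : (push a l).val = a :: l := rfl

@[simp] theorem val_lt (x y : ℝ) : (lt x y).val = decide (x < y) := rfl

@[simp] theorem val_le (x y : ℝ) : (le x y).val = decide (x ≤ y) := rfl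

@[simp] theorem val_eq (x y : ℝ) : (eq x y).val = decide (x = y) := rfl

@[simp] theorem val_sub (x y : ℝ) : (sub x y).val = x - y := rfl

@[simp] theorem val_add (x y : ℝ) : (add x y).val = x + y := rfl

@[simp] theorem val_mul (x y : ℝ) : (mul x y).val = x * y := rfl

@[simp] theorem val_div (x y : ℝ) : (div x y).val = x / y := rfl

@[simp] theorem val_det2 (x y z w : ℝ) : (det2 x y z w).val = x * w - y * z := rfl

@[simp] theorem val_vadd (a b : Fin 3 → ℝ) : (vadd a b).val = a + b := by
  ext i; fin_cases i <;> rfl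

@[simp] theorem val_vsub (a b : Fin 3 → ℝ) : (vsub a b).val = a - b := by
  ext i; fin_cases i <;> rfl

@[simp] theorem val_vscale (t : ℝ) (a : Fin 3 → ℝ) : (vscale t a).val = t • a := by
  ext i; fin_cases i <;> rfl

@[simp] theorem val_dot (a b : Fin 3 → ℝ) : (dot a b).val = dotProduct a b := by
  rw [dotProduct, Fin.sum_univ_three]; rfl

@[simp] theorem val_cross (a b : Fin 3 → ℝ) : (cross a b).val = crossProduct a b := by
  rw [cross_apply]; rfl

@[simp] theorem val_veq (a b : Fin 3 → ℝ) : (veq a b).val = decide (a = b) := by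
  have : (veq a b).val = (decide (a 0 = b 0) && decide (a 1 = b 1) && decide (a 2 = b 2)) := rfl
  rw [this, ← Bool.decide_and, ← Bool.decide_and, decide_eq_decide, funext_iff, Fin.forall_fin_succ,
    Fin.forall_fin_succ, Fin.forall_fin_one, and_assoc]
  rfl

theorem val_forEach {α σ : Type} (f : σ → α → Timed σ) (l : List α) (s : σ) :
    (forEach f l s).val = l.foldl (fun s a => (f s a).val) s := by
  induction l generalizing s with
  | nil => rfl
  | cons a l ih => exact ih _

end Timed

@[simp] theorem val_slack (h : Halfspace ℝ) (x : Fin 3 → ℝ) : (slack h x).val = h.gap x := by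
  simp [slack, Halfspace.gap]

/-- Pushing reverses the order. In this form the loops that collect optional results become list
expressions about which membership and pairwise statements are easy. -/
theorem foldl_push_pair {α β γ : Type} (F : α → Option β) (G : α → Option γ) (l : List α)
    (st : List β × List γ) :
    l.foldl (fun st a => ((F a).elim st.1 (· :: st.1), (G a).elim st.2 (· :: st.2))) st =
      ((l.filterMap F).reverse ++ st.1, (l.filterMap G).reverse ++ st.2) := by
  induction l generalizing st with
  | nil => rfl
  | cons a l ih =>
    rw [List.foldl_cons, ih]
    cases hF : F a <;> cases hG : G a <;> simp [hF, hG]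

/-- The entries on which `F` is defined are a permutation of `[a, b]`; their order in the list is
not known, hence the two cases. -/
theorem filterMap_eq_pair {α β : Type} {F : α → Option β} {l : List α} (hl : l.Nodup)
    {a b : α} (hab : a ≠ b) (ha : a ∈ l) (hb : b ∈ l) {x y : β} (hx : F a = some x)
    (hy : F b = some y) (hF : ∀ e ∈ l, ∀ z, F e = some z → e = a ∨ e = b) :
    l.filterMap F = [x, y] ∨ l.filterMap F = [y, x] := by
  classical
  have h1 : (l.filter (fun e => (F e).isSome)).Perm [a, b] := by
    rw [List.perm_ext_iff_of_nodup (hl.filter _) (by simp [hab])]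
    intro e
    simp only [List.mem_filter, List.mem_cons, List.not_mem_nil, or_false]
    constructor
    · rintro ⟨he, hs⟩
      obtain ⟨z, hz⟩ := Option.isSome_iff_exists.1 hs
      exact hF e he z hz
    · rintro (rfl | rfl)
      · exact ⟨ha, by simp [hx]⟩
      · exact ⟨hb, by simp [hy]⟩
  have h2 : (l.filter (fun e => (F e).isSome)).filterMap F = l.filterMap F := by
    rw [List.filterMap_filter]
    congr 1
    ext e
    cases F e <;> simp
  have h3 := h1.filterMap F
  rw [h2] at h3
  have h4 : [a, b].filterMap F = [x, y] := by simp [hx, hy]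
  rw [h4] at h3
  obtain ⟨u, v, huv⟩ := List.length_eq_two.1 h3.length_eq
  rw [huv] at h3 ⊢
  have hu : u ∈ [x, y] := h3.subset (by simp)
  rcases (by simpa using hu : u = x ∨ u = y) with rfl | rfl
  · left
    rw [List.perm_singleton.1 ((List.perm_cons u).1 h3)]
  · right
    rw [List.perm_singleton.1 ((List.perm_cons u).1 (h3.trans (List.Perm.swap _ _ _)))]

theorem val_cutPoint (p q : Fin 3 → ℝ) (s r : ℝ) :
    (cutPoint p q s r).val = p + (s / (s - r)) • (q - p) := by
  simp [cutPoint]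

/-- Along the segment the gap is affine, starts positive and does not increase to a positive end, so
it is nonnegative exactly up to the parameter `h.gap p / (h.gap p - h.gap q)` of its zero. -/
theorem cutPoint_spec (h : Halfspace ℝ) {p q : Fin 3 → ℝ} (hp : 0 < h.gap p) (hq : h.gap q ≤ 0) :
    ∃ x, (cutPoint p q (h.gap p) (h.gap q)).val = x ∧ x ∈ segment ℝ p q ∧ h.gap x = 0 ∧ p ≠ x ∧
      ∀ y, y ∈ segment ℝ p x ↔ y ∈ segment ℝ p q ∧ 0 ≤ h.gap y := by
  rw [val_cutPoint]
  have hd : 0 < h.gap p - h.gap q := by linarith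
  set t := h.gap p / (h.gap p - h.gap q) with ht
  have t0 : 0 < t := div_pos hp hd
  have t1 : t ≤ 1 := (div_le_one hd).2 (by linarith)
  have htd : t * (h.gap p - h.gap q) = h.gap p := by rw [ht]; field_simp
  have hx : h.gap (p + t • (q - p)) = 0 := by rw [Halfspace.gap_lineMap]; linarith
  refine ⟨_, rfl, mem_segment_iff_lineMap.2 ⟨t, t0.le, t1, rfl⟩, hx, ?_, ?_⟩
  · intro he
    rw [← he] at hx
    exact hp.ne' hx
  intro y
  rw [mem_segment_iff_lineMap, mem_segment_iff_lineMap]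
  constructor
  · rintro ⟨s, s0, s1, rfl⟩
    refine ⟨⟨s * t, by positivity, by nlinarith, by module⟩, ?_⟩
    rw [Halfspace.gap_lineMap, hx]
    have := mul_nonneg (sub_nonneg.2 s1) hp.le
    linarith
  · rintro ⟨⟨s, s0, s1, rfl⟩, hy⟩
    rw [Halfspace.gap_lineMap] at hy
    have hst : s ≤ t := by
      rw [ht, le_div_iff₀ hd]; linarith
    refine ⟨s / t, by positivity, (div_le_one t0).2 hst, ?_⟩
    have : s = s / t * t := by field_simp
    nth_rewrite 1 [this]
    module

theorem val_cutEdge_pos_pos {h : Halfspace ℝ} {e : (Fin 3 → ℝ) × (Fin 3 → ℝ)}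
    (h1 : 0 < h.gap e.1) (h2 : 0 < h.gap e.2) : (cutEdge h e).val = (some e, none) := by
  simp [cutEdge, h1, h2]

theorem val_cutEdge_pos_nonpos {h : Halfspace ℝ} {e : (Fin 3 → ℝ) × (Fin 3 → ℝ)}
    (h1 : 0 < h.gap e.1) (h2 : h.gap e.2 ≤ 0) : (cutEdge h e).val =
      (some (e.1, (cutPoint e.1 e.2 (h.gap e.1) (h.gap e.2)).val),
        some (cutPoint e.1 e.2 (h.gap e.1) (h.gap e.2)).val) := by
  simp [cutEdge, h1, h2.not_gt]

theorem val_cutEdge_nonpos_pos {h : Halfspace ℝ} {e : (Fin 3 → ℝ) × (Fin 3 → ℝ)}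
    (h1 : h.gap e.1 ≤ 0) (h2 : 0 < h.gap e.2) : (cutEdge h e).val =
      (some ((cutPoint e.2 e.1 (h.gap e.2) (h.gap e.1)).val, e.2),
        some (cutPoint e.2 e.1 (h.gap e.2) (h.gap e.1)).val) := by
  simp [cutEdge, h2, h1.not_gt]

theorem val_cutEdge_nonpos_nonpos {h : Halfspace ℝ} {e : (Fin 3 → ℝ) × (Fin 3 → ℝ)}
    (h1 : h.gap e.1 ≤ 0) (h2 : h.gap e.2 ≤ 0) : (cutEdge h e).val = (none, none) := by
  simp [cutEdge, h2.not_gt, h1.not_gt]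

theorem gap_segment_nonneg {h : Halfspace ℝ} {p q x : Fin 3 → ℝ} (hp : 0 ≤ h.gap p)
    (hq : 0 ≤ h.gap q) (hx : x ∈ segment ℝ p q) : 0 ≤ h.gap x := by
  obtain ⟨t, t0, t1, rfl⟩ := mem_segment_iff_lineMap.1 hx
  rw [Halfspace.gap_lineMap]
  exact add_nonneg (mul_nonneg (sub_nonneg.2 t1) hp) (mul_nonneg t0 hq)

theorem gap_segment_pos {h : Halfspace ℝ} {p q x : Fin 3 → ℝ} (hp : 0 < h.gap p)
    (hq : 0 < h.gap q) (hx : x ∈ segment ℝ p q) : 0 < h.gap x := by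
  obtain ⟨t, t0, t1, rfl⟩ := mem_segment_iff_lineMap.1 hx
  rw [Halfspace.gap_lineMap]
  rcases eq_or_lt_of_le t0 with rfl | t0
  · linarith
  · have := mul_nonneg (sub_nonneg.2 t1) hp.le
    have := mul_pos t0 hq
    linarith

theorem gap_segment_nonpos {h : Halfspace ℝ} {p q x : Fin 3 → ℝ} (hp : h.gap p ≤ 0)
    (hq : h.gap q ≤ 0) (hx : x ∈ segment ℝ p q) : h.gap x ≤ 0 := by
  obtain ⟨t, t0, t1, rfl⟩ := mem_segment_iff_lineMap.1 hx
  rw [Halfspace.gap_lineMap]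
  have := mul_nonpos_of_nonneg_of_nonpos (sub_nonneg.2 t1) hp
  have := mul_nonpos_of_nonneg_of_nonpos t0 hq
  linarith

theorem cutEdge_fst_eq_none {h : Halfspace ℝ} {e : (Fin 3 → ℝ) × (Fin 3 → ℝ)} :
    (cutEdge h e).val.1 = none ↔ h.gap e.1 ≤ 0 ∧ h.gap e.2 ≤ 0 := by
  rcases lt_or_ge 0 (h.gap e.1) with h1 | h1 <;> rcases lt_or_ge 0 (h.gap e.2) with h2 | h2
  · simp [val_cutEdge_pos_pos h1 h2, h1]
  · simp [val_cutEdge_pos_nonpos h1 h2, h1]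
  · simp [val_cutEdge_nonpos_pos h1 h2, h2]
  · simp [val_cutEdge_nonpos_nonpos h1 h2, h2, h1]

theorem cutEdge_fst_eq_some {h : Halfspace ℝ} {e e' : (Fin 3 → ℝ) × (Fin 3 → ℝ)} (hne : e.1 ≠ e.2)
    (he : (cutEdge h e).val.1 = some e') :
    e'.1 ≠ e'.2 ∧ (0 < h.gap e'.1 ∨ 0 < h.gap e'.2) ∧
      ∀ x, x ∈ segment ℝ e'.1 e'.2 ↔ x ∈ segment ℝ e.1 e.2 ∧ 0 ≤ h.gap x := by
  rcases lt_or_ge 0 (h.gap e.1) with h1 | h1 <;> rcases lt_or_ge 0 (h.gap e.2) with h2 | h2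
  · rw [val_cutEdge_pos_pos h1 h2] at he
    obtain rfl : e = e' := by simpa using he
    exact ⟨hne, Or.inl h1, fun x => ⟨fun hx => ⟨hx, gap_segment_nonneg h1.le h2.le hx⟩, And.left⟩⟩
  · obtain ⟨x, hx, -, -, hn, hs⟩ := cutPoint_spec h h1 h2
    rw [val_cutEdge_pos_nonpos h1 h2, hx] at he
    obtain rfl : (e.1, x) = e' := by simpa using he
    exact ⟨hn, Or.inl h1, hs⟩
  · obtain ⟨x, hx, -, -, hn, hs⟩ := cutPoint_spec h h2 h1
    rw [val_cutEdge_nonpos_pos h1 h2, hx] at he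
    obtain rfl : (x, e.2) = e' := by simpa using he
    refine ⟨hn.symm, Or.inr h2, fun y => ?_⟩
    rw [segment_symm, hs, segment_symm]
  · simp [val_cutEdge_nonpos_nonpos h1 h2] at he

/-- For the converse direction: an edge with a positive point and a point on the plane has one
positive and one nonpositive endpoint, so the routine returns some point, and `CutsAt.unique`
identifies it. -/
theorem cutEdge_snd_eq_some {h : Halfspace ℝ} {e : (Fin 3 → ℝ) × (Fin 3 → ℝ)} {q : Fin 3 → ℝ} :
    (cutEdge h e).val.2 = some q ↔ CutsAt h e q := by
  have hmp : ∀ q, (cutEdge h e).val.2 = some q → CutsAt h e q := by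
    intro q he
    rcases lt_or_ge 0 (h.gap e.1) with h1 | h1 <;> rcases lt_or_ge 0 (h.gap e.2) with h2 | h2
    · simp [val_cutEdge_pos_pos h1 h2] at he
    · obtain ⟨x, hx, hm, h0, -, -⟩ := cutPoint_spec h h1 h2
      rw [val_cutEdge_pos_nonpos h1 h2, hx] at he
      obtain rfl : x = q := by simpa using he
      exact ⟨hm, h0, e.1, left_mem_segment _ _ _, h1⟩
    · obtain ⟨x, hx, hm, h0, -, -⟩ := cutPoint_spec h h2 h1
      rw [val_cutEdge_nonpos_pos h1 h2, hx] at he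
      obtain rfl : x = q := by simpa using he
      exact ⟨segment_symm ℝ e.1 e.2 ▸ hm, h0, e.2, right_mem_segment _ _ _, h2⟩
    · simp [val_cutEdge_nonpos_nonpos h1 h2] at he
  refine ⟨hmp q, fun hc => ?_⟩
  have hsome : ∃ q', (cutEdge h e).val.2 = some q' := by
    obtain ⟨p, hp, hpos⟩ := hc.exists_pos
    rcases lt_or_ge 0 (h.gap e.1) with h1 | h1 <;> rcases lt_or_ge 0 (h.gap e.2) with h2 | h2
    · exact absurd hc.gap_eq (gap_segment_pos h1 h2 hc.mem).ne'
    · exact ⟨_, by rw [val_cutEdge_pos_nonpos h1 h2]⟩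
    · exact ⟨_, by rw [val_cutEdge_nonpos_pos h1 h2]⟩
    · exact absurd hpos (gap_segment_nonpos h1 h2 hp).not_gt
  obtain ⟨q', hq'⟩ := hsome
  rw [hq', (hmp q' hq').unique hc]

theorem val_cutEdges (h : Halfspace ℝ) (es : List ((Fin 3 → ℝ) × (Fin 3 → ℝ))) :
    (cutEdges h es).val = ((es.filterMap fun e => (cutEdge h e).val.1).reverse,
      (es.filterMap fun e => (cutEdge h e).val.2).reverse) := by
  rw [cutEdges, Timed.val_forEach]
  have := foldl_push_pair (fun e => (cutEdge h e).val.1) (fun e => (cutEdge h e).val.2) es ([], [])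
  simp only [List.append_nil] at this
  rw [← this]
  congr 1
  ext st e : 2
  simp only [Timed.val_bind, Timed.val_pure]
  rcases (cutEdge h e).val with ⟨_ | a, _ | b⟩ <;> rfl

/-- Some vertex of the facet has positive gap. -/
def Facet.Survives (h : Halfspace ℝ) (f : Facet ℝ) : Prop :=
  ∃ e ∈ f.edges, 0 < h.gap e.1 ∨ 0 < h.gap e.2

theorem val_isViolated (h : Halfspace ℝ) (l : List (Facet ℝ)) :
    (isViolated h l).val = true ↔ ∃ f ∈ l, ∃ e ∈ f.edges, h.gap e.1 < 0 ∨ h.gap e.2 < 0 := by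
  have inner (es : List ((Fin 3 → ℝ) × (Fin 3 → ℝ))) (b : Bool) :
      es.foldl (fun b e => b || decide (h.gap e.1 < 0) || decide (h.gap e.2 < 0)) b = true ↔
        b = true ∨ ∃ e ∈ es, h.gap e.1 < 0 ∨ h.gap e.2 < 0 := by
    induction es generalizing b with
    | nil => simp
    | cons e es ih => rw [List.foldl_cons, ih]; simp [or_assoc]
  have outer (l : List (Facet ℝ)) (b : Bool) :
      l.foldl (fun b f => f.edges.foldl
        (fun b e => b || decide (h.gap e.1 < 0) || decide (h.gap e.2 < 0)) b) b = true ↔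
        b = true ∨ ∃ f ∈ l, ∃ e ∈ f.edges, h.gap e.1 < 0 ∨ h.gap e.2 < 0 := by
    induction l generalizing b with
    | nil => simp
    | cons f l ih => rw [List.foldl_cons, ih, inner]; simp [or_assoc]
  rw [isViolated, Timed.val_forEach]
  simp only [Timed.val_forEach, Timed.val_bind, val_slack, Timed.val_lt, Timed.val_pure]
  rw [outer]
  simp

theorem val_cutPolyhedron (h : Halfspace ℝ) (l : List (Facet ℝ)) :
    (cutPolyhedron l h).val = if (isViolated h l).val = true then
      ⟨h, (l.filterMap fun f => (cutFacet h f).val.2).reverse⟩ ::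
        (l.filterMap fun f => (cutFacet h f).val.1).reverse else l := by
  have := foldl_push_pair (fun f => (cutFacet h f).val.1) (fun f => (cutFacet h f).val.2) l ([], [])
  simp only [List.append_nil] at this
  rw [cutPolyhedron, Timed.val_bind]
  cases (isViolated h l).val
  · rfl
  · simp only [Timed.val_bind, Timed.val_forEach, Timed.val_push, if_true]
    refine (congrArg (fun X : List (Facet ℝ) × List ((Fin 3 → ℝ) × (Fin 3 → ℝ)) =>
      (⟨h, X.2⟩ : Facet ℝ) :: X.1) (Eq.trans ?_ this) :)
    congr 1
    ext st f : 2
    simp only [Timed.val_pure]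
    rcases (cutFacet h f).val with ⟨_ | a, _ | b⟩ <;> rfl

theorem mem_filterMap_reverse {α β : Type} {F : α → Option β} {l : List α} {b : β} :
    b ∈ (l.filterMap F).reverse ↔ ∃ a ∈ l, F a = some b := by simp

namespace IsRepresentation

variable {c : Fin 3 → ℝ} {l : List (Facet ℝ)} (H : IsRepresentation c l)
include H

omit H in
theorem val_cutFacet_of_not_survives {h : Halfspace ℝ} {f : Facet ℝ} (hs : ¬ f.Survives h) :
    (cutFacet h f).val = (none, none) := by
  have : (f.edges.filterMap fun e => (cutEdge h e).val.1) = [] := by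
    rw [List.filterMap_eq_nil_iff]
    intro e he
    rw [cutEdge_fst_eq_none]
    by_contra hc
    refine hs ⟨e, he, ?_⟩
    rw [not_and_or, not_le, not_le] at hc
    exact hc
  simp [cutFacet, val_cutEdges, this]

/-- By `facet_section` a surviving facet has two cut edges if it meets the plane and none otherwise,
so testing for a list of exactly two points loses nothing. The two points coincide when the section
is a single point; then no edge is added. -/
theorem val_cutFacet_of_survives {h : Halfspace ℝ} {f : Facet ℝ} (hf : f ∈ l)
    (hs : f.Survives h) :
    ∃ o : Option ((Fin 3 → ℝ) × (Fin 3 → ℝ)), (cutFacet h f).val =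
      (some ⟨f.half, o.toList ++ (f.edges.filterMap fun e => (cutEdge h e).val.1).reverse⟩, o) ∧
      (∀ e, o = some e → e.1 ≠ e.2 ∧ ∀ q, q ∈ segment ℝ e.1 e.2 ↔
        q ∈ polyhedron l ∧ f.half.gap q = 0 ∧ h.gap q = 0) ∧
      (o = none → ∀ x y, x ∈ polyhedron l → f.half.gap x = 0 → h.gap x = 0 →
        y ∈ polyhedron l → f.half.gap y = 0 → h.gap y = 0 → x = y) := by
  obtain ⟨e, he, hpos⟩ := hs
  obtain ⟨p, hpe, hp0⟩ : ∃ p ∈ segment ℝ e.1 e.2, 0 < h.gap p := by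
    rcases hpos with hpos | hpos
    exacts [⟨_, left_mem_segment _ _ _, hpos⟩, ⟨_, right_mem_segment _ _ _, hpos⟩]
  obtain ⟨hp, fp⟩ := H.mem_of_mem_edge hf he hpe
  obtain ⟨k, ks, hk⟩ : ∃ k ks,
      (f.edges.filterMap fun e => (cutEdge h e).val.1).reverse = k :: ks := by
    rw [← List.ne_nil_iff_exists_cons, ne_eq, List.reverse_eq_nil_iff, List.filterMap_eq_nil_iff]
    intro hc
    have := cutEdge_fst_eq_none.1 (hc e he)
    rcases hpos with hpos | hpos <;> linarith
  have hcut : (cutFacet h f).val = (match (f.edges.filterMap fun e => (cutEdge h e).val.2).reverse with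
    | [x, y] => if x = y then (some ⟨f.half, k :: ks⟩, none)
        else (some ⟨f.half, (x, y) :: k :: ks⟩, some (x, y))
    | _ => (some ⟨f.half, k :: ks⟩, none)) := by
    rw [cutFacet, Timed.val_bind, val_cutEdges, hk]
    rcases (f.edges.filterMap fun e => (cutEdge h e).val.2).reverse with
      _ | ⟨x, _ | ⟨y, _ | ⟨z, r⟩⟩⟩
    · rfl
    · rfl
    · by_cases hxy : x = y
      · simp [hxy]
      · simp [hxy]
    · rfl
  rw [hcut, hk]
  by_cases hsec : ∃ x₀ ∈ polyhedron l, f.half.gap x₀ = 0 ∧ h.gap x₀ = 0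
  · obtain ⟨x₀, hx₀, fx₀, hx₀0⟩ := hsec
    obtain ⟨e₁, he₁, e₂, he₂, hne, x, y, hc₁, hc₂, hsec, huniq⟩ :=
      H.facet_section hf hp fp hp0 hx₀ fx₀ hx₀0
    have hnd : f.edges.Nodup := (H.distinct f hf).imp fun {a b} h hab => h (by rw [hab])
    have hpair : ∃ u v, (f.edges.filterMap fun e => (cutEdge h e).val.2).reverse = [u, v] ∧
        ∀ q, q ∈ segment ℝ u v ↔ q ∈ polyhedron l ∧ f.half.gap q = 0 ∧ h.gap q = 0 := by
      rcases filterMap_eq_pair (F := fun e => (cutEdge h e).val.2) hnd hne he₁ he₂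
        (cutEdge_snd_eq_some.2 hc₁) (cutEdge_snd_eq_some.2 hc₂)
        (fun e he z hz => huniq e he z (cutEdge_snd_eq_some.1 hz)) with h1 | h1
      · exact ⟨y, x, by rw [h1]; rfl, fun q => by rw [segment_symm]; exact hsec q⟩
      · exact ⟨x, y, by rw [h1]; rfl, hsec⟩
    obtain ⟨u, v, huv, hsec⟩ := hpair
    rw [huv]
    by_cases h0 : u = v
    · refine ⟨none, by simp [h0], by simp, fun _ a b a1 a2 a3 b1 b2 b3 => ?_⟩
      have ha := (hsec a).2 ⟨a1, a2, a3⟩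
      have hb := (hsec b).2 ⟨b1, b2, b3⟩
      rw [h0, segment_same, Set.mem_singleton_iff] at ha hb
      rw [ha, hb]
    · refine ⟨some (u, v), by simp [h0], ?_, by simp⟩
      rintro e he
      obtain rfl : (u, v) = e := by simpa using he
      exact ⟨h0, hsec⟩
  · have hnil : (f.edges.filterMap fun e => (cutEdge h e).val.2) = [] := by
      rw [List.filterMap_eq_nil_iff]
      intro e he
      by_contra hc
      obtain ⟨q, hq⟩ := Option.ne_none_iff_exists'.1 hc
      have hq' := cutEdge_snd_eq_some.1 hq
      have := H.mem_of_mem_edge hf he hq'.mem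
      exact hsec ⟨q, this.1, this.2, hq'.gap_eq⟩
    refine ⟨none, by simp [hnil], by simp, fun _ x y h1 h2 h3 => ?_⟩
    exact absurd ⟨x, h1, h2, h3⟩ hsec

end IsRepresentation

/-! ### Cutting preserves the invariant -/

namespace IsRepresentation

variable {c : Fin 3 → ℝ} {l : List (Facet ℝ)} (H : IsRepresentation c l)
include H

/-- Two facets that meet a plane in the same segment coincide. -/
theorem half_eq_of_section_eq {f g : Facet ℝ} (hf : f ∈ l) (hg : g ∈ l) {h : Halfspace ℝ}
    {x y p p' z : Fin 3 → ℝ} (hxy : x ≠ y) (fx : f.half.gap x = 0) (gx : g.half.gap x = 0)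
    (hx : h.gap x = 0) (fy : f.half.gap y = 0) (gy : g.half.gap y = 0) (hy : h.gap y = 0)
    (hp : p ∈ polyhedron l) (fp : f.half.gap p = 0) (hp0 : 0 < h.gap p)
    (hp' : p' ∈ polyhedron l) (gp' : g.half.gap p' = 0) (hp0' : 0 < h.gap p')
    (hz : h.gap z = 0) (hzl : ∀ f ∈ l, 0 < f.half.gap z) : f.half = g.half := by
  by_contra hne
  have e (k : Halfspace ℝ) (q : Fin 3 → ℝ) (hk : k.gap x = 0) :
      dotProduct (q - x) k.normal = - k.gap q := by
    rw [dotProduct_comm, k.dotProduct_normal_sub, hk, zero_sub]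
  have gp : 0 < g.half.gap p := lt_of_le_of_ne (hp g hg) fun h0 => hp0.ne' <|
    H.gap_eq_zero_of_two_points hf hg (Ne.symm hne) hxy fx gx hx fy gy hy fp h0.symm
  have fp' : 0 < f.half.gap p' := lt_of_le_of_ne (hp' f hf) fun h0 => hp0'.ne' <|
    H.gap_eq_zero_of_two_points hg hf hne hxy gx fx hx gy fy hy gp' h0.symm
  -- The roles are dual here: the three normals are the vectors, all orthogonal to the common line,
  -- and the points `p`, `p'`, `z`, one on each plane and strictly inside the other two halfspaces,
  -- act as functionals.
  refine no_three_supported (n := y - x) (r₁ := f.half.normal) (r₂ := g.half.normal)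
    (r₃ := h.normal) (n₁ := p - x) (n₂ := p' - x) (n₃ := z - x) (sub_ne_zero.2 hxy.symm)
    ?_ ?_ ?_ ?_ ?_ ?_ ?_ ?_ ?_ ?_ ?_ ?_ <;> first | rw [e _ _ fx] | rw [e _ _ gx] | rw [e _ _ hx]
  all_goals first | linarith | linarith [hzl f hf] | linarith [hzl g hg]

/-- Cutting a polyhedron by a violated halfspace. -/
theorem cut {h : Halfspace ℝ} (hc : 0 < h.gap c) {v : Fin 3 → ℝ} (hv : v ∈ polyhedron l)
    (hv0 : h.gap v < 0) :
    IsRepresentation c (⟨h, (l.filterMap fun f => (cutFacet h f).val.2).reverse⟩ ::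
        (l.filterMap fun f => (cutFacet h f).val.1).reverse) ∧
      polyhedron (⟨h, (l.filterMap fun f => (cutFacet h f).val.2).reverse⟩ ::
        (l.filterMap fun f => (cutFacet h f).val.1).reverse) =
          {x ∈ polyhedron l | 0 ≤ h.gap x} := by
  set es := (l.filterMap fun f => (cutFacet h f).val.2).reverse with hes
  set fs := (l.filterMap fun f => (cutFacet h f).val.1).reverse with hfs
  have mem_es : ∀ e, e ∈ es ↔ ∃ f ∈ l, (cutFacet h f).val.2 = some e := fun e =>
    mem_filterMap_reverse
  have mem_fs : ∀ f', f' ∈ fs ↔ ∃ f ∈ l, (cutFacet h f).val.1 = some f' := fun e =>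
    mem_filterMap_reverse
  have surv : ∀ f ∈ l, f.Survives h → ∃ f' ∈ fs, (cutFacet h f).val.1 = some f' ∧
      f'.half = f.half := by
    intro f hf hs
    obtain ⟨o, ho, -, -⟩ := H.val_cutFacet_of_survives hf hs
    have h1 : (cutFacet h f).val.1 = some ⟨f.half, o.toList ++
      (f.edges.filterMap fun e => (cutEdge h e).val.1).reverse⟩ := by rw [ho]
    exact ⟨_, (mem_fs _).2 ⟨f, hf, h1⟩, h1, rfl⟩
  have inv : ∀ f ∈ l, ∀ f', (cutFacet h f).val.1 = some f' → f.Survives h ∧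
      f'.half = f.half := by
    intro f hf f' hf'
    by_cases hs : f.Survives h
    · obtain ⟨o, ho, -, -⟩ := H.val_cutFacet_of_survives hf hs
      rw [ho] at hf'
      refine ⟨hs, ?_⟩
      rw [← Option.some.inj hf']
    · rw [val_cutFacet_of_not_survives hs] at hf'
      exact absurd hf' (by simp)
  have survives_of_pos : ∀ f ∈ l, ∀ x ∈ polyhedron l, f.half.gap x = 0 → 0 < h.gap x →
      f.Survives h := fun f hf x hx fx hpos => H.exists_edge_pos hf h hx fx hpos
  have pos_of_survives : ∀ f ∈ l, f.Survives h → ∃ p ∈ polyhedron l, f.half.gap p = 0 ∧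
      0 < h.gap p := by
    rintro f hf ⟨e, he, hpos | hpos⟩
    · have := H.mem_of_mem_edge hf he (left_mem_segment _ _ _)
      exact ⟨_, this.1, this.2, hpos⟩
    · have := H.mem_of_mem_edge hf he (right_mem_segment _ _ _)
      exact ⟨_, this.1, this.2, hpos⟩
  have mem_poly : ∀ x, x ∈ polyhedron (⟨h, es⟩ :: fs) ↔ x ∈ polyhedron l ∧ 0 ≤ h.gap x := by
    intro x
    constructor
    · intro hx
      have hx0 : 0 ≤ h.gap x := hx ⟨h, es⟩ List.mem_cons_self
      refine ⟨?_, hx0⟩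
      -- If `x` violates an old halfspace, the segment from the centre leaves the old polyhedron
      -- through a facet at a point of positive gap. This facet survives the cut, so its halfspace
      -- is still listed, but `x` violates it.
      by_contra hxl
      have hcl : c ∈ polyhedron l := fun f hf => (H.center f hf).le
      obtain ⟨t, t0, t1, hp, g, hg, hgp, hgx⟩ := exists_exit hcl hxl
      have hpos : 0 < h.gap (c + t • (x - c)) := by
        rw [Halfspace.gap_lineMap]
        have := mul_pos (sub_pos.2 t1) hc
        have := mul_nonneg t0 hx0
        linarith
      obtain ⟨g', hg', -, hh⟩ := surv g hg (survives_of_pos g hg _ hp hgp hpos)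
      have := hx g' (List.mem_cons_of_mem _ hg')
      rw [hh] at this
      linarith
    · rintro ⟨hx, hx0⟩ f' hf'
      rcases List.mem_cons.1 hf' with rfl | hf'
      · exact hx0
      · obtain ⟨f, hf, hff⟩ := (mem_fs f').1 hf'
        rw [(inv f hf f' hff).2]
        exact hx f hf
  have old : ∀ f' ∈ fs, ∃ f ∈ l, f.Survives h ∧ f'.half = f.half ∧
      (cutFacet h f).val.1 = some f' := by
    intro f' hf'
    obtain ⟨f, hf, hff⟩ := (mem_fs f').1 hf'
    exact ⟨f, hf, (inv f hf f' hff).1, (inv f hf f' hff).2, hff⟩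
  have h_ne : ∀ f ∈ l, f.half ≠ h := by
    intro f hf hfh
    have := hv f hf
    rw [hfh] at this
    linarith
  -- The segment from the centre to the violating point `v` crosses the cutting plane strictly
  -- inside all old halfspaces; this is the strict point of the new facet.
  obtain ⟨z, hz, hzl⟩ : ∃ z, h.gap z = 0 ∧ ∀ f ∈ l, 0 < f.half.gap z := by
    have hd : 0 < h.gap c - h.gap v := by linarith
    refine ⟨c + (h.gap c / (h.gap c - h.gap v)) • (v - c), ?_, fun f hf => ?_⟩
    · rw [Halfspace.gap_lineMap]; field_simp; ring
    · rw [Halfspace.gap_lineMap]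
      have h1 : h.gap c / (h.gap c - h.gap v) < 1 := by rw [div_lt_one hd]; linarith
      have := mul_pos (sub_pos.2 h1) (H.center f hf)
      have := mul_nonneg (div_nonneg hc.le hd.le) (hv f hf)
      linarith
  have es_spec : ∀ e ∈ es, ∃ f ∈ l, f.Survives h ∧ e.1 ≠ e.2 ∧ ∀ q, q ∈ segment ℝ e.1 e.2 ↔
      q ∈ polyhedron l ∧ f.half.gap q = 0 ∧ h.gap q = 0 := by
    intro e he
    obtain ⟨f, hf, hfe⟩ := (mem_es e).1 he
    by_cases hs : f.Survives h
    · obtain ⟨o, ho, hoe, -⟩ := H.val_cutFacet_of_survives hf hs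
      rw [ho] at hfe
      exact ⟨f, hf, hs, hoe e hfe⟩
    · rw [val_cutFacet_of_not_survives hs] at hfe
      exact absurd hfe (by simp)
  have edges_spec : ∀ f ∈ l, ∀ f', (cutFacet h f).val.1 = some f' → ∀ e' ∈ f'.edges,
      e'.1 ≠ e'.2 ∧ ((∀ q, q ∈ segment ℝ e'.1 e'.2 ↔
          q ∈ polyhedron l ∧ f.half.gap q = 0 ∧ h.gap q = 0) ∨
        ∃ e ∈ f.edges, (cutEdge h e).val.1 = some e') := by
    intro f hf f' hff e' he'
    obtain ⟨o, ho, hoe, -⟩ := H.val_cutFacet_of_survives hf (inv f hf f' hff).1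
    rw [ho] at hff
    rw [← Option.some.inj hff, List.mem_append] at he'
    rcases he' with he' | he'
    · have := hoe e' (by simpa using he')
      exact ⟨this.1, Or.inl this.2⟩
    · obtain ⟨e, he, hee⟩ := mem_filterMap_reverse.1 he'
      exact ⟨(cutEdge_fst_eq_some (H.edge_ne f hf e he) hee).1, Or.inr ⟨e, he, hee⟩⟩
  have face_iff : ∀ (f : Facet ℝ) (k : Halfspace ℝ), f.half = k → ∀ x,
      x ∈ f.face (polyhedron (⟨h, es⟩ :: fs)) ↔ (x ∈ polyhedron l ∧ 0 ≤ h.gap x) ∧ k.gap x = 0 := by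
    intro f k hk x
    rw [mem_face_polyhedron, mem_poly, hk]
  refine ⟨⟨?_, ?_, ?_, ?_, ?_, ?_, ?_, ?_⟩, Set.ext mem_poly⟩
  · rw [List.pairwise_cons]
    constructor
    · intro f' hf' hh
      obtain ⟨f, hf, -, hfh, -⟩ := old f' hf'
      exact h_ne f hf (by rw [← hfh, ← hh])
    · rw [hfs, List.pairwise_reverse, List.pairwise_filterMap]
      refine H.nodup.imp_of_mem fun {f g} hf hg hne f' hf' g' hg' hh => hne ?_
      rw [← (inv f hf f' hf').2, ← (inv g hg g' hg').2, hh]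
  · intro f' hf'
    rcases List.mem_cons.1 hf' with rfl | hf'
    · exact hc
    · obtain ⟨f, hf, -, hfh, -⟩ := old f' hf'
      rw [hfh]; exact H.center f hf
  · exact H.bounded.subset fun x hx => ((mem_poly x).1 hx).1
  · intro f' hf'
    rcases List.mem_cons.1 hf' with rfl | hf'
    · refine ⟨z, hz, fun g' hg' hne => ?_⟩
      rcases List.mem_cons.1 hg' with rfl | hg'
      · exact absurd rfl hne
      · obtain ⟨g, hg, -, hgh, -⟩ := old g' hg'
        rw [hgh]; exact hzl g hg
    · obtain ⟨f, hf, hs, hfh, -⟩ := old f' hf'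
      obtain ⟨p, hp, fp, hpos⟩ := pos_of_survives f hf hs
      -- The old strict point of the facet may be cut off, so another one is needed on the positive
      -- side of `h`.
      obtain ⟨z, fz, hz, hz0⟩ := H.exists_strict_pos hf hp fp hpos
      refine ⟨z, by rw [hfh, fz], fun g' hg' hne => ?_⟩
      rcases List.mem_cons.1 hg' with rfl | hg'
      · exact hz0
      · obtain ⟨g, hg, -, hgh, -⟩ := old g' hg'
        rw [hgh, hfh] at hne
        rw [hgh]; exact hz g hg hne
  · intro f' hf' e' he'
    rcases List.mem_cons.1 hf' with rfl | hf'
    · obtain ⟨f, -, -, hne, -⟩ := es_spec e' he'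
      exact hne
    · obtain ⟨f, hf, -, -, hff⟩ := old f' hf'
      exact (edges_spec f hf f' hff e' he').1
  · intro f' hf' e' he'
    rcases List.mem_cons.1 hf' with rfl | hf'
    · obtain ⟨f, hf, hs, -, hseg⟩ := es_spec e' he'
      obtain ⟨f', hf', -, hfh⟩ := surv f hf hs
      refine ⟨f', List.mem_cons_of_mem _ hf', by rw [hfh]; exact h_ne f hf, ?_⟩
      ext q
      rw [hseg, Set.mem_inter_iff, face_iff _ h rfl, face_iff _ _ hfh]
      constructor
      · rintro ⟨h1, h2, h3⟩
        exact ⟨⟨⟨h1, h3.ge⟩, h3⟩, ⟨h1, h3.ge⟩, h2⟩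
      · rintro ⟨⟨⟨h1, -⟩, h3⟩, -, h2⟩
        exact ⟨h1, h2, h3⟩
    · obtain ⟨f, hf, -, hfh, hff⟩ := old f' hf'
      rcases (edges_spec f hf f' hff e' he').2 with hseg | ⟨e, he, hee⟩
      · refine ⟨⟨h, es⟩, List.mem_cons_self, by rw [hfh]; exact (h_ne f hf).symm, ?_⟩
        ext q
        rw [hseg, Set.mem_inter_iff, face_iff _ _ hfh, face_iff _ h rfl]
        constructor
        · rintro ⟨h1, h2, h3⟩
          exact ⟨⟨⟨h1, h3.ge⟩, h2⟩, ⟨h1, h3.ge⟩, h3⟩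
        · rintro ⟨⟨⟨h1, -⟩, h3⟩, -, h2⟩
          exact ⟨h1, h3, h2⟩
      · obtain ⟨-, hpos, hseg⟩ := cutEdge_fst_eq_some (H.edge_ne f hf e he) hee
        obtain ⟨g, hg, hgf, hs⟩ := H.edge_spec hf he
        obtain ⟨p, hp, hp0⟩ : ∃ p ∈ segment ℝ e'.1 e'.2, 0 < h.gap p := by
          rcases hpos with hpos | hpos
          exacts [⟨_, left_mem_segment _ _ _, hpos⟩, ⟨_, right_mem_segment _ _ _, hpos⟩]
        obtain ⟨hpP, -, gp⟩ := (hs p).1 ((hseg p).1 hp).1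
        -- A kept edge has an endpoint of positive gap, so the neighbouring facet along it survives
        -- as well.
        obtain ⟨g', hg', -, hgh⟩ := surv g hg (survives_of_pos g hg p hpP gp hp0)
        refine ⟨g', List.mem_cons_of_mem _ hg', by rw [hgh, hfh]; exact hgf, ?_⟩
        ext q
        rw [hseg, hs, Set.mem_inter_iff, face_iff _ _ hfh, face_iff _ _ hgh]
        tauto
  · intro f' hf' g' hg' hne hnt
    rcases List.mem_cons.1 hf' with rfl | hf'
    · rcases List.mem_cons.1 hg' with rfl | hg'
      · exact absurd rfl hne
      obtain ⟨f, hf, hs, hfh, -⟩ := old g' hg'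
      obtain ⟨o, ho, hoe, hon⟩ := H.val_cutFacet_of_survives hf hs
      obtain ⟨x, hx, y, hy, hxy⟩ := hnt
      rw [Set.mem_inter_iff, face_iff _ h rfl, face_iff _ _ hfh] at hx hy
      rcases o with _ | e
      · exact absurd (hon rfl x y hx.1.1.1 hx.2.2 hx.1.2 hy.1.1.1 hy.2.2 hy.1.2) hxy
      · refine ⟨e, (mem_es e).2 ⟨f, hf, by rw [ho]⟩, ?_⟩
        ext q
        rw [(hoe e rfl).2, Set.mem_inter_iff, face_iff _ h rfl, face_iff _ _ hfh]
        constructor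
        · rintro ⟨h1, h2, h3⟩
          exact ⟨⟨⟨h1, h3.ge⟩, h3⟩, ⟨h1, h3.ge⟩, h2⟩
        · rintro ⟨⟨⟨h1, -⟩, h3⟩, -, h2⟩
          exact ⟨h1, h2, h3⟩
    · obtain ⟨f, hf, hs, hfh, hff⟩ := old f' hf'
      obtain ⟨o, ho, hoe, hon⟩ := H.val_cutFacet_of_survives hf hs
      rw [ho] at hff
      have hed := congrArg Facet.edges (Option.some.inj hff)
      simp only at hed
      rw [← hed]
      obtain ⟨x, hx, y, hy, hxy⟩ := hnt
      rcases List.mem_cons.1 hg' with rfl | hg'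
      · rw [Set.mem_inter_iff, face_iff _ _ hfh, face_iff _ h rfl] at hx hy
        rcases o with _ | e
        · exact absurd (hon rfl x y hx.1.1.1 hx.1.2 hx.2.2 hy.1.1.1 hy.1.2 hy.2.2) hxy
        · refine ⟨e, by simp, ?_⟩
          ext q
          rw [(hoe e rfl).2, Set.mem_inter_iff, face_iff _ _ hfh, face_iff _ h rfl]
          constructor
          · rintro ⟨h1, h2, h3⟩
            exact ⟨⟨⟨h1, h3.ge⟩, h2⟩, ⟨h1, h3.ge⟩, h3⟩
          · rintro ⟨⟨⟨h1, -⟩, h3⟩, -, h2⟩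
            exact ⟨h1, h3, h2⟩
      · obtain ⟨g, hg, -, hgh, -⟩ := old g' hg'
        rw [Set.mem_inter_iff, face_iff _ _ hfh, face_iff _ _ hgh] at hx hy
        have hgf : g.half ≠ f.half := by rw [← hgh, ← hfh]; exact hne
        obtain ⟨e, he, hseg⟩ := H.complete f hf g hg hgf
          ⟨x, ⟨mem_face_polyhedron.2 ⟨hx.1.1.1, hx.1.2⟩, mem_face_polyhedron.2 ⟨hx.1.1.1, hx.2.2⟩⟩,
            y, ⟨mem_face_polyhedron.2 ⟨hy.1.1.1, hy.1.2⟩, mem_face_polyhedron.2 ⟨hy.1.1.1, hy.2.2⟩⟩,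
            hxy⟩
        have hs' : ∀ q, q ∈ segment ℝ e.1 e.2 ↔
            q ∈ polyhedron l ∧ f.half.gap q = 0 ∧ g.half.gap q = 0 := by
          intro q
          rw [hseg, Set.mem_inter_iff, mem_face_polyhedron, mem_face_polyhedron]
          tauto
        cases hcut : (cutEdge h e).val.1 with
        | some e' =>
          refine ⟨e', List.mem_append_right _ (mem_filterMap_reverse.2 ⟨e, he, hcut⟩), ?_⟩
          ext q
          rw [(cutEdge_fst_eq_some (H.edge_ne f hf e he) hcut).2.2, hs', Set.mem_inter_iff,
            face_iff _ _ hfh, face_iff _ _ hgh]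
          tauto
        | none =>
          -- The old edge is dropped, although `x` and `y` on it satisfy `h`. Hence both lie on the
          -- cutting plane, the two facets meet in the line of the section, and the new edge of `f`
          -- takes the place of the old one.
          obtain ⟨n1, n2⟩ := cutEdge_fst_eq_none.1 hcut
          have hx0 : h.gap x = 0 := le_antisymm
            (gap_segment_nonpos n1 n2 ((hs' x).2 ⟨hx.1.1.1, hx.1.2, hx.2.2⟩)) hx.1.1.2
          have hy0 : h.gap y = 0 := le_antisymm
            (gap_segment_nonpos n1 n2 ((hs' y).2 ⟨hy.1.1.1, hy.1.2, hy.2.2⟩)) hy.1.1.2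
          obtain ⟨p, hp, fp, hpos⟩ := pos_of_survives f hf hs
          rcases o with _ | e₁
          · exact absurd (hon rfl x y hx.1.1.1 hx.1.2 hx0 hy.1.1.1 hy.1.2 hy0) hxy
          refine ⟨e₁, by simp, ?_⟩
          ext q
          rw [(hoe e₁ rfl).2, Set.mem_inter_iff, face_iff _ _ hfh, face_iff _ _ hgh]
          constructor
          · rintro ⟨h1, h2, h3⟩
            refine ⟨⟨⟨h1, h3.ge⟩, h2⟩, ⟨h1, h3.ge⟩, ?_⟩
            exact H.gap_eq_zero_of_line hf fp hpos.ne' hxy hx.1.2 hx0 hx.2.2 hy.1.2 hy0 hy.2.2 h2 h3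
          · rintro ⟨⟨⟨h1, h0⟩, h2⟩, -, h3⟩
            exact ⟨h1, h2, le_antisymm (gap_segment_nonpos n1 n2 ((hs' q).2 ⟨h1, h2, h3⟩)) h0⟩
  · intro f' hf'
    rcases List.mem_cons.1 hf' with rfl | hf'
    · change List.Pairwise _ es
      rw [hes, List.pairwise_reverse, List.pairwise_filterMap]
      refine H.nodup.imp_of_mem fun {f g} hf hg hne e he e' he' hseg => hne ?_
      by_cases hsf : f.Survives h
      · by_cases hsg : g.Survives h
        · obtain ⟨o, ho, hoe, -⟩ := H.val_cutFacet_of_survives hf hsf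
          obtain ⟨o', ho', hoe', -⟩ := H.val_cutFacet_of_survives hg hsg
          rw [ho] at he
          rw [ho'] at he'
          obtain ⟨hne, hs⟩ := hoe e he
          obtain ⟨-, hs'⟩ := hoe' e' he'
          rw [hseg] at hs'
          have hs' := fun q => (hs' q).symm.trans (hs q)
          have x1 := (hs e.1).1 (left_mem_segment _ _ _)
          have y1 := (hs e.2).1 (right_mem_segment _ _ _)
          have x2 := (hs' e.1).2 x1
          have y2 := (hs' e.2).2 y1
          obtain ⟨p, hp, fp, hp0⟩ := pos_of_survives f hf hsf
          obtain ⟨p', hp', gp', hp0'⟩ := pos_of_survives g hg hsg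
          exact H.half_eq_of_section_eq hf hg hne x1.2.1 x2.2.1 x1.2.2 y1.2.1 y2.2.1 y1.2.2 hp fp hp0
            hp' gp' hp0' hz hzl
        · rw [val_cutFacet_of_not_survives hsg] at he'
          exact absurd he' (by simp)
      · rw [val_cutFacet_of_not_survives hsf] at he
        exact absurd he (by simp)
    · obtain ⟨f, hf, hs, hfh, hff⟩ := old f' hf'
      obtain ⟨o, ho, hoe, hon⟩ := H.val_cutFacet_of_survives hf hs
      rw [ho] at hff
      rw [← Option.some.inj hff]
      change List.Pairwise _ (_ ++ _)
      rw [List.pairwise_append]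
      refine ⟨?_, ?_, ?_⟩
      · rcases o with _ | e <;> simp
      · rw [List.pairwise_reverse, List.pairwise_filterMap]
        refine (H.distinct f hf).imp_of_mem fun {e₁ e₂} he₁ he₂ hne e₁' h₁ e₂' h₂ hseg => hne ?_
        obtain ⟨hn, -, hs₁⟩ := cutEdge_fst_eq_some (H.edge_ne f hf e₁ he₁) h₁
        obtain ⟨-, -, hs₂⟩ := cutEdge_fst_eq_some (H.edge_ne f hf e₂ he₂) h₂
        rw [hseg] at hs₂
        have x1 : e₁'.1 ∈ segment ℝ e₁'.1 e₁'.2 := left_mem_segment _ _ _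
        have y1 : e₁'.2 ∈ segment ℝ e₁'.1 e₁'.2 := right_mem_segment _ _ _
        rw [H.edge_eq_of_two_points hf he₁ he₂ hn ((hs₁ _).1 x1).1 ((hs₁ _).1 y1).1
          ((hs₂ _).1 x1).1 ((hs₂ _).1 y1).1]
      -- The new edge lies in the cutting plane, while a kept edge has an endpoint of positive gap.
      · intro e₁ h₁ e' he' hseg
        obtain ⟨e, he, hee⟩ := mem_filterMap_reverse.1 he'
        have hs₁ := (hoe e₁ (by simpa using h₁)).2
        rw [hseg] at hs₁
        obtain ⟨-, hpos, -⟩ := cutEdge_fst_eq_some (H.edge_ne f hf e he) hee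
        rcases hpos with hpos | hpos
        · exact hpos.ne' ((hs₁ _).1 (left_mem_segment _ _ _)).2.2
        · exact hpos.ne' ((hs₁ _).1 (right_mem_segment _ _ _)).2.2

/-- Intersecting with a halfspace keeps the loop invariant. -/
theorem cutPolyhedron {h : Halfspace ℝ} (hc : 0 < h.gap c) :
    IsRepresentation c (cutPolyhedron l h).val ∧
      polyhedron (_root_.cutPolyhedron l h).val = {x ∈ polyhedron l | 0 ≤ h.gap x} ∧
      (_root_.cutPolyhedron l h).val.length ≤ l.length + 1 := by
  rw [val_cutPolyhedron]
  split_ifs with hviol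
  · obtain ⟨f, hf, e, he, hneg⟩ := (val_isViolated h l).1 hviol
    obtain ⟨v, hv, hv0⟩ : ∃ v ∈ polyhedron l, h.gap v < 0 := by
      rcases hneg with hneg | hneg
      · exact ⟨_, (H.mem_of_mem_edge hf he (left_mem_segment _ _ _)).1, hneg⟩
      · exact ⟨_, (H.mem_of_mem_edge hf he (right_mem_segment _ _ _)).1, hneg⟩
    obtain ⟨h1, h2⟩ := H.cut hc hv hv0
    refine ⟨h1, h2, ?_⟩
    simp only [List.length_cons, List.length_reverse, add_le_add_iff_right]
    exact List.length_filterMap_le _ _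
  · refine ⟨H, ?_, Nat.le_succ _⟩
    ext x
    refine ⟨fun hx => ⟨hx, ?_⟩, And.left⟩
    by_contra! hneg
    exact hviol ((val_isViolated h l).2 (H.exists_edge_neg h hx hneg))

end IsRepresentation

/-! ### From the invariant to the boundary representation -/

theorem Facet.face_congr {f g : Facet ℝ} (h : f.half = g.half) (P : Set (Fin 3 → ℝ)) :
    f.face P = g.face P := by
  unfold Facet.face; rw [h]

namespace IsRepresentation

variable {c : Fin 3 → ℝ} {l : List (Facet ℝ)} (H : IsRepresentation c l)
include H

theorem face_ne {f g : Facet ℝ} (hf : f ∈ l) (hg : g ∈ l) (h : g.half ≠ f.half) :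
    g.face (polyhedron l) ≠ f.face (polyhedron l) := by
  intro he
  obtain ⟨z, fz, hz⟩ := H.strict f hf
  have h1 : z ∈ f.face (polyhedron l) :=
    mem_face_polyhedron.2 ⟨mem_polyhedron_of_strict fz hz, fz⟩
  rw [← he, mem_face_polyhedron] at h1
  exact (hz g hg h).ne' h1.2

theorem face_ne_iff {f g : Facet ℝ} (hf : f ∈ l) (hg : g ∈ l) :
    g.face (polyhedron l) ≠ f.face (polyhedron l) ↔ g.half ≠ f.half :=
  ⟨fun h he => h (Facet.face_congr he _), H.face_ne hf hg⟩

/-- From the strict point of the facet one can move a little in every direction of its plane without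
leaving the face, so the span is the whole kernel of the normal. -/
theorem finrank_vectorSpan_face {f : Facet ℝ} (hf : f ∈ l) :
    Module.finrank ℝ (vectorSpan ℝ (f.face (polyhedron l))) = 2 := by
  obtain ⟨z, fz, hz⟩ := H.strict f hf
  have hzm : z ∈ f.face (polyhedron l) :=
    mem_face_polyhedron.2 ⟨mem_polyhedron_of_strict fz hz, fz⟩
  have hker : vectorSpan ℝ (f.face (polyhedron l)) =
      LinearMap.ker (dotProductBilin ℝ ℝ f.half.normal) := by
    apply le_antisymm
    · rw [vectorSpan, Submodule.span_le]
      rintro _ ⟨x, hx, y, hy, rfl⟩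
      change dotProduct f.half.normal (x - y) = 0
      rw [f.half.dotProduct_normal_sub, (mem_face_polyhedron.1 hx).2,
        (mem_face_polyhedron.1 hy).2, sub_zero]
    · intro d hd
      have hd : dotProduct f.half.normal d = 0 := hd
      obtain ⟨ε, hε, hstep⟩ := exists_small_step l z d
      have fy : f.half.gap (z + ε • d) = 0 := by
        rw [Halfspace.gap_add_smul, fz, hd]; ring
      have hy : z + ε • d ∈ f.face (polyhedron l) := by
        refine mem_face_polyhedron.2 ⟨mem_polyhedron_of_strict fy fun g hg hne => ?_, fy⟩
        exact hstep ε hε.le le_rfl g hg (hz g hg hne)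
      have hmem := vsub_mem_vectorSpan ℝ hy hzm
      rw [vsub_eq_sub, add_sub_cancel_left] at hmem
      have := Submodule.smul_mem _ ε⁻¹ hmem
      rwa [smul_smul, inv_mul_cancel₀ hε.ne', one_smul] at this
  have hne : (dotProductBilin ℝ ℝ f.half.normal : Module.Dual ℝ (Fin 3 → ℝ)) ≠ 0 := by
    intro h0
    have := LinearMap.congr_fun h0 f.half.normal
    exact H.normal_ne_zero hf (dotProduct_self_eq_zero.1 this)
  have := Module.Dual.finrank_ker_add_one_of_ne_zero hne
  rw [hker]
  rw [Module.finrank_fin_fun] at this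
  exact Nat.succ_injective this

theorem isBoundaryRepresentation : IsBoundaryRepresentation (polyhedron l) l where
  eq_inter := by
    ext x
    refine forall₂_congr fun f _ => ?_
    exact sub_nonneg
  two_dim f hf := H.finrank_vectorSpan_face hf
  distinct := H.nodup.imp_of_mem fun {f g} hf hg hne => H.face_ne hg hf hne
  edges := by
    intro f hf S
    constructor
    · rintro ⟨e, he, rfl⟩
      obtain ⟨g, hg, hne, hs⟩ := H.edge_eq f hf e he
      exact ⟨g, hg, H.face_ne hf hg hne, hs, e.1, left_mem_segment _ _ _, e.2,
        right_mem_segment _ _ _, H.edge_ne f hf e he⟩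
    · rintro ⟨g, hg, hne, rfl, hnt⟩
      obtain ⟨e, he, hs⟩ := H.complete f hf g hg ((H.face_ne_iff hf hg).1 hne) hnt
      exact ⟨e, he, hs.symm⟩
  edges_distinct := H.distinct

end IsRepresentation

/-! ### Parallelepipeds satisfy the invariant -/

/-- A basis of the space together with its dual basis. -/
structure IsDualFrame (u v w a b c : Fin 3 → ℝ) : Prop where
  au : dotProduct a u = 1
  av : dotProduct a v = 0
  aw : dotProduct a w = 0
  bu : dotProduct b u = 0
  bv : dotProduct b v = 1
  bw : dotProduct b w = 0
  cu : dotProduct c u = 0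
  cv : dotProduct c v = 0
  cw : dotProduct c w = 1

namespace IsDualFrame

variable {u v w a b c : Fin 3 → ℝ} (D : IsDualFrame u v w a b c)
include D

theorem swap : IsDualFrame u w v a c b :=
  ⟨D.au, D.aw, D.av, D.cu, D.cw, D.cv, D.bu, D.bw, D.bv⟩

/-- Duality says that one matrix is a right inverse of the other; a right inverse of a square matrix
is also a left inverse. -/
theorem expand (x : Fin 3 → ℝ) :
    x = dotProduct a x • u + dotProduct b x • v + dotProduct c x • w := by
  have h : (Matrix.of ![a, b, c]) * (Matrix.of ![u, v, w]).transpose = 1 := by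
    have e (i j : Fin 3) : ((Matrix.of ![a, b, c]) * (Matrix.of ![u, v, w]).transpose) i j =
      dotProduct (![a, b, c] i) (![u, v, w] j) := rfl
    ext i j
    rw [e]
    fin_cases i <;> fin_cases j <;>
      simp [D.au, D.av, D.aw, D.bu, D.bv, D.bw, D.cu, D.cv, D.cw]
  have h2 := congrArg (fun M => M.mulVec x) (mul_eq_one_comm.1 h)
  simp only [Matrix.one_mulVec, ← Matrix.mulVec_mulVec] at h2
  ext i
  have := congrFun h2 i
  simp [Matrix.mulVec, dotProduct, Fin.sum_univ_three] at this ⊢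
  linarith

theorem mem_segment_iff {o x : Fin 3 → ℝ} : x ∈ segment ℝ o (o + w) ↔
    dotProduct a x = dotProduct a o ∧ dotProduct b x = dotProduct b o ∧
      dotProduct c o ≤ dotProduct c x ∧ dotProduct c x ≤ dotProduct c o + 1 := by
  rw [mem_segment_iff_lineMap]
  constructor
  · rintro ⟨t, t0, t1, rfl⟩
    simp only [dotProduct_add, dotProduct_smul, add_sub_cancel_left, D.aw, D.bw, D.cw, smul_eq_mul]
    refine ⟨by ring, by ring, by linarith, by linarith⟩
  · rintro ⟨h1, h2, h3, h4⟩
    refine ⟨dotProduct c x - dotProduct c o, by linarith, by linarith, ?_⟩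
    nth_rewrite 1 [D.expand x]
    rw [h1, h2, add_sub_cancel_left]
    nth_rewrite 3 [D.expand o]
    module

end IsDualFrame

theorem Halfspace.ne_of_gap {h h' : Halfspace ℝ} {x : Fin 3 → ℝ} (hx : h.gap x ≠ h'.gap x) :
    h ≠ h' := fun he => hx (by rw [he])

/-- The part of `IsRepresentation` that concerns a single facet. -/
structure IsRepresentedFacet (l : List (Facet ℝ)) (f : Facet ℝ) : Prop where
  strict : ∃ z, f.half.gap z = 0 ∧ ∀ g ∈ l, g.half ≠ f.half → 0 < g.half.gap z
  edge_ne : ∀ e ∈ f.edges, e.1 ≠ e.2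
  edge_eq : ∀ e ∈ f.edges, ∃ g ∈ l, g.half ≠ f.half ∧
    segment ℝ e.1 e.2 = f.face (polyhedron l) ∩ g.face (polyhedron l)
  complete : ∀ g ∈ l, g.half ≠ f.half →
    (f.face (polyhedron l) ∩ g.face (polyhedron l)).Nontrivial →
    ∃ e ∈ f.edges, segment ℝ e.1 e.2 = f.face (polyhedron l) ∩ g.face (polyhedron l)
  distinct : f.edges.Pairwise fun e e' => segment ℝ e.1 e.2 ≠ segment ℝ e'.1 e'.2

/-- In the dual coordinates the polyhedron is a box, and `f` is its slice at height `s`, used for `s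
= 0` and `s = 1`. The four neighbours are the facets on which one of the other coordinates is
extreme; the opposite facet is covered by the last alternative of `hl`. -/
theorem isRepresentedFacet_parallelogram {u v w a b c k : Fin 3 → ℝ}
    (D : IsDualFrame u v w a b c) {l : List (Facet ℝ)} {f B₀ B₁ C₀ C₁ : Facet ℝ} {s : ℝ}
    (hs : 0 ≤ s ∧ s ≤ 1)
    (hP : ∀ x, x ∈ polyhedron l ↔
      (dotProduct a k ≤ dotProduct a x ∧ dotProduct a x ≤ dotProduct a k + 1) ∧
      (dotProduct b k ≤ dotProduct b x ∧ dotProduct b x ≤ dotProduct b k + 1) ∧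
      (dotProduct c k ≤ dotProduct c x ∧ dotProduct c x ≤ dotProduct c k + 1))
    (hf : ∀ x, f.half.gap x = 0 ↔ dotProduct a x = dotProduct a k + s)
    (hB₀ : B₀ ∈ l) (hB₁ : B₁ ∈ l) (hC₀ : C₀ ∈ l) (hC₁ : C₁ ∈ l)
    (gB₀ : ∀ x, B₀.half.gap x = dotProduct b x - dotProduct b k)
    (gB₁ : ∀ x, B₁.half.gap x = dotProduct b k + 1 - dotProduct b x)
    (gC₀ : ∀ x, C₀.half.gap x = dotProduct c x - dotProduct c k)
    (gC₁ : ∀ x, C₁.half.gap x = dotProduct c k + 1 - dotProduct c x)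
    (hl : ∀ g ∈ l, g.half ≠ f.half → g = B₀ ∨ g = B₁ ∨ g = C₀ ∨ g = C₁ ∨
      ∀ x, f.half.gap x = 0 → 0 < g.half.gap x)
    (hedges : f.edges = [(k + s • u, k + s • u + v), (k + s • u, k + s • u + w),
      (k + s • u + v, k + s • u + v + w), (k + s • u + w, k + s • u + v + w)]) :
    IsRepresentedFacet l f := by
  have hv : v ≠ 0 := by rintro rfl; have := D.bv; simp at this
  have hw : w ≠ 0 := by rintro rfl; have := D.cw; simp at this
  obtain ⟨o, ho⟩ : ∃ o, o = k + s • u := ⟨_, rfl⟩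
  rw [← ho] at hedges
  have ao : dotProduct a o = dotProduct a k + s := by
    rw [ho, dotProduct_add, dotProduct_smul, D.au, smul_eq_mul, mul_one]
  have bo : dotProduct b o = dotProduct b k := by
    rw [ho, dotProduct_add, dotProduct_smul, D.bu, smul_eq_mul, mul_zero, add_zero]
  have co : dotProduct c o = dotProduct c k := by
    rw [ho, dotProduct_add, dotProduct_smul, D.cu, smul_eq_mul, mul_zero, add_zero]
  have hface : ∀ g : Facet ℝ, ∀ x, x ∈ f.face (polyhedron l) ∩ g.face (polyhedron l) ↔
      dotProduct a x = dotProduct a k + s ∧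
      (dotProduct b k ≤ dotProduct b x ∧ dotProduct b x ≤ dotProduct b k + 1) ∧
      (dotProduct c k ≤ dotProduct c x ∧ dotProduct c x ≤ dotProduct c k + 1) ∧
      g.half.gap x = 0 := by
    intro g x
    rw [Set.mem_inter_iff, mem_face_polyhedron, mem_face_polyhedron, hP, hf]
    constructor
    · tauto
    · rintro ⟨h1, h2, h3, h4⟩
      have : dotProduct a k ≤ dotProduct a x ∧ dotProduct a x ≤ dotProduct a k + 1 := by
        constructor <;> linarith [hs.1, hs.2]
      tauto
  have hsw : o + v + w = o + w + v := by abel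
  have sC₀ : segment ℝ o (o + v) = f.face (polyhedron l) ∩ C₀.face (polyhedron l) := by
    ext x
    rw [hface, D.swap.mem_segment_iff, ao, bo, co, gC₀]
    constructor
    · rintro ⟨h1, h2, h3, h4⟩
      refine ⟨h1, ⟨h3, h4⟩, ⟨h2.ge, by linarith⟩, by linarith⟩
    · rintro ⟨h1, ⟨h3, h4⟩, -, h5⟩
      exact ⟨h1, by linarith, h3, h4⟩
  have sB₀ : segment ℝ o (o + w) = f.face (polyhedron l) ∩ B₀.face (polyhedron l) := by
    ext x
    rw [hface, D.mem_segment_iff, ao, bo, co, gB₀]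
    constructor
    · rintro ⟨h1, h2, h3, h4⟩
      refine ⟨h1, ⟨h2.ge, by linarith⟩, ⟨h3, h4⟩, by linarith⟩
    · rintro ⟨h1, -, ⟨h3, h4⟩, h5⟩
      exact ⟨h1, by linarith, h3, h4⟩
  have sB₁ : segment ℝ (o + v) (o + v + w) =
      f.face (polyhedron l) ∩ B₁.face (polyhedron l) := by
    ext x
    rw [hface, D.mem_segment_iff, dotProduct_add, dotProduct_add, dotProduct_add, ao, bo, co, gB₁,
      D.av, D.bv, D.cv]
    constructor
    · rintro ⟨h1, h2, h3, h4⟩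
      refine ⟨by linarith, ⟨by linarith, by linarith⟩, ⟨by linarith, by linarith⟩, by linarith⟩
    · rintro ⟨h1, -, ⟨h3, h4⟩, h5⟩
      exact ⟨by linarith, by linarith, by linarith, by linarith⟩
  have sC₁ : segment ℝ (o + w) (o + v + w) =
      f.face (polyhedron l) ∩ C₁.face (polyhedron l) := by
    ext x
    rw [hsw, hface, D.swap.mem_segment_iff, dotProduct_add, dotProduct_add, dotProduct_add, ao, bo,
      co, gC₁, D.aw, D.bw, D.cw]
    constructor
    · rintro ⟨h1, h2, h3, h4⟩
      refine ⟨by linarith, ⟨by linarith, by linarith⟩, ⟨by linarith, by linarith⟩, by linarith⟩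
    · rintro ⟨h1, ⟨h3, h4⟩, -, h5⟩
      exact ⟨by linarith, by linarith, by linarith, by linarith⟩
  set z := o + (1 / 2 : ℝ) • v + (1 / 2 : ℝ) • w with hz
  have az : dotProduct a z = dotProduct a k + s := by
    rw [hz]; simp only [dotProduct_add, dotProduct_smul, D.av, D.aw, ao, smul_eq_mul]; ring
  have bz : dotProduct b z = dotProduct b k + 1 / 2 := by
    rw [hz]; simp only [dotProduct_add, dotProduct_smul, D.bv, D.bw, bo, smul_eq_mul]; ring
  have cz : dotProduct c z = dotProduct c k + 1 / 2 := by
    rw [hz]; simp only [dotProduct_add, dotProduct_smul, D.cv, D.cw, co, smul_eq_mul]; ring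
  have fz : f.half.gap z = 0 := (hf z).2 az
  have nB₀ : B₀.half ≠ f.half := Halfspace.ne_of_gap (x := z) (by rw [fz, gB₀, bz]; norm_num)
  have nB₁ : B₁.half ≠ f.half := Halfspace.ne_of_gap (x := z) (by rw [fz, gB₁, bz]; norm_num)
  have nC₀ : C₀.half ≠ f.half := Halfspace.ne_of_gap (x := z) (by rw [fz, gC₀, cz]; norm_num)
  have nC₁ : C₁.half ≠ f.half := Halfspace.ne_of_gap (x := z) (by rw [fz, gC₁, cz]; norm_num)
  refine ⟨⟨z, fz, fun g hg hne => ?_⟩, ?_, ?_, ?_, ?_⟩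
  · rcases hl g hg hne with rfl | rfl | rfl | rfl | h
    · rw [gB₀, bz]; linarith
    · rw [gB₁, bz]; linarith
    · rw [gC₀, cz]; linarith
    · rw [gC₁, cz]; linarith
    · exact h z fz
  · rw [hedges]
    simp [hv, hw, hsw]
  · rw [hedges]
    simp only [List.mem_cons, List.not_mem_nil, or_false, forall_eq_or_imp, forall_eq]
    exact ⟨⟨C₀, hC₀, nC₀, sC₀⟩, ⟨B₀, hB₀, nB₀, sB₀⟩, ⟨B₁, hB₁, nB₁, sB₁⟩, ⟨C₁, hC₁, nC₁, sC₁⟩⟩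
  · rw [hedges]
    rintro g hg hne ⟨x, hx, -⟩
    rcases hl g hg hne with rfl | rfl | rfl | rfl | h
    · exact ⟨(o, o + w), by simp, sB₀⟩
    · exact ⟨(o + v, o + v + w), by simp, sB₁⟩
    · exact ⟨(o, o + v), by simp, sC₀⟩
    · exact ⟨(o + w, o + v + w), by simp, sC₁⟩
    · have h1 := mem_face_polyhedron.1 hx.1
      have h2 := mem_face_polyhedron.1 hx.2
      exact absurd h2.2 (h x h1.2).ne'
  · have key : ∀ {S T : Set (Fin 3 → ℝ)} (x : Fin 3 → ℝ), x ∈ S → x ∉ T → S ≠ T :=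
      fun x hx hx' he => hx' (he ▸ hx)
    have memB₀ : ∀ x, x ∈ segment ℝ o (o + w) → dotProduct b x = dotProduct b k := fun x hx =>
      ((D.mem_segment_iff.1 hx).2.1).trans bo
    have memC₀ : ∀ x, x ∈ segment ℝ o (o + v) → dotProduct c x = dotProduct c k := fun x hx =>
      ((D.swap.mem_segment_iff.1 hx).2.1).trans co
    have memB₁ : ∀ x, x ∈ segment ℝ (o + v) (o + v + w) → dotProduct b x = dotProduct b k + 1 := by
      intro x hx
      rw [(D.mem_segment_iff.1 hx).2.1, dotProduct_add, bo, D.bv]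
    have memC₁ : ∀ x, x ∈ segment ℝ (o + w) (o + v + w) → dotProduct c x = dotProduct c k + 1 := by
      intro x hx
      rw [hsw] at hx
      rw [(D.swap.mem_segment_iff.1 hx).2.1, dotProduct_add, co, D.cw]
    have bov : dotProduct b (o + v) = dotProduct b k + 1 := by rw [dotProduct_add, bo, D.bv]
    have cow : dotProduct c (o + w) = dotProduct c k + 1 := by rw [dotProduct_add, co, D.cw]
    have cov : dotProduct c (o + v) = dotProduct c k := by rw [dotProduct_add, co, D.cv, add_zero]
    have bow : dotProduct b (o + w) = dotProduct b k := by rw [dotProduct_add, bo, D.bw, add_zero]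
    rw [hedges]
    simp only [List.pairwise_cons, List.mem_cons, List.not_mem_nil, or_false, forall_eq_or_imp,
      forall_eq, false_imp_iff, implies_true, List.Pairwise.nil, and_true]
    refine ⟨⟨?_, ?_, ?_⟩, ⟨?_, ?_⟩, ?_⟩
    · exact key (o + v) (right_mem_segment _ _ _) fun h => by have := memB₀ _ h; linarith
    · exact key o (left_mem_segment _ _ _) fun h => by have := memB₁ _ h; linarith
    · exact key o (left_mem_segment _ _ _) fun h => by have := memC₁ _ h; linarith
    · exact key o (left_mem_segment _ _ _) fun h => by have := memB₁ _ h; linarith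
    · exact key o (left_mem_segment _ _ _) fun h => by have := memC₁ _ h; linarith
    · exact key (o + v) (left_mem_segment _ _ _) fun h => by have := memC₁ _ h; linarith

/-- The vector whose inner products with `u`, `v`, `w` are `1`, `0`, `0`. -/
noncomputable def dualVector (u v w : Fin 3 → ℝ) : Fin 3 → ℝ :=
  (1 / dotProduct u (crossProduct v w)) • crossProduct v w

theorem isDualFrame_dualVector {u v w : Fin 3 → ℝ} (h : dotProduct u (crossProduct v w) ≠ 0) :
    IsDualFrame u v w (dualVector u v w) (dualVector v w u) (dualVector w u v) := by
  have h1 : dotProduct v (crossProduct w u) = dotProduct u (crossProduct v w) :=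
    (triple_product_permutation u v w).symm
  have h2 : dotProduct w (crossProduct u v) = dotProduct u (crossProduct v w) := by
    rw [← h1]; exact (triple_product_permutation v w u).symm
  unfold dualVector
  rw [h1, h2]
  have e (t : ℝ) (m r : Fin 3 → ℝ) : dotProduct (t • m) r = t • dotProduct r m := by
    rw [smul_dotProduct, dotProduct_comm]
  constructor <;> rw [e]
  · rw [smul_eq_mul, one_div, inv_mul_cancel₀ h]
  · rw [dot_self_cross, smul_zero]
  · rw [dot_cross_self, smul_zero]
  · rw [dot_cross_self, smul_zero]
  · rw [h1, smul_eq_mul, one_div, inv_mul_cancel₀ h]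
  · rw [dot_self_cross, smul_zero]
  · rw [dot_self_cross, smul_zero]
  · rw [dot_cross_self, smul_zero]
  · rw [h2, smul_eq_mul, one_div, inv_mul_cancel₀ h]

theorem val_slab (k u v w : Fin 3 → ℝ) : (slab k u v w).val =
    (⟨(-1 : ℝ) • dualVector u v w, -1 * dotProduct (dualVector u v w) k⟩,
      ⟨dualVector u v w, dotProduct (dualVector u v w) k + 1⟩) := by
  simp [slab, dualVector]

theorem gap_slab_fst (k u v w x : Fin 3 → ℝ) : (slab k u v w).val.1.gap x =
    dotProduct (dualVector u v w) x - dotProduct (dualVector u v w) k := by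
  rw [val_slab]; simp only [Halfspace.gap, smul_dotProduct, smul_eq_mul]; ring

theorem gap_slab_snd (k u v w x : Fin 3 → ℝ) : (slab k u v w).val.2.gap x =
    dotProduct (dualVector u v w) k + 1 - dotProduct (dualVector u v w) x := by
  rw [val_slab]; rfl

theorem val_facetPair (k u v w : Fin 3 → ℝ) : (facetPair k u v w).val =
    (⟨(slab k u v w).val.1, [(k, k + v), (k, k + w), (k + v, k + v + w), (k + w, k + v + w)]⟩,
      ⟨(slab k u v w).val.2, [(k + u, k + u + v), (k + u, k + u + w),
        (k + u + v, k + u + v + w), (k + u + w, k + u + v + w)]⟩) := by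
  simp [facetPair, parallelogramEdges]

/-- The list enters only through membership, so that the statement can be used for all three pairs
of facets by permuting `u`, `v`, `w` cyclically. -/
theorem isRepresentedFacet_facetPair {k u v w : Fin 3 → ℝ}
    (h : dotProduct u (crossProduct v w) ≠ 0) {l : List (Facet ℝ)}
    (hl : ∀ f, f ∈ l ↔ f = (facetPair k u v w).val.1 ∨ f = (facetPair k u v w).val.2 ∨
      f = (facetPair k v w u).val.1 ∨ f = (facetPair k v w u).val.2 ∨
      f = (facetPair k w u v).val.1 ∨ f = (facetPair k w u v).val.2) :
    IsRepresentedFacet l (facetPair k u v w).val.1 ∧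
      IsRepresentedFacet l (facetPair k u v w).val.2 := by
  have D := isDualFrame_dualVector h
  have g1 (k u v w x : Fin 3 → ℝ) : (facetPair k u v w).val.1.half.gap x =
      dotProduct (dualVector u v w) x - dotProduct (dualVector u v w) k := gap_slab_fst k u v w x
  have g2 (k u v w x : Fin 3 → ℝ) : (facetPair k u v w).val.2.half.gap x =
      dotProduct (dualVector u v w) k + 1 - dotProduct (dualVector u v w) x :=
    gap_slab_snd k u v w x
  have hP : ∀ x, x ∈ polyhedron l ↔
      (dotProduct (dualVector u v w) k ≤ dotProduct (dualVector u v w) x ∧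
        dotProduct (dualVector u v w) x ≤ dotProduct (dualVector u v w) k + 1) ∧
      (dotProduct (dualVector v w u) k ≤ dotProduct (dualVector v w u) x ∧
        dotProduct (dualVector v w u) x ≤ dotProduct (dualVector v w u) k + 1) ∧
      (dotProduct (dualVector w u v) k ≤ dotProduct (dualVector w u v) x ∧
        dotProduct (dualVector w u v) x ≤ dotProduct (dualVector w u v) k + 1) := by
    intro x
    change (∀ f ∈ l, 0 ≤ f.half.gap x) ↔ _
    simp only [hl, forall_eq_or_imp, forall_eq, g1, g2, sub_nonneg]
    tauto
  have m : ∀ f ∈ l, f = (facetPair k u v w).val.1 ∨ f = (facetPair k u v w).val.2 ∨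
      f = (facetPair k v w u).val.1 ∨ f = (facetPair k v w u).val.2 ∨
      f = (facetPair k w u v).val.1 ∨ f = (facetPair k w u v).val.2 := fun f hf => (hl f).1 hf
  constructor
  · refine isRepresentedFacet_parallelogram D (s := 0) ⟨le_rfl, zero_le_one⟩ hP ?_
      (B₀ := (facetPair k v w u).val.1) (B₁ := (facetPair k v w u).val.2)
      (C₀ := (facetPair k w u v).val.1) (C₁ := (facetPair k w u v).val.2)
      ((hl _).2 (by simp)) ((hl _).2 (by simp)) ((hl _).2 (by simp)) ((hl _).2 (by simp))
      (g1 _ _ _ _) (g2 _ _ _ _) (g1 _ _ _ _) (g2 _ _ _ _) ?_ ?_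
    · intro x
      rw [g1, add_zero, sub_eq_zero]
    · intro g hg hne
      rcases m g hg with rfl | rfl | h | h | h | h
      · exact absurd rfl hne
      · refine Or.inr <| Or.inr <| Or.inr <| Or.inr fun x hx => ?_
        rw [g1] at hx
        rw [g2]; linarith
      all_goals simp [h]
    · rw [val_facetPair]; simp
  · refine isRepresentedFacet_parallelogram D (s := 1) ⟨zero_le_one, le_rfl⟩ hP ?_
      (B₀ := (facetPair k v w u).val.1) (B₁ := (facetPair k v w u).val.2)
      (C₀ := (facetPair k w u v).val.1) (C₁ := (facetPair k w u v).val.2)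
      ((hl _).2 (by simp)) ((hl _).2 (by simp)) ((hl _).2 (by simp)) ((hl _).2 (by simp))
      (g1 _ _ _ _) (g2 _ _ _ _) (g1 _ _ _ _) (g2 _ _ _ _) ?_ ?_
    · intro x
      rw [g2, sub_eq_zero, eq_comm]
    · intro g hg hne
      rcases m g hg with rfl | rfl | h | h | h | h
      · refine Or.inr <| Or.inr <| Or.inr <| Or.inr fun x hx => ?_
        rw [g2] at hx
        rw [g1]; linarith
      · exact absurd rfl hne
      all_goals simp [h]
    · rw [val_facetPair]; simp

namespace Projector

variable (p : Projector ℝ)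

/-- The volume of the gamut, up to sign. -/
noncomputable def volume : ℝ :=
  dotProduct (p.R - p.K) (crossProduct (p.G - p.K) (p.B - p.K))

theorem val_gamutHalfspaces : (gamutHalfspaces p).val =
    [(slab p.K (p.R - p.K) (p.G - p.K) (p.B - p.K)).val.1,
      (slab p.K (p.R - p.K) (p.G - p.K) (p.B - p.K)).val.2,
      (slab p.K (p.G - p.K) (p.B - p.K) (p.R - p.K)).val.1,
      (slab p.K (p.G - p.K) (p.B - p.K) (p.R - p.K)).val.2,
      (slab p.K (p.B - p.K) (p.R - p.K) (p.G - p.K)).val.1,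
      (slab p.K (p.B - p.K) (p.R - p.K) (p.G - p.K)).val.2] := by
  simp [gamutHalfspaces]

theorem val_gamutFacets : (gamutFacets p).val =
    [(facetPair p.K (p.R - p.K) (p.G - p.K) (p.B - p.K)).val.1,
      (facetPair p.K (p.R - p.K) (p.G - p.K) (p.B - p.K)).val.2,
      (facetPair p.K (p.G - p.K) (p.B - p.K) (p.R - p.K)).val.1,
      (facetPair p.K (p.G - p.K) (p.B - p.K) (p.R - p.K)).val.2,
      (facetPair p.K (p.B - p.K) (p.R - p.K) (p.G - p.K)).val.1,
      (facetPair p.K (p.B - p.K) (p.R - p.K) (p.G - p.K)).val.2] := by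
  simp [gamutFacets]

theorem map_half_gamutFacets :
    (gamutFacets p).val.map Facet.half = (gamutHalfspaces p).val := by
  rw [val_gamutFacets, val_gamutHalfspaces]; rfl

variable {p}

theorem mem_gamut_iff (hp : p.volume ≠ 0) (x : Fin 3 → ℝ) :
    x ∈ p.gamut ↔ ∀ h ∈ (gamutHalfspaces p).val, 0 ≤ h.gap x := by
  have D := isDualFrame_dualVector hp
  rw [val_gamutHalfspaces]
  simp only [List.mem_cons, List.not_mem_nil, or_false, forall_eq_or_imp, forall_eq, gap_slab_fst,
    gap_slab_snd]
  constructor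
  · rintro ⟨α, ⟨a0, a1⟩, β, ⟨b0, b1⟩, γ, ⟨c0, c1⟩, rfl⟩
    simp only [dotProduct_add, dotProduct_smul, D.au, D.av, D.aw, D.bu, D.bv, D.bw, D.cu, D.cv,
      D.cw, smul_eq_mul]
    refine ⟨?_, ?_, ?_, ?_, ?_, ?_⟩ <;> linarith
  · rintro ⟨a0, a1, b0, b1, c0, c1⟩
    refine ⟨_, ⟨a0, by linarith⟩, _, ⟨b0, by linarith⟩, _, ⟨c0, by linarith⟩, ?_⟩
    have h3 := D.expand (x - p.K)
    simp only [dotProduct_sub] at h3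
    refine (add_sub_cancel p.K x).symm.trans ?_
    rw [h3]
    module

theorem isBounded_gamut (p : Projector ℝ) : Bornology.IsBounded p.gamut := by
  rw [isBounded_iff_forall_norm_le]
  refine ⟨‖p.K‖ + ‖p.R - p.K‖ + ‖p.G - p.K‖ + ‖p.B - p.K‖, ?_⟩
  rintro x ⟨α, ⟨a0, a1⟩, β, ⟨b0, b1⟩, γ, ⟨c0, c1⟩, rfl⟩
  have key : ∀ (t : ℝ) (v : Fin 3 → ℝ), 0 ≤ t → t ≤ 1 → ‖t • v‖ ≤ ‖v‖ := by
    intro t v t0 t1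
    rw [norm_smul, Real.norm_of_nonneg t0]
    exact mul_le_of_le_one_left (norm_nonneg _) t1
  refine (norm_add_le _ _).trans (add_le_add ?_ (key _ _ c0 c1))
  refine (norm_add_le _ _).trans (add_le_add ?_ (key _ _ b0 b1))
  exact (norm_add_le _ _).trans (add_le_add le_rfl (key _ _ a0 a1))

theorem exists_add_smul_mem_of_interior {S : Set (Fin 3 → ℝ)} {c : Fin 3 → ℝ} (hc : c ∈ interior S)
    (d : Fin 3 → ℝ) : ∃ ε : ℝ, 0 < ε ∧ c + ε • d ∈ S := by
  have hcont : Filter.Tendsto (fun ε : ℝ => c + ε • d) (nhds 0) (nhds c) := by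
    have : Continuous fun ε : ℝ => c + ε • d := by fun_prop
    simpa using this.tendsto 0
  have h1 := hcont.eventually (mem_interior_iff_mem_nhds.1 hc)
  obtain ⟨ε, hε, h⟩ := Metric.eventually_nhds_iff.1 h1
  refine ⟨ε / 2, by positivity, h ?_⟩
  rw [dist_zero_right, Real.norm_of_nonneg (by positivity)]
  linarith

/-- If the edge vectors are dependent, some `m ≠ 0` is orthogonal to all of them and the gamut lies
in a plane with normal `m`, so no point of it can be moved in the direction `m`. -/
theorem volume_ne_zero {c : Fin 3 → ℝ} (hc : c ∈ interior p.gamut) : p.volume ≠ 0 := by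
  intro h0
  have hdet : (Matrix.of ![p.R - p.K, p.G - p.K, p.B - p.K] : Matrix (Fin 3) (Fin 3) ℝ).det = 0 := by
    rw [volume, triple_product_eq_det] at h0
    exact h0
  obtain ⟨m, hm, H⟩ := Matrix.exists_mulVec_eq_zero_iff.2 hdet
  have e0 : dotProduct m (p.R - p.K) = 0 := by
    rw [dotProduct_comm]; exact congrFun H 0
  have e1 : dotProduct m (p.G - p.K) = 0 := by
    rw [dotProduct_comm]; exact congrFun H 1
  have e2 : dotProduct m (p.B - p.K) = 0 := by
    rw [dotProduct_comm]; exact congrFun H 2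
  have key : ∀ x ∈ p.gamut, dotProduct m x = dotProduct m p.K := by
    rintro x ⟨α, -, β, -, γ, -, rfl⟩
    simp only [dotProduct_add, dotProduct_smul, e0, e1, e2, smul_zero, add_zero]
  obtain ⟨ε, hε, h⟩ := exists_add_smul_mem_of_interior hc m
  have h1 := key _ h
  rw [dotProduct_add, dotProduct_smul, key c (interior_subset hc), smul_eq_mul, add_eq_left] at h1
  rcases mul_eq_zero.1 h1 with h1 | h1
  · exact hε.ne' h1
  · exact hm (dotProduct_self_eq_zero.1 h1)

/-- An interior point can be moved a little in the direction of the normal, which lowers the gap but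
leaves it nonnegative. -/
theorem gap_pos_of_interior {c : Fin 3 → ℝ} (hc : c ∈ interior p.gamut) :
    ∀ h ∈ (gamutHalfspaces p).val, 0 < h.gap c := by
  have hv := volume_ne_zero hc
  have D := isDualFrame_dualVector hv
  intro h hh
  have hn : h.normal ≠ 0 := by
    have ne (u v w : Fin 3 → ℝ) (huv : dotProduct (dualVector u v w) u = 1) :
        dualVector u v w ≠ 0 := by
      intro h0
      rw [h0, zero_dotProduct] at huv
      exact zero_ne_one huv
    rw [val_gamutHalfspaces] at hh
    simp only [List.mem_cons, List.not_mem_nil, or_false, val_slab] at hh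
    rcases hh with rfl | rfl | rfl | rfl | rfl | rfl
    · exact smul_ne_zero (by norm_num) (ne _ _ _ D.au)
    · exact ne _ _ _ D.au
    · exact smul_ne_zero (by norm_num) (ne _ _ _ D.bv)
    · exact ne _ _ _ D.bv
    · exact smul_ne_zero (by norm_num) (ne _ _ _ D.cw)
    · exact ne _ _ _ D.cw
  obtain ⟨ε, hε, hmem⟩ := exists_add_smul_mem_of_interior hc h.normal
  have h1 := (mem_gamut_iff hv _).1 hmem h hh
  rw [Halfspace.gap_add_smul] at h1
  have h2 : 0 < dotProduct h.normal h.normal := by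
    refine lt_of_le_of_ne ?_ fun h0 => hn (dotProduct_self_eq_zero.1 h0.symm)
    exact Finset.sum_nonneg fun i _ => mul_self_nonneg _
  have := mul_pos hε h2
  linarith

theorem polyhedron_gamutFacets {c : Fin 3 → ℝ} (hc : c ∈ interior p.gamut) :
    polyhedron (gamutFacets p).val = p.gamut := by
  ext x
  rw [mem_gamut_iff (volume_ne_zero hc), ← map_half_gamutFacets, List.forall_mem_map]
  rfl

theorem isRepresentation_gamutFacets {c : Fin 3 → ℝ} (hc : c ∈ interior p.gamut) :
    IsRepresentation c (gamutFacets p).val := by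
  have hv := volume_ne_zero hc
  have D := isDualFrame_dualVector hv
  have h1 : dotProduct (p.G - p.K) (crossProduct (p.B - p.K) (p.R - p.K)) ≠ 0 := by
    rw [← triple_product_permutation]; exact hv
  have h2 : dotProduct (p.B - p.K) (crossProduct (p.R - p.K) (p.G - p.K)) ≠ 0 := by
    rw [← triple_product_permutation]; exact h1
  have mem : ∀ f, f ∈ (gamutFacets p).val ↔ _ := fun f => by
    rw [val_gamutFacets, List.mem_cons, List.mem_cons, List.mem_cons, List.mem_cons, List.mem_cons,
      List.mem_singleton]
  have F : ∀ f ∈ (gamutFacets p).val, IsRepresentedFacet (gamutFacets p).val f := by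
    have k0 := isRepresentedFacet_facetPair hv mem
    have k1 := isRepresentedFacet_facetPair (k := p.K) h1 (l := (gamutFacets p).val)
      (fun f => by rw [mem]; tauto)
    have k2 := isRepresentedFacet_facetPair (k := p.K) h2 (l := (gamutFacets p).val)
      (fun f => by rw [mem]; tauto)
    intro f hf
    rcases (mem f).1 hf with rfl | rfl | rfl | rfl | rfl | rfl
    exacts [k0.1, k0.2, k1.1, k1.2, k2.1, k2.2]
  refine ⟨?_, ?_, ?_, fun f hf => (F f hf).strict, fun f hf => (F f hf).edge_ne,
    fun f hf => (F f hf).edge_eq, fun f hf => (F f hf).complete, fun f hf => (F f hf).distinct⟩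
  -- At this point the six gaps are `0.1`, `0.9`, `0.2`, `0.8`, `0.3`, `0.7`; as they differ, so do
  -- the six halfspaces.
  · set y : Fin 3 → ℝ := p.K + (1 / 10 : ℝ) • (p.R - p.K) + (2 / 10 : ℝ) • (p.G - p.K)
      + (3 / 10 : ℝ) • (p.B - p.K) with hy
    have hnd : ((gamutHalfspaces p).val.map fun h => h.gap y).Nodup := by
      rw [val_gamutHalfspaces]
      simp only [List.map_cons, List.map_nil, gap_slab_fst, gap_slab_snd, hy, dotProduct_add,
        dotProduct_smul, D.au, D.av, D.aw, D.bu, D.bv, D.bw, D.cu, D.cv, D.cw, smul_eq_mul]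
      ring_nf
      norm_num
    rw [← map_half_gamutFacets, List.map_map, List.Nodup, List.pairwise_map] at hnd
    exact hnd.imp fun {f g} h he => h (by simp [he])
  · intro f hf
    refine gap_pos_of_interior hc _ ?_
    rw [← map_half_gamutFacets]
    exact List.mem_map_of_mem hf
  · rw [polyhedron_gamutFacets hc]; exact p.isBounded_gamut

end Projector

/-! ### A linear bound for the number of edges -/

/-- A linear function that separates the points of a finite set. -/
theorem exists_injective_dotProduct (V : Finset (Fin 3 → ℝ)) :
    ∃ n : Fin 3 → ℝ, n ≠ 0 ∧ ∀ v ∈ V, ∀ v' ∈ V, dotProduct n v = dotProduct n v' → v = v' := by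
  classical
  -- The vector is taken on the moment curve `(1, t, t²)`. Its inner product with a difference `d ≠
  -- 0` is a nonzero polynomial in `t`, so only finitely many `t` have to be avoided.
  let q (d : Fin 3 → ℝ) : Polynomial ℝ := Polynomial.C (d 0) + Polynomial.C (d 1) * Polynomial.X +
    Polynomial.C (d 2) * Polynomial.X ^ 2
  have hq (d : Fin 3 → ℝ) (h : q d = 0) : d = 0 := by
    have h0 := congrArg (fun p => Polynomial.coeff p 0) h
    have h1 := congrArg (fun p => Polynomial.coeff p 1) h
    have h2 := congrArg (fun p => Polynomial.coeff p 2) h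
    simp [q, Polynomial.coeff_X, Polynomial.coeff_C, Polynomial.coeff_X_pow] at h0 h1 h2
    ext i
    fin_cases i
    exacts [h0, h1, h2]
  obtain ⟨t, ht⟩ := Infinite.exists_notMem_finset
    ((V ×ˢ V).biUnion fun p => (q (p.1 - p.2)).roots.toFinset)
  refine ⟨![1, t, t ^ 2], ?_, ?_⟩
  · intro h
    have := congrFun h 0
    simp at this
  · intro v hv v' hv' h
    by_contra hne
    apply ht
    rw [Finset.mem_biUnion]
    refine ⟨(v, v'), Finset.mem_product.2 ⟨hv, hv'⟩, ?_⟩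
    rw [Multiset.mem_toFinset, Polynomial.mem_roots fun h0 => hne (sub_eq_zero.1 (hq _ h0))]
    simp [dotProduct, Fin.sum_univ_three] at h
    simp [q]
    linarith

namespace IsRepresentation

variable {c : Fin 3 → ℝ} {l : List (Facet ℝ)} (H : IsRepresentation c l)
include H

theorem list_nodup : l.Nodup := H.nodup.imp fun {_ _} h he => h (by rw [he])

theorem edges_nodup {f : Facet ℝ} (hf : f ∈ l) : f.edges.Nodup :=
  (H.distinct f hf).imp fun {_ _} h he => h (by rw [he])

/-- An endpoint of an edge lies on at least three facets. -/
theorem exists_third_facet {f : Facet ℝ} (hf : f ∈ l) {e : (Fin 3 → ℝ) × (Fin 3 → ℝ)}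
    (he : e ∈ f.edges) {v : Fin 3 → ℝ} (hv : v = e.1 ∨ v = e.2) :
    ∃ g ∈ l, ∃ k ∈ l, g.half ≠ f.half ∧ k.half ≠ f.half ∧ k.half ≠ g.half ∧
      f.half.gap v = 0 ∧ g.half.gap v = 0 ∧ k.half.gap v = 0 := by
  obtain ⟨y, hvy, hseg⟩ : ∃ y, v ≠ y ∧ segment ℝ e.1 e.2 = segment ℝ v y := by
    rcases hv with rfl | rfl
    · exact ⟨e.2, H.edge_ne f hf e he, rfl⟩
    · exact ⟨e.1, (H.edge_ne f hf e he).symm, segment_symm _ _ _⟩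
  obtain ⟨g, hg, hgf, hs⟩ := H.edge_spec hf he
  rw [hseg] at hs
  obtain ⟨hvP, fv, gv⟩ := (hs v).1 (left_mem_segment _ _ _)
  obtain ⟨-, fy, gy⟩ := (hs y).1 (right_mem_segment _ _ _)
  refine ⟨g, hg, ?_⟩
  by_contra! hcon
  -- If `f` and `g` were the only facets at `v`, the edge could be prolonged beyond its endpoint.
  obtain ⟨ε, hε, hstep⟩ := exists_small_step l v (v - y)
  have hz : ∀ k : Halfspace ℝ, k.gap v = 0 → k.gap y = 0 → k.gap (v + ε • (v - y)) = 0 := by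
    intro k h1 h2
    rw [Halfspace.gap_add_smul, k.dotProduct_normal_sub, h1, h2]; ring
  have hmem : v + ε • (v - y) ∈ polyhedron l := by
    intro k hk
    by_cases h1 : k.half = f.half
    · rw [h1, hz _ fv fy]
    by_cases h2 : k.half = g.half
    · rw [h2, hz _ gv gy]
    exact (hstep ε hε.le le_rfl k hk
      (lt_of_le_of_ne (hvP k hk) (Ne.symm (hcon k hk hgf h1 h2 fv gv)))).le
  obtain ⟨t, t0, -, ht⟩ := mem_segment_iff_lineMap.1 ((hs _).2 ⟨hmem, hz _ fv fy, hz _ gv gy⟩)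
  have h3 : (ε + t) • (v - y) = 0 := by
    rw [add_left_cancel_iff] at ht
    rw [add_smul, ht]; module
  rcases smul_eq_zero.1 h3 with h3 | h3
  · linarith
  · exact hvy (sub_eq_zero.1 h3)

/-- A facet that extends to both sides of a point in some direction has a point strictly inside it on
the same level. -/
theorem exists_strict_level {f : Facet ℝ} (hf : f ∈ l) {n u w : Fin 3 → ℝ} {s : ℝ}
    (hu : u ∈ polyhedron l) (fu : f.half.gap u = 0) (hw : w ∈ polyhedron l)
    (fw : f.half.gap w = 0) (hus : s < dotProduct n u) (hws : dotProduct n w < s) :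
    ∃ x, f.half.gap x = 0 ∧ dotProduct n x = s ∧
      ∀ g ∈ l, g.half ≠ f.half → 0 < g.half.gap x := by
  obtain ⟨z, fz, hz⟩ := H.strict f hf
  have key : ∀ y ∈ polyhedron l, f.half.gap y = 0 →
      (∃ t : ℝ, 0 ≤ t ∧ t < 1 ∧ (1 - t) * dotProduct n z + t * dotProduct n y = s) →
      ∃ x, f.half.gap x = 0 ∧ dotProduct n x = s ∧
        ∀ g ∈ l, g.half ≠ f.half → 0 < g.half.gap x := by
    rintro y hy fy ⟨t, t0, t1, ht⟩
    refine ⟨z + t • (y - z), ?_, ?_, fun g hg hne => ?_⟩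
    · rw [Halfspace.gap_lineMap, fz, fy]; ring
    · rw [← ht, dotProduct_add, dotProduct_smul, dotProduct_sub, smul_eq_mul]; ring
    · rw [Halfspace.gap_lineMap]
      have := mul_pos (sub_pos.2 t1) (hz g hg hne)
      have := mul_nonneg t0 (hy g hg)
      linarith
  -- The strict point is moved towards `u` or `w`, whichever is across the level; the end is not
  -- reached, so strictness is kept.
  rcases le_total (dotProduct n z) s with h | h
  · have hd : 0 < dotProduct n u - dotProduct n z := by linarith
    refine key u hu fu ⟨(s - dotProduct n z) / (dotProduct n u - dotProduct n z),
      div_nonneg (by linarith) hd.le, (div_lt_one hd).2 (by linarith), ?_⟩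
    field_simp
    ring
  · have hd : 0 < dotProduct n z - dotProduct n w := by linarith
    refine key w hw fw ⟨(dotProduct n z - s) / (dotProduct n z - dotProduct n w),
      div_nonneg (by linarith) hd.le, (div_lt_one hd).2 (by linarith), ?_⟩
    field_simp
    ring

/-- The number of edges is linear in the number of facets. -/
theorem sum_length_edges_le : (l.map fun f => f.edges.length).sum ≤ 12 * l.length := by
  classical
  let V : Finset (Fin 3 → ℝ) :=
    (l.flatMap fun f => f.edges.flatMap fun e => [e.1, e.2]).toFinset
  have mem_V : ∀ v, v ∈ V ↔ ∃ f ∈ l, ∃ e ∈ f.edges, v = e.1 ∨ v = e.2 := by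
    intro v
    simp [V, List.mem_flatMap]
  obtain ⟨n, hn, hinj⟩ := exists_injective_dotProduct V
  have V_mem : ∀ v ∈ V, v ∈ polyhedron l := by
    intro v hv
    obtain ⟨f, hf, e, he, rfl | rfl⟩ := (mem_V v).1 hv
    · exact (H.mem_of_mem_edge hf he (left_mem_segment _ _ _)).1
    · exact (H.mem_of_mem_edge hf he (right_mem_segment _ _ _)).1
  -- Incidences of vertices and facets are counted in two ways. In a `mid` incidence the vertex is
  -- neither a highest nor a lowest point of the face.
  let on (f : Facet ℝ) (v : Fin 3 → ℝ) : Prop := f.half.gap v = 0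
  let mid (f : Facet ℝ) (v : Fin 3 → ℝ) : Prop := f.half.gap v = 0 ∧
    (∃ u ∈ polyhedron l, f.half.gap u = 0 ∧ dotProduct n v < dotProduct n u) ∧
    (∃ w ∈ polyhedron l, f.half.gap w = 0 ∧ dotProduct n w < dotProduct n v)
  have hon := Finset.sum_card_bipartiteAbove_eq_sum_card_bipartiteBelow (s := l.toFinset) (t := V) on
  have hmid := Finset.sum_card_bipartiteAbove_eq_sum_card_bipartiteBelow (s := l.toFinset) (t := V)
    mid
  have three : ∀ v ∈ V, 3 ≤ (Finset.bipartiteBelow on l.toFinset v).card := by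
    intro v hv
    obtain ⟨f, hf, e, he, hve⟩ := (mem_V v).1 hv
    obtain ⟨g, hg, k, hk, hgf, hkf, hkg, fv, gv, kv⟩ := H.exists_third_facet hf he hve
    apply Finset.two_lt_card.2
    simp only [Finset.mem_bipartiteBelow, List.mem_toFinset]
    exact ⟨f, ⟨hf, fv⟩, g, ⟨hg, gv⟩, k, ⟨hk, kv⟩, fun h => hgf (by rw [h]), fun h => hkf (by rw [h]),
      fun h => hkg (by rw [h])⟩
  -- The level plane of `n` through `v` cuts the polyhedron in a polygon, and each `mid` facet
  -- contributes a side through `v`; three sides cannot meet in a point.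
  have two : ∀ v ∈ V, (Finset.bipartiteBelow mid l.toFinset v).card ≤ 2 := by
    intro v hv
    by_contra! hc
    obtain ⟨f, hf, g, hg, k, hk, hfg, hfk, hgk⟩ := Finset.two_lt_card.1 hc
    simp only [Finset.mem_bipartiteBelow, List.mem_toFinset] at hf hg hk
    have lev : ∀ f, f ∈ l ∧ mid f v → ∃ x, dotProduct n (x - v) = 0 ∧
        dotProduct f.half.normal (x - v) = 0 ∧
        ∀ g ∈ l, g ≠ f → g.half.gap v = 0 → dotProduct g.half.normal (x - v) < 0 := by
      rintro f ⟨hf, fv, ⟨u, hu, fu, hus⟩, ⟨w, hw, fw, hws⟩⟩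
      obtain ⟨x, fx, nx, hx⟩ := H.exists_strict_level hf hu fu hw fw hus hws
      refine ⟨x, by rw [dotProduct_sub, nx, sub_self],
        by rw [Halfspace.dotProduct_normal_sub, fx, fv, sub_self], fun g hg hgf gv => ?_⟩
      rw [Halfspace.dotProduct_normal_sub, gv, zero_sub, neg_lt_zero]
      exact hx g hg fun h => hgf (H.eq_of_half_eq hg hf h)
    obtain ⟨x, x1, x2, x3⟩ := lev f hf
    obtain ⟨y, y1, y2, y3⟩ := lev g hg
    obtain ⟨z, z1, z2, z3⟩ := lev k hk
    exact no_three_supported hn x1 y1 z1 x2 y2 z2 (y3 f hf.1 hfg hf.2.1) (z3 f hf.1 hfk hf.2.1)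
      (x3 g hg.1 hfg.symm hg.2.1) (z3 g hg.1 hgk hg.2.1) (x3 k hk.1 hfk.symm hk.2.1)
      (y3 k hk.1 hgk.symm hk.2.1)
  -- As `n` separates the vertices, a face has at most one highest and one lowest vertex.
  have extreme : ∀ f ∈ l.toFinset, (Finset.bipartiteAbove on V f).card ≤
      2 + (Finset.bipartiteAbove mid V f).card := by
    intro f hf
    let top := V.filter fun v => f.half.gap v = 0 ∧
      ∀ u ∈ polyhedron l, f.half.gap u = 0 → dotProduct n u ≤ dotProduct n v
    let bot := V.filter fun v => f.half.gap v = 0 ∧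
      ∀ u ∈ polyhedron l, f.half.gap u = 0 → dotProduct n v ≤ dotProduct n u
    have htop : top.card ≤ 1 := by
      refine Finset.card_le_one.2 fun a ha b hb => ?_
      obtain ⟨aV, fa, a2⟩ := Finset.mem_filter.1 ha
      obtain ⟨bV, fb, b2⟩ := Finset.mem_filter.1 hb
      exact hinj a aV b bV (le_antisymm (b2 a (V_mem a aV) fa) (a2 b (V_mem b bV) fb))
    have hbot : bot.card ≤ 1 := by
      refine Finset.card_le_one.2 fun a ha b hb => ?_
      obtain ⟨aV, fa, a2⟩ := Finset.mem_filter.1 ha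
      obtain ⟨bV, fb, b2⟩ := Finset.mem_filter.1 hb
      exact hinj a aV b bV (le_antisymm (a2 b (V_mem b bV) fb) (b2 a (V_mem a aV) fa))
    have hsub : Finset.bipartiteAbove on V f ⊆ (top ∪ bot) ∪ Finset.bipartiteAbove mid V f := by
      intro v hv
      obtain ⟨hv, fv⟩ := (Finset.mem_bipartiteAbove _).1 hv
      have fv : f.half.gap v = 0 := fv
      simp only [Finset.mem_union, Finset.mem_bipartiteAbove, top, bot, Finset.mem_filter, mid]
      by_cases h1 : ∃ u ∈ polyhedron l, f.half.gap u = 0 ∧ dotProduct n v < dotProduct n u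
      · by_cases h2 : ∃ w ∈ polyhedron l, f.half.gap w = 0 ∧ dotProduct n w < dotProduct n v
        · exact Or.inr ⟨hv, fv, h1, h2⟩
        · push Not at h2
          exact Or.inl (Or.inr ⟨hv, fv, h2⟩)
      · push Not at h1
        exact Or.inl (Or.inl ⟨hv, fv, h1⟩)
    have := Finset.card_le_card hsub
    have := Finset.card_union_le (top ∪ bot) (Finset.bipartiteAbove mid V f)
    have := Finset.card_union_le top bot
    omega
  -- At most two edges of a facet contain a given vertex, so at most two have it as their first
  -- endpoint.
  have edges : ∀ f ∈ l.toFinset, f.edges.length ≤ 2 * (Finset.bipartiteAbove on V f).card := by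
    intro f hf
    have hf := List.mem_toFinset.1 hf
    rw [← List.toFinset_card_of_nodup (H.edges_nodup hf)]
    refine Finset.card_le_mul_card_image_of_maps_to (f := Prod.fst) (fun e he => ?_) 2
      fun v hv => ?_
    · have he := List.mem_toFinset.1 he
      exact (Finset.mem_bipartiteAbove on).2 ⟨(mem_V _).2 ⟨f, hf, e, he, Or.inl rfl⟩,
        (H.mem_of_mem_edge hf he (left_mem_segment _ _ _)).2⟩
    · by_contra! hc
      obtain ⟨e₁, h1, e₂, h2, e₃, h3, h12, h13, h23⟩ := Finset.two_lt_card.1 hc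
      simp only [Finset.mem_filter, List.mem_toFinset] at h1 h2 h3
      exact H.no_three_edges hf h1.1 h2.1 h3.1 h12 h13 h23 (v := v)
        (h1.2 ▸ left_mem_segment _ _ _) (h2.2 ▸ left_mem_segment _ _ _)
        (h3.2 ▸ left_mem_segment _ _ _)
  have hF : l.toFinset.card = l.length := List.toFinset_card_of_nodup H.list_nodup
  have hsum : (l.map fun f => f.edges.length).sum = ∑ f ∈ l.toFinset, f.edges.length :=
    (List.sum_toFinset _ H.list_nodup).symm
  have s1 : ∑ f ∈ l.toFinset, f.edges.length ≤
      2 * ∑ f ∈ l.toFinset, (Finset.bipartiteAbove on V f).card := by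
    rw [Finset.mul_sum]; exact Finset.sum_le_sum edges
  have s2 : ∑ f ∈ l.toFinset, (Finset.bipartiteAbove on V f).card ≤
      2 * l.length + ∑ f ∈ l.toFinset, (Finset.bipartiteAbove mid V f).card := by
    refine (Finset.sum_le_sum extreme).trans ?_
    rw [Finset.sum_add_distrib, Finset.sum_const, hF, smul_eq_mul, mul_comm]
  have s3 : ∑ v ∈ V, (Finset.bipartiteBelow mid l.toFinset v).card ≤ V.card * 2 :=
    Finset.sum_le_card_nsmul _ _ _ two
  have s4 : V.card * 3 ≤ ∑ v ∈ V, (Finset.bipartiteBelow on l.toFinset v).card :=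
    Finset.card_nsmul_le_sum _ _ _ three
  -- With `V` vertices and `F` facets there are at least `3V` and at most `2F + 2V` incidences. So
  -- `V ≤ 2F`, there are at most `6F` incidences, and at most twice as many edges.
  omega

end IsRepresentation

/-! ### Running time of the construction -/

namespace Timed

theorem time_forEach_le {α σ : Type} (f : σ → α → Timed σ) (T : α → ℕ) (l : List α) (s : σ)
    (h : ∀ s, ∀ a ∈ l, (f s a).time ≤ T a) :
    (forEach f l s).time ≤ 1 + (l.map fun a => T a + 1).sum := by
  induction l generalizing s with
  | nil => exact le_rfl
  | cons a l ih =>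
    have h1 : (forEach f (a :: l) s).time = 1 + ((f s a).time + (forEach f l (f s a).val).time) := rfl
    have h2 := h s a List.mem_cons_self
    have h3 := ih (f s a).val fun s b hb => h s b (List.mem_cons_of_mem _ hb)
    rw [h1, List.map_cons, List.sum_cons]
    omega

theorem time_forEach_le_mul {α σ : Type} (f : σ → α → Timed σ) (T : ℕ) (l : List α) (s : σ)
    (h : ∀ s, ∀ a ∈ l, (f s a).time ≤ T) : (forEach f l s).time ≤ 1 + l.length * (T + 1) := by
  have := time_forEach_le f (fun _ => T) l s h
  simpa using this

theorem length_forEach_le {α β : Type} (f : List β → α → Timed (List β)) (k : ℕ) (l : List α)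
    (s : List β) (h : ∀ s, ∀ a ∈ l, (f s a).val.length ≤ s.length + k) :
    (forEach f l s).val.length ≤ s.length + l.length * k := by
  rw [val_forEach]
  induction l generalizing s with
  | nil => simp
  | cons a l ih =>
    rw [List.foldl_cons, List.length_cons]
    have h1 := h s a List.mem_cons_self
    have h2 := ih (f s a).val fun s b hb => h s b (List.mem_cons_of_mem _ hb)
    rw [add_mul]
    omega

end Timed

section

variable (x y z w : ℝ) (a b : Fin 3 → ℝ)

@[simp] theorem time_add : (Timed.add x y).time = 1 := rfl
@[simp] theorem time_sub : (Timed.sub x y).time = 1 := rfl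
@[simp] theorem time_mul : (Timed.mul x y).time = 1 := rfl
@[simp] theorem time_div : (Timed.div x y).time = 1 := rfl
@[simp] theorem time_lt : (Timed.lt x y).time = 1 := rfl
@[simp] theorem time_le : (Timed.le x y).time = 1 := rfl
@[simp] theorem time_eq : (Timed.eq x y).time = 1 := rfl
@[simp] theorem time_push {α : Type} (a : α) (l : List α) : (Timed.push a l).time = 1 := rfl
@[simp] theorem time_det2 : (Timed.det2 x y z w).time = 3 := rfl
@[simp] theorem time_vadd : (Timed.vadd a b).time = 3 := rfl
@[simp] theorem time_vsub : (Timed.vsub a b).time = 3 := rfl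
@[simp] theorem time_vscale : (Timed.vscale x a).time = 3 := rfl
@[simp] theorem time_dot : (Timed.dot a b).time = 5 := rfl
@[simp] theorem time_cross : (Timed.cross a b).time = 9 := rfl

end

theorem time_slack (h : Halfspace ℝ) (x : Fin 3 → ℝ) : (slack h x).time = 6 := rfl

theorem time_cutEdge_le (h : Halfspace ℝ) (e : (Fin 3 → ℝ) × (Fin 3 → ℝ)) :
    (cutEdge h e).time ≤ 25 := by
  have h1 (p q : Fin 3 → ℝ) (s r : ℝ) : (cutPoint p q s r).time = 11 := rfl
  have h2 (x y : ℝ) : (Timed.lt x y).time = 1 := rfl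
  simp only [cutEdge, Timed.time_bind, time_slack, h2]
  rcases (Timed.lt 0 (slack h e.1).val).val <;> rcases (Timed.lt 0 (slack h e.2).val).val <;>
    simp [h1]

theorem time_cutEdges_le (h : Halfspace ℝ) (es : List ((Fin 3 → ℝ) × (Fin 3 → ℝ))) :
    (cutEdges h es).time ≤ 1 + es.length * 28 := by
  refine Timed.time_forEach_le_mul _ 27 es _ fun st e _ => ?_
  have h1 := time_cutEdge_le h e
  simp only [Timed.time_bind, Timed.time_pure]
  rcases (cutEdge h e).val with ⟨_ | a, _ | b⟩ <;> simp [Timed.push] <;> omega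

theorem time_cutFacet_le (h : Halfspace ℝ) (f : Facet ℝ) :
    (cutFacet h f).time ≤ f.edges.length * 28 + 5 := by
  have h1 := time_cutEdges_le h f.edges
  have hv (x y : Fin 3 → ℝ) : (Timed.veq x y).time = 3 := rfl
  rw [cutFacet, Timed.time_bind]
  rcases (cutEdges h f.edges).val with ⟨_ | ⟨k, ks⟩, _ | ⟨x, _ | ⟨y, _ | ⟨z, r⟩⟩⟩⟩ <;>
    simp only [Timed.time_bind, Timed.time_pure, hv]
  all_goals try omega
  rcases (Timed.veq x y).val <;> simp [Timed.push] <;> omega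

theorem List.sum_map_mul_add {α : Type} (l : List α) (T : α → ℕ) (a b : ℕ) :
    (l.map fun x => T x * a + b).sum = (l.map T).sum * a + l.length * b := by
  induction l with
  | nil => simp
  | cons x l ih => simp only [List.map_cons, List.sum_cons, List.length_cons, ih]; ring

theorem time_isViolated_le (h : Halfspace ℝ) (l : List (Facet ℝ)) : (isViolated h l).time ≤
    1 + ((l.map fun f => f.edges.length).sum * 15 + l.length * 2) := by
  have h2 : ∀ F : Bool → Facet ℝ → Timed Bool,
      (∀ st, ∀ f ∈ l, (F st f).time ≤ f.edges.length * 15 + 1) → (Timed.forEach F l false).time ≤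
        1 + ((l.map fun f => f.edges.length).sum * 15 + l.length * 2) := by
    intro F hF
    rw [← List.sum_map_mul_add]
    exact Timed.time_forEach_le F (fun f => f.edges.length * 15 + 1) l _ hF
  refine h2 _ fun b f _ => ?_
  rw [add_comm]
  refine Timed.time_forEach_le_mul _ 14 f.edges _ fun b e _ => ?_
  simp [time_slack]

theorem time_cutPolyhedron_le (l : List (Facet ℝ)) (h : Halfspace ℝ) : (cutPolyhedron l h).time ≤
    3 + ((l.map fun f => f.edges.length).sum * 43 + l.length * 10) := by
  have h1 := time_isViolated_le h l
  rw [cutPolyhedron, Timed.time_bind]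
  rcases (isViolated h l).val
  · simp only [Timed.time_pure]
    omega
  · have h2 : ∀ F : List (Facet ℝ) × List ((Fin 3 → ℝ) × (Fin 3 → ℝ)) → Facet ℝ → Timed _,
        (∀ st, ∀ f ∈ l, (F st f).time ≤ f.edges.length * 28 + 7) → (Timed.forEach F l ([], [])).time ≤
          1 + ((l.map fun f => f.edges.length).sum * 28 + l.length * 8) := by
      intro F hF
      rw [← List.sum_map_mul_add]
      exact Timed.time_forEach_le F (fun f => f.edges.length * 28 + 7) l _ hF
    simp only [Timed.time_bind, time_push]
    refine (Nat.add_le_add h1 (Nat.add_le_add_right (h2 _ fun st f _ => ?_) 1)).trans (by omega)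
    have h3 := time_cutFacet_le h f
    simp only [Timed.time_bind, Timed.time_pure]
    rcases (cutFacet h f).val with ⟨_ | a, _ | b⟩ <;> simp <;> omega

/-- The constant is `43 * 12 + 10`, from at most 12 edges per facet on average. -/
theorem IsRepresentation.time_cutPolyhedron_le {c : Fin 3 → ℝ} {l : List (Facet ℝ)}
    (H : IsRepresentation c l) (h : Halfspace ℝ) :
    (_root_.cutPolyhedron l h).time ≤ 3 + l.length * 526 := by
  have := _root_.time_cutPolyhedron_le l h
  have := H.sum_length_edges_le
  omega

/-- A cut adds at most one facet, so `l.length + hs.length` bounds the number of facets throughout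
the loop. -/
theorem IsRepresentation.forEach_cutPolyhedron {c : Fin 3 → ℝ} (hs : List (Halfspace ℝ))
    {l : List (Facet ℝ)} (H : IsRepresentation c l) (hc : ∀ h ∈ hs, 0 < h.gap c) :
    IsRepresentation c (Timed.forEach _root_.cutPolyhedron hs l).val ∧
      polyhedron (Timed.forEach _root_.cutPolyhedron hs l).val =
        {x ∈ polyhedron l | ∀ h ∈ hs, 0 ≤ h.gap x} ∧
      (Timed.forEach _root_.cutPolyhedron hs l).val.length ≤ l.length + hs.length ∧
      (Timed.forEach _root_.cutPolyhedron hs l).time ≤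
        1 + hs.length * (4 + (l.length + hs.length) * 526) := by
  induction hs generalizing l with
  | nil => exact ⟨H, by ext x; simp [Timed.forEach], le_rfl, by simp [Timed.forEach, Timed.tick]⟩
  | cons h hs ih =>
    obtain ⟨H1, H2, H3⟩ := H.cutPolyhedron (hc h List.mem_cons_self)
    obtain ⟨I1, I2, I3, I4⟩ := ih H1 fun k hk => hc k (List.mem_cons_of_mem _ hk)
    have ht : (Timed.forEach _root_.cutPolyhedron (h :: hs) l).time = 1 +
      ((_root_.cutPolyhedron l h).time +
        (Timed.forEach _root_.cutPolyhedron hs (_root_.cutPolyhedron l h).val).time) := rfl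
    refine ⟨I1, I2.trans ?_, ?_, ?_⟩
    · rw [H2]
      ext x
      simp only [Set.mem_ofPred_eq, List.mem_cons, forall_eq_or_imp, and_assoc]
    · refine I3.trans ?_
      rw [List.length_cons]
      omega
    · rw [ht, List.length_cons]
      have h1 := H.time_cutPolyhedron_le h
      have h2 : hs.length * (4 + ((_root_.cutPolyhedron l h).val.length + hs.length) * 526) ≤
          hs.length * (4 + (l.length + (hs.length + 1)) * 526) :=
        Nat.mul_le_mul_left _ (by omega)
      have h3 : (hs.length + 1) * (4 + (l.length + (hs.length + 1)) * 526) =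
          hs.length * (4 + (l.length + (hs.length + 1)) * 526) +
            (4 + (l.length + (hs.length + 1)) * 526) := by ring
      rw [h3]
      omega

theorem time_slab (k u v w : Fin 3 → ℝ) : (slab k u v w).time = 28 := by simp [slab]

theorem time_gamutHalfspaces (p : Projector ℝ) : (gamutHalfspaces p).time = 93 := by
  simp [gamutHalfspaces, time_slab]

theorem time_gamutFacets (p : Projector ℝ) : (gamutFacets p).time = 156 := by
  have h (k u v w : Fin 3 → ℝ) : (facetPair k u v w).time = 49 := by
    simp [facetPair, time_slab, parallelogramEdges]
  simp [gamutFacets, h]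

theorem length_gamutHalfspaces (p : Projector ℝ) : (gamutHalfspaces p).val.length = 6 := rfl

/-- The bound `m` on the final number of facets is fixed in advance, so every round has the same
cost: `119 = 1 + 93 + 1 + 6 * 4` and `3156 = 6 * 526`. -/
theorem IsRepresentation.forEach_projector {c : Fin 3 → ℝ} (m : ℕ) (ps : List (Projector ℝ))
    {l : List (Facet ℝ)} (H : IsRepresentation c l) (hc : ∀ p ∈ ps, c ∈ interior p.gamut)
    (hm : l.length + 6 * ps.length ≤ m) {r : Timed (List (Facet ℝ))}
    (hr : r = Timed.forEach (fun (l : List (Facet ℝ)) (q : Projector ℝ) => do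
        let hs ← gamutHalfspaces q
        Timed.forEach _root_.cutPolyhedron hs l) ps l) :
    IsRepresentation c r.val ∧
      polyhedron r.val = {x ∈ polyhedron l | ∀ p ∈ ps, x ∈ p.gamut} ∧
      r.val.length ≤ m ∧ r.time ≤ 1 + ps.length * (119 + m * 3156) := by
  induction ps generalizing l r with
  | nil =>
    subst hr
    exact ⟨H, by ext x; simp [Timed.forEach], (Nat.le_add_right _ _).trans hm, by simp [Timed.forEach, Timed.tick]⟩
  | cons p ps ih =>
    have hp := hc p List.mem_cons_self
    obtain ⟨H1, H2, H3, H4⟩ := H.forEach_cutPolyhedron (gamutHalfspaces p).val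
      (Projector.gap_pos_of_interior hp)
    rw [length_gamutHalfspaces] at H3 H4
    rw [List.length_cons] at hm
    set l' := (Timed.forEach _root_.cutPolyhedron (gamutHalfspaces p).val l) with hl'
    obtain ⟨I1, I2, I3, I4⟩ := ih H1 (fun k hk => hc k (List.mem_cons_of_mem _ hk))
      (by omega) rfl
    have hv : r.val = (Timed.forEach (fun (l : List (Facet ℝ)) (q : Projector ℝ) => do
        let hs ← gamutHalfspaces q
        Timed.forEach _root_.cutPolyhedron hs l) ps l'.val).val := by rw [hr]; rfl
    have ht : r.time = 1 + ((gamutHalfspaces p).time + l'.time +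
        (Timed.forEach (fun (l : List (Facet ℝ)) (q : Projector ℝ) => do
        let hs ← gamutHalfspaces q
        Timed.forEach _root_.cutPolyhedron hs l) ps l'.val).time) := by rw [hr]; rfl
    rw [hv]
    refine ⟨I1, I2.trans ?_, I3, ?_⟩
    · rw [H2]
      ext x
      simp only [Set.mem_ofPred_eq, List.mem_cons, forall_eq_or_imp, and_assoc,
        Projector.mem_gamut_iff (Projector.volume_ne_zero hp)]
    · rw [ht, time_gamutHalfspaces, List.length_cons, Nat.succ_mul]
      omega

/-- The construction of the polyhedron: correctness, size and time. -/
theorem constructPolyhedron_spec {ps : List (Projector ℝ)} (hps : ps ≠ []) {c : Fin 3 → ℝ}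
    (hc : c ∈ interior (gamutIntersection ps)) :
    IsRepresentation c (constructPolyhedron ps).val ∧
      polyhedron (constructPolyhedron ps).val = gamutIntersection ps ∧
      (constructPolyhedron ps).val.length ≤ 6 * ps.length ∧
      (constructPolyhedron ps).time ≤ 175 + ps.length * (119 + 6 * ps.length * 3156) := by
  have hc' : ∀ p ∈ ps, c ∈ interior p.gamut := fun p hp => 
    interior_mono (fun x (hx : ∀ p ∈ ps, x ∈ p.gamut) => hx p hp) hc
  obtain _ | ⟨p, ps⟩ := ps
  · exact absurd rfl hps
  have hp := hc' p List.mem_cons_self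
  have hlen : (gamutFacets p).val.length = 6 := rfl
  obtain ⟨I1, I2, I3, I4⟩ := (Projector.isRepresentation_gamutFacets hp).forEach_projector
    (6 * (ps.length + 1)) ps (fun q hq => hc' q (List.mem_cons_of_mem _ hq))
    (by rw [hlen]; omega) rfl
  have ht : (constructPolyhedron (p :: ps)).time = (gamutFacets p).time +
    (Timed.forEach (fun (l : List (Facet ℝ)) (q : Projector ℝ) => do
        let hs ← gamutHalfspaces q
        Timed.forEach _root_.cutPolyhedron hs l) ps (gamutFacets p).val).time := rfl
  refine ⟨I1, I2.trans ?_, I3, ?_⟩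
  · rw [Projector.polyhedron_gamutFacets hp]
    ext x
    simp [gamutIntersection]
  · rw [ht, time_gamutFacets, List.length_cons, Nat.succ_mul]
    omega

/-! ### What the loops of steps 2 to 5 compute -/

/-- The common form of the searches for a minimum, a maximum and a best pair: `r t b` means that `t`
is at least as good as `b`, and `F` gives the optional candidate of an element. -/
theorem foldl_best {α β : Type} (r : β → β → Prop) (hrefl : ∀ b, r b b)
    (htrans : ∀ a b c, r a b → r b c → r a c) (F : α → Option β) (step : Option β → α → Option β)
    (h₁ : ∀ a, step none a = F a) (h₂ : ∀ a b, F a = none → step (some b) a = some b)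
    (h₃ : ∀ a b t, F a = some t →
      (step (some b) a = some t ∧ r t b) ∨ (step (some b) a = some b ∧ r b t))
    (l : List α) (init : Option β) :
    (l.foldl step init = none → init = none ∧ ∀ a ∈ l, F a = none) ∧
      ∀ t, l.foldl step init = some t → (init = some t ∨ ∃ a ∈ l, F a = some t) ∧
        (∀ b, init = some b → r t b) ∧ ∀ a ∈ l, ∀ b, F a = some b → r t b := by
  induction l generalizing init with
  | nil =>
    refine ⟨fun h => ⟨h, by simp⟩, fun t ht => ⟨Or.inl ht, fun b hb => ?_, by simp⟩⟩
    obtain rfl : t = b := Option.some.inj (ht.symm.trans hb)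
    exact hrefl t
  | cons a l ih =>
    obtain ⟨i1, i2⟩ := ih (step init a)
    rw [List.foldl_cons]
    have hs : (step init a = none → init = none ∧ F a = none) ∧ ∀ s, step init a = some s →
        (init = some s ∨ F a = some s) ∧ (∀ b, init = some b → r s b) ∧
          ∀ b, F a = some b → r s b := by
      rcases init with _ | b
      · rw [h₁]
        refine ⟨fun h => ⟨rfl, h⟩, fun s hs => ⟨Or.inr hs, by simp, fun b hb => ?_⟩⟩
        obtain rfl : s = b := Option.some.inj (hs.symm.trans hb)
        exact hrefl s
      · cases hF : F a with
        | none =>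
          rw [h₂ a b hF]
          refine ⟨by simp, fun s hs => ⟨Or.inl hs, fun b' hb => ?_, by simp⟩⟩
          obtain rfl : s = b' := Option.some.inj (hs.symm.trans hb)
          exact hrefl s
        | some t =>
          rcases h₃ a b t hF with ⟨h, hr⟩ | ⟨h, hr⟩ <;> rw [h]
          · refine ⟨by simp, fun s hs => ?_⟩
            obtain rfl := Option.some.inj hs
            refine ⟨Or.inr rfl, fun b' hb => ?_, fun b' hb => ?_⟩
            · exact Option.some.inj hb ▸ hr
            · exact Option.some.inj hb ▸ hrefl _
          · refine ⟨by simp, fun s hs => ?_⟩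
            obtain rfl := Option.some.inj hs
            refine ⟨Or.inl rfl, fun b' hb => ?_, fun b' hb => ?_⟩
            · exact Option.some.inj hb ▸ hrefl _
            · exact Option.some.inj hb ▸ hr
    constructor
    · intro h
      obtain ⟨h3, h4⟩ := i1 h
      obtain ⟨h5, h6⟩ := hs.1 h3
      exact ⟨h5, List.forall_mem_cons.2 ⟨h6, h4⟩⟩
    · intro t ht
      obtain ⟨h3, h4, h5⟩ := i2 t ht
      cases hst : step init a with
      | none =>
        obtain ⟨rfl, h6⟩ := hs.1 hst
        refine ⟨?_, by simp, List.forall_mem_cons.2 ⟨by simp [h6], h5⟩⟩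
        rcases h3 with h3 | ⟨a', ha', h3⟩
        · rw [hst] at h3; simp at h3
        · exact Or.inr ⟨a', List.mem_cons_of_mem _ ha', h3⟩
      | some s =>
        obtain ⟨h6, h7, h8⟩ := hs.2 s hst
        have hts := h4 s hst
        refine ⟨?_, fun b hb => htrans _ _ _ hts (h7 b hb),
          List.forall_mem_cons.2 ⟨fun b hb => htrans _ _ _ hts (h8 b hb), h5⟩⟩
        rcases h3 with h3 | ⟨a', ha', h3⟩
        · rw [hst] at h3
          rw [← h3]
          rcases h6 with h6 | h6
          · exact Or.inl h6
          · exact Or.inr ⟨a, List.mem_cons_self, h6⟩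
        · exact Or.inr ⟨a', List.mem_cons_of_mem _ ha', h3⟩

theorem foldl_push_option {α β : Type} (F : α → Option β) (l : List α) (acc : List β) :
    l.foldl (fun acc a => (F a).elim acc (· :: acc)) acc = (l.filterMap F).reverse ++ acc := by
  induction l generalizing acc with
  | nil => rfl
  | cons a l ih =>
    rw [List.foldl_cons, ih]
    cases hF : F a <;> simp [hF]

theorem val_partitionFacets (l : List (Facet ℝ)) : (partitionFacets l).val =
    ((l.filter fun f => f.half.offset < 0).reverse, (l.filter fun f => 0 < f.half.offset).reverse) := by
  have key (st : List (Facet ℝ) × List (Facet ℝ)) : l.foldl (fun st f =>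
      (if f.half.offset < 0 then (f :: st.1, st.2) else if 0 < f.half.offset then (st.1, f :: st.2)
        else st)) st = ((l.filter fun f => f.half.offset < 0).reverse ++ st.1,
        (l.filter fun f => 0 < f.half.offset).reverse ++ st.2) := by
    induction l generalizing st with
    | nil => rfl
    | cons f l ih =>
      rw [List.foldl_cons, ih]
      rcases lt_trichotomy f.half.offset 0 with h | h | h
      · simp [h, h.not_gt]
      · simp [h]
      · simp [h, h.not_gt]
  have := key ([], [])
  simp only [List.append_nil] at this
  rw [partitionFacets, Timed.val_forEach, ← this]
  congr 1
  ext st f : 2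
  rcases lt_trichotomy f.half.offset 0 with h | h | h
  · simp [h]
  · simp [h]
  · simp [h, h.not_gt]

theorem val_allEdges (l : List (Facet ℝ)) (acc : List ((Fin 3 → ℝ) × (Fin 3 → ℝ))) :
    (∀ e, e ∈ (Timed.forEach (fun (acc : List ((Fin 3 → ℝ) × (Fin 3 → ℝ))) (f : Facet ℝ) =>
      Timed.forEach (fun (acc : List ((Fin 3 → ℝ) × (Fin 3 → ℝ))) e => Timed.push e acc)
        f.edges acc) l acc).val ↔ e ∈ acc ∨ ∃ f ∈ l, e ∈ f.edges) := by
  have inner (es acc : List ((Fin 3 → ℝ) × (Fin 3 → ℝ))) :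
      es.foldl (fun acc e => e :: acc) acc = es.reverse ++ acc := by
    induction es generalizing acc with
    | nil => rfl
    | cons e es ih => rw [List.foldl_cons, ih]; simp
  simp only [Timed.val_forEach, Timed.val_push, inner]
  induction l generalizing acc with
  | nil => simp
  | cons f l ih =>
    intro e
    rw [List.foldl_cons, ih]
    simp [or_assoc, or_left_comm]

theorem mem_allEdges {l : List (Facet ℝ)} {e : (Fin 3 → ℝ) × (Fin 3 → ℝ)} :
    e ∈ (allEdges l).val ↔ ∃ f ∈ l, e ∈ f.edges := by
  rw [allEdges, val_allEdges]; simp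

theorem mem_allVertices {l : List (Facet ℝ)} {v : Fin 3 → ℝ} :
    v ∈ (allVertices l).val ↔ ∃ f ∈ l, ∃ e ∈ f.edges, v = e.1 ∨ v = e.2 := by
  have inner (es : List ((Fin 3 → ℝ) × (Fin 3 → ℝ))) (acc : List (Fin 3 → ℝ)) :
      v ∈ es.foldl (fun acc e => e.2 :: e.1 :: acc) acc ↔
        v ∈ acc ∨ ∃ e ∈ es, v = e.1 ∨ v = e.2 := by
    induction es generalizing acc with
    | nil => simp
    | cons e es ih =>
      rw [List.foldl_cons, ih, List.exists_mem_cons_iff, List.mem_cons, List.mem_cons]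
      generalize (∃ x ∈ es, v = x.1 ∨ v = x.2) = p
      tauto
  have outer (acc : List (Fin 3 → ℝ)) : v ∈ l.foldl (fun acc (f : Facet ℝ) =>
      f.edges.foldl (fun acc e => e.2 :: e.1 :: acc) acc) acc ↔
        v ∈ acc ∨ ∃ f ∈ l, ∃ e ∈ f.edges, v = e.1 ∨ v = e.2 := by
    induction l generalizing acc with
    | nil => simp
    | cons f l ih => rw [List.foldl_cons, ih, inner]; simp [or_assoc]
  simp only [allVertices, Timed.val_forEach, Timed.val_push, Timed.val_bind, outer]
  simp

@[simp] theorem val_chroma (luma x : Fin 3 → ℝ) :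
    (chroma luma x).val = (1 / dotProduct luma x) • x := by
  simp [chroma]

theorem rayPlane_eq_some {c : Fin 3 → ℝ} {f : Facet ℝ} {t : ℝ} : (rayPlane c f).val = some t ↔
    dotProduct f.half.normal c ≠ 0 ∧ 0 < t ∧ t = f.half.offset / dotProduct f.half.normal c := by
  by_cases h0 : dotProduct f.half.normal c = 0
  · simp [rayPlane, h0]
  · by_cases h1 : 0 < f.half.offset / dotProduct f.half.normal c
    · simp only [rayPlane, Timed.val_bind, Timed.val_dot, Timed.val_eq, h0, decide_false,
        Timed.val_div, Timed.val_lt, h1, decide_true, Timed.val_pure, Option.some.injEq]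
      constructor
      · rintro rfl; exact ⟨h0, h1, rfl⟩
      · rintro ⟨-, -, rfl⟩; rfl
    · simp only [rayPlane, Timed.val_bind, Timed.val_dot, Timed.val_eq, h0, decide_false,
        Timed.val_div, Timed.val_lt, h1, Timed.val_pure]
      constructor
      · intro h; simp at h
      · rintro ⟨-, h, rfl⟩; exact absurd h h1

theorem nearestOnRay_spec (c : Fin 3 → ℝ) (l : List (Facet ℝ)) :
    ((nearestOnRay c l).val = none → ∀ f ∈ l, (rayPlane c f).val = none) ∧
      ∀ t, (nearestOnRay c l).val = some t → (∃ f ∈ l, (rayPlane c f).val = some t) ∧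
        ∀ f ∈ l, ∀ s, (rayPlane c f).val = some s → t ≤ s := by
  have key := foldl_best (fun x y : ℝ => x ≤ y) le_refl (fun _ _ _ => le_trans)
    (fun f => (rayPlane c f).val)
  suffices h : ((nearestOnRay c l).val = none → none = (none : Option ℝ) ∧ ∀ f ∈ l, (rayPlane c f).val = none) ∧
      ∀ t, (nearestOnRay c l).val = some t →
        (none = some t ∨ ∃ f ∈ l, (rayPlane c f).val = some t) ∧
        (∀ b, none = some b → t ≤ b) ∧
        ∀ f ∈ l, ∀ s, (rayPlane c f).val = some s → t ≤ s by
    refine ⟨fun h' => (h.1 h').2, fun t ht => ?_⟩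
    obtain ⟨h3, -, h4⟩ := h.2 t ht
    exact ⟨by simpa using h3, h4⟩
  rw [nearestOnRay, Timed.val_forEach]
  refine key _ (fun f => ?_) (fun f b h => ?_) (fun f b t h => ?_) l none
  · simp only [Timed.val_bind, Timed.val_pure]
  · simp only [Timed.val_bind, h, Timed.val_pure]
  · rcases lt_or_ge t b with hlt | hge
    · exact Or.inl ⟨by simp [h, hlt], hlt.le⟩
    · exact Or.inr ⟨by simp [h, hge.not_gt], hge⟩

theorem farthestOnRay_spec (c : Fin 3 → ℝ) (l : List (Facet ℝ)) :
    ((farthestOnRay c l).val = none → ∀ f ∈ l, (rayPlane c f).val = none) ∧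
      ∀ t, (farthestOnRay c l).val = some t → (∃ f ∈ l, (rayPlane c f).val = some t) ∧
        ∀ f ∈ l, ∀ s, (rayPlane c f).val = some s → s ≤ t := by
  have key := foldl_best (fun x y : ℝ => y ≤ x) le_refl (fun _ _ _ h h' => le_trans h' h)
    (fun f => (rayPlane c f).val)
  suffices h : ((farthestOnRay c l).val = none → none = (none : Option ℝ) ∧ ∀ f ∈ l, (rayPlane c f).val = none) ∧
      ∀ t, (farthestOnRay c l).val = some t →
        (none = some t ∨ ∃ f ∈ l, (rayPlane c f).val = some t) ∧
        (∀ b, none = some b → b ≤ t) ∧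
        ∀ f ∈ l, ∀ s, (rayPlane c f).val = some s → s ≤ t by
    refine ⟨fun h' => (h.1 h').2, fun t ht => ?_⟩
    obtain ⟨h3, -, h4⟩ := h.2 t ht
    exact ⟨by simpa using h3, h4⟩
  rw [farthestOnRay, Timed.val_forEach]
  refine key _ (fun f => ?_) (fun f b h => ?_) (fun f b t h => ?_) l none
  · simp only [Timed.val_bind, Timed.val_pure]
  · simp only [Timed.val_bind, h, Timed.val_pure]
  · rcases lt_or_ge b t with hlt | hge
    · exact Or.inl ⟨by simp [h, hlt], hlt.le⟩
    · exact Or.inr ⟨by simp [h, hge.not_gt], hge⟩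

theorem mem_nearVertexPairs {luma : Fin 3 → ℝ} {near far : List (Facet ℝ)}
    {acc : List ((Fin 3 → ℝ) × (Fin 3 → ℝ))} {vw : (Fin 3 → ℝ) × (Fin 3 → ℝ)} :
    vw ∈ (nearVertexPairs luma near far acc).val ↔ vw ∈ acc ∨ ∃ v ∈ (allVertices near).val, ∃ t,
      (nearestOnRay (chroma luma v).val far).val = some t ∧ vw = (v, t • (chroma luma v).val) := by
  have : (nearVertexPairs luma near far acc).val =
      ((allVertices near).val.filterMap fun v =>
        ((nearestOnRay (chroma luma v).val far).val.map fun t =>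
          (v, t • (chroma luma v).val))).reverse ++ acc := by
    rw [← foldl_push_option, nearVertexPairs, Timed.val_bind, Timed.val_forEach]
    congr 1
    ext acc v : 2
    simp only [Timed.val_bind]
    rcases (nearestOnRay (chroma luma v).val far).val with _ | t
    · rfl
    · simp
  rw [this, List.mem_append, mem_filterMap_reverse, or_comm]
  simp only [Option.map_eq_some_iff, eq_comm (a := vw)]

theorem mem_farVertexPairs {luma : Fin 3 → ℝ} {near far : List (Facet ℝ)}
    {acc : List ((Fin 3 → ℝ) × (Fin 3 → ℝ))} {vw : (Fin 3 → ℝ) × (Fin 3 → ℝ)} :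
    vw ∈ (farVertexPairs luma near far acc).val ↔ vw ∈ acc ∨ ∃ w ∈ (allVertices far).val, ∃ t,
      (farthestOnRay (chroma luma w).val near).val = some t ∧
        vw = (t • (chroma luma w).val, w) := by
  have : (farVertexPairs luma near far acc).val =
      ((allVertices far).val.filterMap fun w =>
        ((farthestOnRay (chroma luma w).val near).val.map fun t =>
          (t • (chroma luma w).val, w))).reverse ++ acc := by
    rw [← foldl_push_option, farVertexPairs, Timed.val_bind, Timed.val_forEach]
    congr 1
    ext acc v : 2
    simp only [Timed.val_bind]
    rcases (farthestOnRay (chroma luma v).val near).val with _ | t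
    · rfl
    · simp
  rw [this, List.mem_append, mem_filterMap_reverse, or_comm]
  simp only [Option.map_eq_some_iff, eq_comm (a := vw)]

theorem mem_crossingPairs {luma : Fin 3 → ℝ} {near far : List (Facet ℝ)}
    {acc : List ((Fin 3 → ℝ) × (Fin 3 → ℝ))} {vw : (Fin 3 → ℝ) × (Fin 3 → ℝ)} :
    vw ∈ (crossingPairs luma near far acc).val ↔ vw ∈ acc ∨ ∃ s ∈ (allEdges near).val,
      ∃ t ∈ (allEdges far).val, (crossingPair luma s t).val = some vw := by
  have outer (ss ts acc : List ((Fin 3 → ℝ) × (Fin 3 → ℝ))) :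
      vw ∈ ss.foldl (fun acc s => (ts.filterMap fun t => (crossingPair luma s t).val).reverse ++ acc)
        acc ↔ vw ∈ acc ∨ ∃ s ∈ ss, ∃ t ∈ ts, (crossingPair luma s t).val = some vw := by
    induction ss generalizing acc with
    | nil => simp
    | cons s ss ih =>
      rw [List.foldl_cons, ih, List.mem_append, mem_filterMap_reverse]
      rw [List.exists_mem_cons_iff, or_comm (b := vw ∈ acc), or_assoc]
  rw [← outer, crossingPairs, Timed.val_bind, Timed.val_bind, Timed.val_forEach]
  have : ∀ x y : List ((Fin 3 → ℝ) × (Fin 3 → ℝ)), x = y → (vw ∈ x ↔ vw ∈ y) := by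
    rintro x y rfl; rfl
  apply this
  congr 1
  ext acc s : 2
  rw [← foldl_push_option, Timed.val_forEach]
  congr 1
  ext acc t : 2
  simp only [Timed.val_bind]
  rcases (crossingPair luma s t).val with _ | t <;> rfl

theorem val_lumaRatio (luma : Fin 3 → ℝ) (vw : (Fin 3 → ℝ) × (Fin 3 → ℝ)) :
    (lumaRatio luma vw).val = dotProduct luma vw.2 / dotProduct luma vw.1 := by
  simp [lumaRatio]

theorem bestPair_spec (luma : Fin 3 → ℝ) (l : List ((Fin 3 → ℝ) × (Fin 3 → ℝ))) (hl : l ≠ []) :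
    ∃ vw ∈ l, (bestPair luma l).val = some vw ∧ ∀ vw' ∈ l,
      dotProduct luma vw'.2 / dotProduct luma vw'.1 ≤ dotProduct luma vw.2 / dotProduct luma vw.1 := by
  have key := foldl_best (fun x y : (Fin 3 → ℝ) × (Fin 3 → ℝ) =>
      dotProduct luma y.2 / dotProduct luma y.1 ≤ dotProduct luma x.2 / dotProduct luma x.1)
    (fun _ => le_rfl) (fun _ _ _ h h' => le_trans h' h) some
  suffices h : ((bestPair luma l).val = none →
        none = (none : Option ((Fin 3 → ℝ) × (Fin 3 → ℝ))) ∧ ∀ vw ∈ l, some vw = none) ∧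
      ∀ t, (bestPair luma l).val = some t →
        (none = some t ∨ ∃ vw ∈ l, some vw = some t) ∧
        (∀ b : (Fin 3 → ℝ) × (Fin 3 → ℝ), none = some b →
          dotProduct luma b.2 / dotProduct luma b.1 ≤ dotProduct luma t.2 / dotProduct luma t.1) ∧
        ∀ vw ∈ l, ∀ b, some vw = some b →
          dotProduct luma b.2 / dotProduct luma b.1 ≤
            dotProduct luma t.2 / dotProduct luma t.1 by
    cases h' : (bestPair luma l).val with
    | none =>
      obtain ⟨a, l', rfl⟩ := List.exists_cons_of_ne_nil hl
      have := (h.1 h').2 a List.mem_cons_self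
      simp at this
    | some vw =>
      obtain ⟨h3, -, h4⟩ := h.2 vw h'
      refine ⟨vw, ?_, rfl, fun vw' hvw' => h4 vw' hvw' vw' rfl⟩
      simpa using h3
  rw [bestPair, Timed.val_forEach]
  refine key _ (fun f => ?_) (fun f b h => ?_) (fun f b t h => ?_) l none
  · simp only [Timed.val_pure]
  · simp at h
  · obtain rfl := Option.some.inj h
    rcases lt_or_ge (dotProduct luma b.2 / dotProduct luma b.1)
      (dotProduct luma f.2 / dotProduct luma f.1) with hlt | hge
    · exact Or.inl ⟨by simp [val_lumaRatio, hlt], hlt.le⟩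
    · exact Or.inr ⟨by simp [val_lumaRatio, hge.not_gt], hge⟩

theorem val_pointOnEdge (luma p q c : Fin 3 → ℝ) (σ : ℝ) : (pointOnEdge luma p q c σ).val =
    (1 / ((1 - σ) / dotProduct luma p + σ / dotProduct luma q)) • c := by
  simp [pointOnEdge]

/-- Undoing the normalisation of `p` and `q` turns `c` into `x • p + y • q` with nonnegative `x`,
`y`; dividing by `x + y` makes this a convex combination. -/
theorem pointOnEdge_spec {luma p q c : Fin 3 → ℝ} {σ : ℝ} (hp : 0 < dotProduct luma p)
    (hq : 0 < dotProduct luma q) (σ0 : 0 ≤ σ) (σ1 : σ ≤ 1)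
    (hc : c = (chroma luma p).val + σ • ((chroma luma q).val - (chroma luma p).val)) :
    (pointOnEdge luma p q c σ).val ∈ segment ℝ p q ∧ ∃ t : ℝ, 0 < t ∧
      (pointOnEdge luma p q c σ).val = t • c := by
  rw [val_pointOnEdge]
  set x := (1 - σ) / dotProduct luma p with hx
  set y := σ / dotProduct luma q with hy
  have hx0 : 0 ≤ x := div_nonneg (by linarith) hp.le
  have hy0 : 0 ≤ y := div_nonneg σ0 hq.le
  have hz : 0 < x + y := by
    rcases eq_or_lt_of_le σ0 with h | h
    · have : 0 < x := by rw [hx, ← h]; positivity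
      linarith
    · have : 0 < y := div_pos h hq
      linarith
  refine ⟨?_, 1 / (x + y), by positivity, rfl⟩
  refine ⟨x / (x + y), y / (x + y), by positivity, by positivity, by field_simp, ?_⟩
  have hc' : c = x • p + y • q := by
    rw [hc, val_chroma, val_chroma, hx, hy]
    module
  rw [hc']
  module

theorem val_crossingPair (luma : Fin 3 → ℝ) (s t : (Fin 3 → ℝ) × (Fin 3 → ℝ))
    {p q r u : Fin 3 → ℝ} (hp : (chroma luma s.1).val = p) (hq : (chroma luma s.2).val = q)
    (hr : (chroma luma t.1).val = r) (hu : (chroma luma t.2).val = u) {den σ τ : ℝ}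
    (hden : den = (q - p) 0 * (u - r) 1 - (q - p) 1 * (u - r) 0)
    (hσ : σ = ((r - p) 0 * (u - r) 1 - (r - p) 1 * (u - r) 0) / den)
    (hτ : τ = ((r - p) 0 * (q - p) 1 - (r - p) 1 * (q - p) 0) / den) :
    (crossingPair luma s t).val = if den = 0 then none else
      if 0 ≤ σ ∧ σ ≤ 1 ∧ 0 ≤ τ ∧ τ ≤ 1 then
        some ((pointOnEdge luma s.1 s.2 (p + σ • (q - p)) σ).val,
          (pointOnEdge luma t.1 t.2 (p + σ • (q - p)) τ).val)
      else none := by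
  rw [crossingPair]
  simp only [Timed.val_bind, hp, hq, hr, hu, Timed.val_vsub, Timed.val_det2, Timed.val_eq, ← hden]
  by_cases h0 : den = 0
  · simp only [h0, decide_true, if_true, Timed.val_pure]
  · simp only [h0, decide_false, if_false, Timed.val_bind, Timed.val_det2, Timed.val_div,
      Timed.val_le, ← hσ, ← hτ]
    by_cases h1 : 0 ≤ σ ∧ σ ≤ 1 ∧ 0 ≤ τ ∧ τ ≤ 1
    · rw [if_pos h1]
      simp only [h1.1, h1.2.1, h1.2.2.1, h1.2.2.2, decide_true, Bool.and_true, Timed.val_bind,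
        Timed.val_vscale, Timed.val_vadd, Timed.val_pure]
    · rw [if_neg h1]
      have : (decide (0 ≤ σ) && decide (σ ≤ 1) && decide (0 ≤ τ) && decide (τ ≤ 1)) = false := by
        simp only [← Bool.decide_and, decide_eq_false_iff_not]
        tauto
      simp only [this, Timed.val_pure]

/-! ### Running time of steps 2 to 5 -/

theorem Timed.length_forEach_le_sum {α β : Type} (f : List β → α → Timed (List β)) (T : α → ℕ)
    (l : List α) (s : List β) (h : ∀ s, ∀ a ∈ l, (f s a).val.length ≤ s.length + T a) :
    (Timed.forEach f l s).val.length ≤ s.length + (l.map T).sum := by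
  rw [Timed.val_forEach]
  induction l generalizing s with
  | nil => simp
  | cons a l ih =>
    have h1 := ih (f s a).val fun s b hb => h s b (List.mem_cons_of_mem _ hb)
    have h2 := h s a List.mem_cons_self
    rw [List.foldl_cons, List.map_cons, List.sum_cons]
    omega

theorem length_allEdges_le (l : List (Facet ℝ)) :
    (allEdges l).val.length ≤ (l.map fun f => f.edges.length).sum := by
  have := Timed.length_forEach_le_sum _ (fun f : Facet ℝ => f.edges.length) l
    ([] : List ((Fin 3 → ℝ) × (Fin 3 → ℝ))) fun acc f _ =>
      (Timed.length_forEach_le (fun acc e => Timed.push e acc) 1 f.edges acc fun _ _ _ =>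
        le_rfl).trans_eq (by rw [mul_one])
  rwa [List.length_nil, zero_add] at this

theorem time_allEdges_le (l : List (Facet ℝ)) :
    (allEdges l).time ≤ 1 + ((l.map fun f => f.edges.length).sum * 2 + l.length * 2) := by
  have h2 : ∀ F : List ((Fin 3 → ℝ) × (Fin 3 → ℝ)) → Facet ℝ →
      Timed (List ((Fin 3 → ℝ) × (Fin 3 → ℝ))),
      (∀ st, ∀ f ∈ l, (F st f).time ≤ f.edges.length * 2 + 1) → (Timed.forEach F l []).time ≤
        1 + ((l.map fun f => f.edges.length).sum * 2 + l.length * 2) := by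
    intro F hF
    rw [← List.sum_map_mul_add]
    exact Timed.time_forEach_le F _ l [] hF
  refine h2 _ fun st f _ => ?_
  have := Timed.time_forEach_le_mul (fun acc e => Timed.push e acc) 1 f.edges st fun _ _ _ => le_rfl
  omega

theorem length_allVertices_le (l : List (Facet ℝ)) :
    (allVertices l).val.length ≤ (l.map fun f => f.edges.length).sum * 2 := by
  have := Timed.length_forEach_le_sum _ (fun f : Facet ℝ => f.edges.length * 2 + 0) l
    ([] : List (Fin 3 → ℝ)) fun acc f _ =>
      Timed.length_forEach_le (fun (acc : List (Fin 3 → ℝ)) (e : (Fin 3 → ℝ) × (Fin 3 → ℝ)) => do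
        let acc' ← Timed.push e.1 acc
        Timed.push e.2 acc') 2 f.edges acc fun _ _ _ => le_rfl
  rw [List.sum_map_mul_add] at this
  rwa [List.length_nil, zero_add, mul_zero, add_zero] at this

theorem time_allVertices_le (l : List (Facet ℝ)) :
    (allVertices l).time ≤ 1 + ((l.map fun f => f.edges.length).sum * 3 + l.length * 2) := by
  have h2 : ∀ F : List (Fin 3 → ℝ) → Facet ℝ → Timed (List (Fin 3 → ℝ)),
      (∀ st, ∀ f ∈ l, (F st f).time ≤ f.edges.length * 3 + 1) → (Timed.forEach F l []).time ≤
        1 + ((l.map fun f => f.edges.length).sum * 3 + l.length * 2) := by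
    intro F hF
    rw [← List.sum_map_mul_add]
    exact Timed.time_forEach_le F _ l [] hF
  refine h2 _ fun st f _ => ?_
  have := Timed.time_forEach_le_mul
    (fun (acc : List (Fin 3 → ℝ)) (e : (Fin 3 → ℝ) × (Fin 3 → ℝ)) => do
      let acc' ← Timed.push e.1 acc
      Timed.push e.2 acc') 2 f.edges st fun _ _ _ => le_rfl
  omega

theorem time_partitionFacets_le (l : List (Facet ℝ)) :
    (partitionFacets l).time ≤ 1 + l.length * 4 := by
  refine Timed.time_forEach_le_mul _ 3 l _ fun st f _ => ?_
  simp only [Timed.time_bind, time_lt]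
  rcases (Timed.lt f.half.offset 0).val <;> rcases (Timed.lt 0 f.half.offset).val <;> simp

theorem time_rayPlane_le (c : Fin 3 → ℝ) (f : Facet ℝ) : (rayPlane c f).time ≤ 8 := by
  rw [rayPlane]
  simp only [Timed.time_bind, time_dot, time_eq]
  rcases (Timed.eq (Timed.dot f.half.normal c).val 0).val
  · simp only [Timed.time_bind, time_div, time_lt]
    rcases (Timed.lt 0 (Timed.div f.half.offset (Timed.dot f.half.normal c).val).val).val <;> simp
  · simp

theorem time_nearestOnRay_le (c : Fin 3 → ℝ) (l : List (Facet ℝ)) :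
    (nearestOnRay c l).time ≤ 1 + l.length * 10 := by
  refine Timed.time_forEach_le_mul _ 9 l _ fun st f _ => ?_
  have := time_rayPlane_le c f
  rw [Timed.time_bind]
  rcases st with _ | b
  · simp only [Timed.time_pure]; omega
  · rcases (rayPlane c f).val with _ | t
    · simp only [Timed.time_pure]; omega
    · simp only [Timed.time_bind, time_lt]
      rcases (Timed.lt t b).val <;> simp only [Timed.time_pure] <;> omega

theorem time_farthestOnRay_le (c : Fin 3 → ℝ) (l : List (Facet ℝ)) :
    (farthestOnRay c l).time ≤ 1 + l.length * 10 := by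
  refine Timed.time_forEach_le_mul _ 9 l _ fun st f _ => ?_
  have := time_rayPlane_le c f
  rw [Timed.time_bind]
  rcases st with _ | b
  · simp only [Timed.time_pure]; omega
  · rcases (rayPlane c f).val with _ | t
    · simp only [Timed.time_pure]; omega
    · simp only [Timed.time_bind, time_lt]
      rcases (Timed.lt b t).val <;> simp only [Timed.time_pure] <;> omega

theorem time_chroma (luma x : Fin 3 → ℝ) : (chroma luma x).time = 9 := by
  simp [chroma]

theorem time_nearVertexPairs_le (luma : Fin 3 → ℝ) (near far : List (Facet ℝ))
    (acc : List ((Fin 3 → ℝ) × (Fin 3 → ℝ))) : (nearVertexPairs luma near far acc).time ≤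
      (allVertices near).time +
        (1 + (allVertices near).val.length * (15 + far.length * 10)) := by
  rw [nearVertexPairs, Timed.time_bind]
  refine Nat.add_le_add_left ?_ _
  refine (Timed.time_forEach_le_mul _ (14 + far.length * 10) _ _ fun acc v _ => ?_).trans
    (le_of_eq (by ring))
  have := time_nearestOnRay_le (chroma luma v).val far
  rw [Timed.time_bind, Timed.time_bind, time_chroma]
  rcases (nearestOnRay (chroma luma v).val far).val with _ | t
  · simp only [Timed.time_pure]; omega
  · simp only [Timed.time_bind, time_vscale, time_push]; omega

theorem length_nearVertexPairs_le (luma : Fin 3 → ℝ) (near far : List (Facet ℝ))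
    (acc : List ((Fin 3 → ℝ) × (Fin 3 → ℝ))) : (nearVertexPairs luma near far acc).val.length ≤
      acc.length + (allVertices near).val.length := by
  rw [nearVertexPairs, Timed.val_bind]
  refine (Timed.length_forEach_le _ 1 _ _ fun acc v _ => ?_).trans_eq (by rw [mul_one])
  rw [Timed.val_bind, Timed.val_bind]
  rcases (nearestOnRay (chroma luma v).val far).val with _ | t
  · simp
  · simp

theorem time_farVertexPairs_le (luma : Fin 3 → ℝ) (near far : List (Facet ℝ))
    (acc : List ((Fin 3 → ℝ) × (Fin 3 → ℝ))) : (farVertexPairs luma near far acc).time ≤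
      (allVertices far).time +
        (1 + (allVertices far).val.length * (15 + near.length * 10)) := by
  rw [farVertexPairs, Timed.time_bind]
  refine Nat.add_le_add_left ?_ _
  refine (Timed.time_forEach_le_mul _ (14 + near.length * 10) _ _ fun acc v _ => ?_).trans
    (le_of_eq (by ring))
  have := time_farthestOnRay_le (chroma luma v).val near
  rw [Timed.time_bind, Timed.time_bind, time_chroma]
  rcases (farthestOnRay (chroma luma v).val near).val with _ | t
  · simp only [Timed.time_pure]; omega
  · simp only [Timed.time_bind, time_vscale, time_push]; omega

theorem length_farVertexPairs_le (luma : Fin 3 → ℝ) (near far : List (Facet ℝ))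
    (acc : List ((Fin 3 → ℝ) × (Fin 3 → ℝ))) : (farVertexPairs luma near far acc).val.length ≤
      acc.length + (allVertices far).val.length := by
  rw [farVertexPairs, Timed.val_bind]
  refine (Timed.length_forEach_le _ 1 _ _ fun acc v _ => ?_).trans_eq (by rw [mul_one])
  rw [Timed.val_bind, Timed.val_bind]
  rcases (farthestOnRay (chroma luma v).val near).val with _ | t
  · simp
  · simp

theorem time_crossingPair_le (luma : Fin 3 → ℝ) (s t : (Fin 3 → ℝ) × (Fin 3 → ℝ)) :
    (crossingPair luma s t).time ≤ 110 := by
  have hp (p q c : Fin 3 → ℝ) (σ : ℝ) : (pointOnEdge luma p q c σ).time = 18 := by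
    simp [pointOnEdge]
  rw [crossingPair]
  simp only [Timed.time_bind, time_chroma, time_vsub, time_det2, time_eq]
  generalize (Timed.eq (_ : ℝ) _).val = b
  rcases b
  · simp only [Timed.time_bind, time_det2, time_div, time_le]
    generalize (_ && _ : Bool) = b
    rcases b
    · simp
    · simp [hp]
  · simp

theorem time_crossingPairs_le (luma : Fin 3 → ℝ) (near far : List (Facet ℝ))
    (acc : List ((Fin 3 → ℝ) × (Fin 3 → ℝ))) : (crossingPairs luma near far acc).time ≤
      (allEdges near).time + ((allEdges far).time + (1 + (allEdges near).val.length *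
        (1 + (allEdges far).val.length * 112 + 1))) := by
  rw [crossingPairs, Timed.time_bind, Timed.time_bind]
  refine Nat.add_le_add_left (Nat.add_le_add_left ?_ _) _
  refine Timed.time_forEach_le_mul _ _ _ _ fun acc s _ => ?_
  refine Timed.time_forEach_le_mul _ 111 _ _ fun acc t _ => ?_
  have := time_crossingPair_le luma s t
  rw [Timed.time_bind]
  rcases (crossingPair luma s t).val with _ | t
  · simp only [Timed.time_pure]; omega
  · simp only [time_push]; omega

theorem length_crossingPairs_le (luma : Fin 3 → ℝ) (near far : List (Facet ℝ))
    (acc : List ((Fin 3 → ℝ) × (Fin 3 → ℝ))) : (crossingPairs luma near far acc).val.length ≤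
      acc.length + (allEdges near).val.length * (allEdges far).val.length := by
  rw [crossingPairs, Timed.val_bind, Timed.val_bind]
  refine Timed.length_forEach_le _ _ _ _ fun acc s _ => ?_
  refine (Timed.length_forEach_le _ 1 _ _ fun acc t _ => ?_).trans_eq (by rw [mul_one])
  rw [Timed.val_bind]
  rcases (crossingPair luma s t).val with _ | t
  · simp
  · simp

theorem time_bestPair_le (luma : Fin 3 → ℝ) (l : List ((Fin 3 → ℝ) × (Fin 3 → ℝ))) :
    (bestPair luma l).time ≤ 1 + l.length * 24 := by
  have hr (vw : (Fin 3 → ℝ) × (Fin 3 → ℝ)) : (lumaRatio luma vw).time = 11 := by simp [lumaRatio]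
  refine Timed.time_forEach_le_mul _ 23 _ _ fun best vw _ => ?_
  rcases best with _ | b
  · simp
  · simp only [Timed.time_bind, hr, time_lt]
    generalize (Timed.lt (_ : ℝ) _).val = b
    rcases b <;> simp

theorem List.sum_map_filter_reverse_le {α : Type} (p : α → Bool) (T : α → ℕ) (l : List α) :
    (((l.filter p).reverse).map T).sum ≤ (l.map T).sum := by
  rw [List.map_reverse, List.sum_reverse]
  exact (List.filter_sublist.map T).sum_le_sum (fun _ _ => Nat.zero_le _)

theorem time_overlayAlgorithm_le {ps : List (Projector ℝ)} (hps : ps ≠ []) {c : Fin 3 → ℝ}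
    (hc : c ∈ interior (gamutIntersection ps)) (luma : Fin 3 → ℝ) :
    (overlayAlgorithm luma ps).time ≤ 1000000 * ps.length ^ 2 := by
  obtain ⟨H, -, hlen, htime⟩ := constructPolyhedron_spec hps hc
  have hn : 1 ≤ ps.length := List.length_pos_iff.2 hps
  have hS := H.sum_length_edges_le
  rw [overlayAlgorithm]
  simp only [Timed.time_bind, val_partitionFacets]
  generalize (constructPolyhedron ps).time = T at *
  generalize (constructPolyhedron ps).val = l at *
  have h1 : ((l.filter fun f => f.half.offset < 0).reverse).length ≤ l.length := by
    rw [List.length_reverse]; exact List.length_filter_le _ _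
  have h2 : ((l.filter fun f => 0 < f.half.offset).reverse).length ≤ l.length := by
    rw [List.length_reverse]; exact List.length_filter_le _ _
  have h3 := List.sum_map_filter_reverse_le (fun f : Facet ℝ => f.half.offset < 0)
    (fun f => f.edges.length) l
  have h4 := List.sum_map_filter_reverse_le (fun f : Facet ℝ => 0 < f.half.offset)
    (fun f => f.edges.length) l
  generalize (l.filter fun f => f.half.offset < 0).reverse = near at *
  generalize (l.filter fun f => 0 < f.half.offset).reverse = far at *
  generalize hA : (nearVertexPairs luma near far []) = A
  generalize hB : (farVertexPairs luma near far A.val) = B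
  generalize hD : (crossingPairs luma near far B.val) = D
  have hp := time_partitionFacets_le l
  have a1 := time_nearVertexPairs_le luma near far []
  have a2 := length_nearVertexPairs_le luma near far []
  have b1 := time_farVertexPairs_le luma near far A.val
  have b2 := length_farVertexPairs_le luma near far A.val
  have d1 := time_crossingPairs_le luma near far B.val
  have d2 := length_crossingPairs_le luma near far B.val
  have f1 := time_bestPair_le luma D.val
  rw [hA] at a1 a2
  rw [hB] at b1 b2
  rw [hD] at d1 d2
  have e1 := length_allEdges_le near
  have e2 := length_allEdges_le far
  have e3 := time_allEdges_le near
  have e4 := time_allEdges_le far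
  have v1 := length_allVertices_le near
  have v2 := length_allVertices_le far
  have v3 := time_allVertices_le near
  have v4 := time_allVertices_le far
  simp only [List.length_nil] at a2
  set n := ps.length
  -- There are at most `6n` facets, hence `12 * 6n = 72n` edge entries and `144n` vertex entries.
  -- The additive constants are absorbed by `1 ≤ n`: `15 + 60n ≤ 75n` and `2 + 112 * 72n ≤ 8066n`.
  have m1 : (allVertices near).val.length * (15 + far.length * 10) ≤ (144 * n) * (75 * n) :=
    Nat.mul_le_mul (by omega) (by omega)
  have m2 : (allVertices far).val.length * (15 + near.length * 10) ≤ (144 * n) * (75 * n) :=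
    Nat.mul_le_mul (by omega) (by omega)
  have m3 : (allEdges near).val.length * (1 + (allEdges far).val.length * 112 + 1) ≤
      (72 * n) * (8066 * n) := Nat.mul_le_mul (by omega) (by omega)
  have m4 : (allEdges near).val.length * (allEdges far).val.length ≤ (72 * n) * (72 * n) :=
    Nat.mul_le_mul (by omega) (by omega)
  have n1 : n ≤ n ^ 2 := Nat.le_self_pow two_ne_zero n
  have x1 : (144 * n) * (75 * n) = 10800 * n ^ 2 := by ring
  have x2 : (72 * n) * (8066 * n) = 580752 * n ^ 2 := by ring
  have x3 : (72 * n) * (72 * n) = 5184 * n ^ 2 := by ring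
  have x4 : 175 + n * (119 + 6 * n * 3156) = 175 + 119 * n + 18936 * n ^ 2 := by ring
  rw [x1] at m1 m2
  rw [x2] at m3
  rw [x3] at m4
  rw [x4] at htime
  omega

/-! ### The chromaticity diagram and the recorded pairs -/

theorem chroma_eq_chromaticity (luma x : Fin 3 → ℝ) :
    (chroma luma x).val = chromaticity luma x := by
  rw [val_chroma, one_div]; rfl

theorem dotProduct_chromaticity {luma x : Fin 3 → ℝ} (hx : 0 < dotProduct luma x) :
    dotProduct luma (chromaticity luma x) = 1 := by
  rw [chromaticity, dotProduct_smul, smul_eq_mul]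
  exact inv_mul_cancel₀ hx.ne'

theorem smul_chromaticity {luma x : Fin 3 → ℝ} (hx : 0 < dotProduct luma x) :
    dotProduct luma x • chromaticity luma x = x := by
  rw [chromaticity, smul_smul]
  exact (congrArg (· • x) (mul_inv_cancel₀ hx.ne')).trans (one_smul _ _)

theorem chromaticity_smul {luma c : Fin 3 → ℝ} {t : ℝ} (ht : 0 < t) :
    chromaticity luma (t • c) = chromaticity luma c := by
  have h : luminosity luma (t • c) = t * luminosity luma c := dotProduct_smul t luma c
  rw [chromaticity, chromaticity, h, smul_smul, mul_inv, mul_assoc, mul_comm, mul_assoc,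
    mul_inv_cancel₀ ht.ne', mul_one]

/-- Vectors of zero luminosity are determined by their first two coordinates. -/
theorem eq_zero_of_dotProduct_eq_zero {luma a : Fin 3 → ℝ} (h2 : luma 2 ≠ 0)
    (ha : dotProduct luma a = 0) (a0 : a 0 = 0) (a1 : a 1 = 0) : a = 0 := by
  have h : luma 2 * a 2 = 0 := by
    simpa [dotProduct, Fin.sum_univ_three, a0, a1] using ha
  ext i
  fin_cases i
  · exact a0
  · exact a1
  · exact (mul_eq_zero.1 h).resolve_left h2

/-- The determinant makes the first two coordinates proportional, and zero luminosity determines the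
third. -/
theorem exists_eq_smul_of_det_eq_zero {luma a b : Fin 3 → ℝ} (h2 : luma 2 ≠ 0)
    (ha : dotProduct luma a = 0) (hb : dotProduct luma b = 0) (hb0 : b ≠ 0)
    (hdet : a 0 * b 1 - a 1 * b 0 = 0) : ∃ κ : ℝ, a = κ • b := by
  have key (k : Fin 3) (hk : b k ≠ 0) (h0 : b k * a 0 = a k * b 0) (h1 : b k * a 1 = a k * b 1) :
      ∃ κ : ℝ, a = κ • b := by
    have : b k • a - a k • b = 0 := by
      refine eq_zero_of_dotProduct_eq_zero h2 ?_ ?_ ?_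
      · rw [dotProduct_sub, dotProduct_smul, dotProduct_smul, ha, hb]; simp
      · simp [h0]
      · simp [h1]
    refine ⟨(b k)⁻¹ * a k, ?_⟩
    rw [mul_smul, ← sub_eq_zero.1 this, smul_smul, inv_mul_cancel₀ hk, one_smul]
  by_cases h0 : b 0 = 0
  · have h1 : b 1 ≠ 0 := fun h1 => hb0 (eq_zero_of_dotProduct_eq_zero h2 hb h0 h1)
    exact key 1 h1 (by linarith) (by ring)
  · exact key 0 h0 (by ring) (by linarith)

/-- The two lines through `p`, `q` and through `r`, `u` in the chromaticity diagram meet in the point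
given by Cramer's rule. -/
theorem add_smul_eq_of_cramer {luma p a r b : Fin 3 → ℝ} (h2 : luma 2 ≠ 0)
    (hp : dotProduct luma p = 1) (hr : dotProduct luma r = 1) (ha : dotProduct luma a = 0)
    (hb : dotProduct luma b = 0) {den : ℝ} (hden : den = a 0 * b 1 - a 1 * b 0) (h0 : den ≠ 0) :
    p + (((r - p) 0 * b 1 - (r - p) 1 * b 0) / den) • a =
      r + (((r - p) 0 * a 1 - (r - p) 1 * a 0) / den) • b := by
  rw [← sub_eq_zero]
  refine eq_zero_of_dotProduct_eq_zero h2 ?_ ?_ ?_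
  · rw [dotProduct_sub, dotProduct_add, dotProduct_add, dotProduct_smul, dotProduct_smul, hp, hr,
      ha, hb]
    simp
  · simp only [Pi.sub_apply, Pi.add_apply, Pi.smul_apply, smul_eq_mul]
    field_simp
    rw [hden]; ring
  · simp only [Pi.sub_apply, Pi.add_apply, Pi.smul_apply, smul_eq_mul]
    field_simp
    rw [hden]; ring

/-- The converse of `add_smul_eq_of_cramer`: any crossing has the parameters that the algorithm
computes. -/
theorem cramer_of_add_smul_eq {p a r b : Fin 3 → ℝ} {σ τ den : ℝ} (h : p + σ • a = r + τ • b)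
    (hden : den = a 0 * b 1 - a 1 * b 0) (h0 : den ≠ 0) :
    σ = ((r - p) 0 * b 1 - (r - p) 1 * b 0) / den ∧
      τ = ((r - p) 0 * a 1 - (r - p) 1 * a 0) / den := by
  have e (i : Fin 3) : p i + σ * a i = r i + τ * b i := congrFun h i
  have e0 := e 0
  have e1 := e 1
  simp only [Pi.sub_apply]
  constructor
  · rw [eq_div_iff h0, hden]; linear_combination b 1 * e0 - b 0 * e1
  · rw [eq_div_iff h0, hden]; linear_combination a 1 * e0 - a 0 * e1

theorem gap_smul (h : Halfspace ℝ) (t : ℝ) (x : Fin 3 → ℝ) :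
    h.gap (t • x) = h.offset - t * dotProduct h.normal x := by
  rw [Halfspace.gap, dotProduct_smul, smul_eq_mul]

/-- The nearest intersection with a far plane of a ray that meets the polyhedron is the last point
of the polyhedron on this ray. -/
theorem nearest_mem_polyhedron {l : List (Facet ℝ)} {c : Fin 3 → ℝ} {τ t : ℝ} (hτ : 0 < τ)
    (hmem : τ • c ∈ polyhedron l)
    (ht : ∃ k ∈ l, 0 < k.half.offset ∧ (rayPlane c k).val = some t)
    (hmin : ∀ k ∈ l, 0 < k.half.offset → ∀ s, (rayPlane c k).val = some s → t ≤ s) :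
    τ ≤ t ∧ t • c ∈ polyhedron l := by
  obtain ⟨k, hk, hpos, hkt⟩ := ht
  obtain ⟨hne, ht0, hteq⟩ := rayPlane_eq_some.1 hkt
  have hτt : τ ≤ t := by
    have h1 := hmem k hk
    rw [gap_smul] at h1
    have h2 : 0 < dotProduct k.half.normal c := by
      by_contra! h
      have := div_nonpos_of_nonneg_of_nonpos hpos.le h
      linarith
    rw [hteq, le_div_iff₀ h2]; linarith
  refine ⟨hτt, fun g hg => ?_⟩
  have h1 := hmem g hg
  rw [gap_smul] at h1 ⊢
  -- If the normal does not point along the ray, the gap does not decrease from `τ` to `t`.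
  -- Otherwise `g` has positive offset, so it is a far facet and `t` does not exceed its
  -- intersection parameter.
  rcases le_or_gt (dotProduct g.half.normal c) 0 with h | h
  · rcases le_or_gt g.half.offset 0 with h' | h'
    · nlinarith
    · nlinarith
  · have h' : 0 < g.half.offset := lt_of_lt_of_le (mul_pos hτ h) (by linarith)
    have := hmin g hg h' _ (rayPlane_eq_some.2 ⟨h.ne', div_pos h' h, rfl⟩)
    rw [le_div_iff₀ h] at this
    linarith

/-- The farthest intersection with a near plane of a ray that meets the polyhedron is the first point
of the polyhedron on this ray. -/
theorem farthest_mem_polyhedron {l : List (Facet ℝ)} {c : Fin 3 → ℝ} {τ t : ℝ}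
    (hmem : τ • c ∈ polyhedron l)
    (ht : ∃ k ∈ l, k.half.offset < 0 ∧ (rayPlane c k).val = some t)
    (hmax : ∀ k ∈ l, k.half.offset < 0 → ∀ s, (rayPlane c k).val = some s → s ≤ t) :
    t ≤ τ ∧ 0 < t ∧ t • c ∈ polyhedron l := by
  obtain ⟨k, hk, hneg, hkt⟩ := ht
  obtain ⟨hne, ht0, hteq⟩ := rayPlane_eq_some.1 hkt
  have hτt : t ≤ τ := by
    have h1 := hmem k hk
    rw [gap_smul] at h1
    have h2 : dotProduct k.half.normal c < 0 := by
      by_contra! h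
      have := div_nonpos_of_nonpos_of_nonneg hneg.le h
      linarith
    rw [hteq, div_le_iff_of_neg h2]; linarith
  refine ⟨hτt, ht0, fun g hg => ?_⟩
  have h1 := hmem g hg
  rw [gap_smul] at h1 ⊢
  rcases le_or_gt 0 (dotProduct g.half.normal c) with h | h
  · nlinarith
  · rcases le_or_gt 0 g.half.offset with h' | h'
    · nlinarith
    · have := hmax g hg h' _ (rayPlane_eq_some.2 ⟨h.ne, div_pos_of_neg_of_neg h' h, rfl⟩)
      rw [div_le_iff_of_neg h] at this
      linarith

/-- The pairs among which the algorithm chooses. -/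
noncomputable def recordedPairs (luma : Fin 3 → ℝ) (l : List (Facet ℝ)) : List ((Fin 3 → ℝ) × (Fin 3 → ℝ)) :=
  let nf := (partitionFacets l).val
  (crossingPairs luma nf.1 nf.2 (farVertexPairs luma nf.1 nf.2
    (nearVertexPairs luma nf.1 nf.2 []).val).val).val

theorem mem_near {l : List (Facet ℝ)} {f : Facet ℝ} :
    f ∈ (partitionFacets l).val.1 ↔ f ∈ l ∧ f.half.offset < 0 := by
  rw [val_partitionFacets]; simp

theorem mem_far {l : List (Facet ℝ)} {f : Facet ℝ} :
    f ∈ (partitionFacets l).val.2 ↔ f ∈ l ∧ 0 < f.half.offset := by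
  rw [val_partitionFacets]; simp

theorem mem_recordedPairs {luma : Fin 3 → ℝ} {l : List (Facet ℝ)}
    {vw : (Fin 3 → ℝ) × (Fin 3 → ℝ)} : vw ∈ recordedPairs luma l ↔
      (∃ f ∈ l, f.half.offset < 0 ∧ ∃ e ∈ f.edges, ∃ v, (v = e.1 ∨ v = e.2) ∧ ∃ t,
        (nearestOnRay (chromaticity luma v) (partitionFacets l).val.2).val = some t ∧
          vw = (v, t • chromaticity luma v)) ∨
      (∃ f ∈ l, 0 < f.half.offset ∧ ∃ e ∈ f.edges, ∃ w, (w = e.1 ∨ w = e.2) ∧ ∃ t,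
        (farthestOnRay (chromaticity luma w) (partitionFacets l).val.1).val = some t ∧
          vw = (t • chromaticity luma w, w)) ∨
      ∃ f ∈ l, f.half.offset < 0 ∧ ∃ s ∈ f.edges, ∃ g ∈ l, 0 < g.half.offset ∧ ∃ t ∈ g.edges,
        (crossingPair luma s t).val = some vw := by
  rw [recordedPairs, mem_crossingPairs, mem_farVertexPairs, mem_nearVertexPairs]
  simp only [mem_allVertices, mem_allEdges, mem_near, mem_far, chroma_eq_chromaticity]
  constructor
  · rintro (((h | ⟨v, ⟨f, ⟨hf, hn⟩, e, he, hv⟩, t, ht⟩) | ⟨w, ⟨f, ⟨hf, hn⟩, e, he, hv⟩, t, ht⟩) |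
      ⟨s, ⟨f, ⟨hf, hn⟩, hs⟩, t, ⟨g, ⟨hg, hgn⟩, ht⟩, h⟩)
    · simp at h
    · exact Or.inl ⟨f, hf, hn, e, he, v, hv, t, ht⟩
    · exact Or.inr (Or.inl ⟨f, hf, hn, e, he, w, hv, t, ht⟩)
    · exact Or.inr (Or.inr ⟨f, hf, hn, s, hs, g, hg, hgn, t, ht, h⟩)
  · rintro (⟨f, hf, hn, e, he, v, hv, t, ht⟩ | ⟨f, hf, hn, e, he, w, hv, t, ht⟩ |
      ⟨f, hf, hn, s, hs, g, hg, hgn, t, ht, h⟩)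
    · exact Or.inl (Or.inl (Or.inr ⟨v, ⟨f, ⟨hf, hn⟩, e, he, hv⟩, t, ht⟩))
    · exact Or.inl (Or.inr ⟨w, ⟨f, ⟨hf, hn⟩, e, he, hv⟩, t, ht⟩)
    · exact Or.inr ⟨s, ⟨f, ⟨hf, hn⟩, hs⟩, t, ⟨g, ⟨hg, hgn⟩, ht⟩, h⟩

namespace IsRepresentation

variable {c₀ : Fin 3 → ℝ} {l : List (Facet ℝ)} (H : IsRepresentation c₀ l) {luma : Fin 3 → ℝ}
  (hL : ∀ x ∈ polyhedron l, 0 < dotProduct luma x)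
include H

theorem endpoint_mem {f : Facet ℝ} (hf : f ∈ l) {e : (Fin 3 → ℝ) × (Fin 3 → ℝ)} (he : e ∈ f.edges)
    {v : Fin 3 → ℝ} (hv : v = e.1 ∨ v = e.2) : v ∈ polyhedron l ∧ f.half.gap v = 0 := by
  apply H.mem_of_mem_edge hf he
  rcases hv with rfl | rfl
  · exact left_mem_segment ℝ _ _
  · exact right_mem_segment ℝ _ _

include hL

/-- Feasibility: intersecting with all the planes of the opposite family, rather than with the
facets themselves, still yields points of the polyhedron. -/
theorem mem_of_mem_recordedPairs (h2 : luma 2 ≠ 0) {vw : (Fin 3 → ℝ) × (Fin 3 → ℝ)}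
    (hvw : vw ∈ recordedPairs luma l) : vw.1 ∈ polyhedron l ∧ vw.2 ∈ polyhedron l ∧
      chromaticity luma vw.1 = chromaticity luma vw.2 := by
  have hcc {x : Fin 3 → ℝ} (hx : 0 < dotProduct luma x) :
      chromaticity luma (chromaticity luma x) = chromaticity luma x := by
    rw [← chromaticity_smul hx, smul_chromaticity hx]
  rcases mem_recordedPairs.1 hvw with ⟨f, hf, hn, e, he, v, hv, t, ht, rfl⟩ |
    ⟨f, hf, hn, e, he, w, hw, t, ht, rfl⟩ | ⟨f, hf, hn, s, hs, g, hg, hgn, t, ht, hst⟩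
  · have hvP := (H.endpoint_mem hf he hv).1
    have hpos := hL v hvP
    obtain ⟨⟨k, hk, hkt⟩, hmin⟩ := (nearestOnRay_spec _ _).2 t ht
    obtain ⟨h3, h4⟩ := nearest_mem_polyhedron hpos (by rwa [smul_chromaticity hpos])
      ⟨k, (mem_far.1 hk).1, (mem_far.1 hk).2, hkt⟩ fun k hk hk' => hmin k (mem_far.2 ⟨hk, hk'⟩)
    exact ⟨hvP, h4, by rw [chromaticity_smul (hpos.trans_le h3), hcc hpos]⟩
  · have hwP := (H.endpoint_mem hf he hw).1
    have hpos := hL w hwP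
    obtain ⟨⟨k, hk, hkt⟩, hmax⟩ := (farthestOnRay_spec _ _).2 t ht
    obtain ⟨-, h3, h4⟩ := farthest_mem_polyhedron (by rwa [smul_chromaticity hpos])
      ⟨k, (mem_near.1 hk).1, (mem_near.1 hk).2, hkt⟩ fun k hk hk' => hmax k (mem_near.2 ⟨hk, hk'⟩)
    exact ⟨h4, hwP, by rw [chromaticity_smul h3, hcc hpos]⟩
  · have p1 := hL _ (H.endpoint_mem hf hs (Or.inl rfl)).1
    have p2 := hL _ (H.endpoint_mem hf hs (Or.inr rfl)).1
    have p3 := hL _ (H.endpoint_mem hg ht (Or.inl rfl)).1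
    have p4 := hL _ (H.endpoint_mem hg ht (Or.inr rfl)).1
    rw [val_crossingPair luma s t rfl rfl rfl rfl rfl rfl rfl] at hst
    split_ifs at hst with h0 hσ
    obtain ⟨s0, s1, t0, t1⟩ := hσ
    have hcr := add_smul_eq_of_cramer h2 (p := (chroma luma s.1).val) (r := (chroma luma t.1).val)
      (a := (chroma luma s.2).val - (chroma luma s.1).val)
      (b := (chroma luma t.2).val - (chroma luma t.1).val)
      (by rw [chroma_eq_chromaticity, dotProduct_chromaticity p1])
      (by rw [chroma_eq_chromaticity, dotProduct_chromaticity p3])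
      (by rw [dotProduct_sub, chroma_eq_chromaticity, chroma_eq_chromaticity,
        dotProduct_chromaticity p1, dotProduct_chromaticity p2, sub_self])
      (by rw [dotProduct_sub, chroma_eq_chromaticity, chroma_eq_chromaticity,
        dotProduct_chromaticity p3, dotProduct_chromaticity p4, sub_self]) rfl h0
    obtain ⟨hv, α, hα, hvα⟩ := pointOnEdge_spec p1 p2 s0 s1 rfl
    obtain ⟨hw, β, hβ, hwβ⟩ := pointOnEdge_spec p3 p4 t0 t1 hcr
    obtain rfl := Option.some.inj hst
    refine ⟨(H.mem_of_mem_edge hf hs hv).1, (H.mem_of_mem_edge hg ht hw).1, ?_⟩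
    simp only [hvα, hwβ, chromaticity_smul hα, chromaticity_smul hβ]

end IsRepresentation

/-! ### Optimality through the vertices of the overlay -/

theorem isClosed_polyhedron (l : List (Facet ℝ)) : IsClosed (polyhedron l) := by
  have : polyhedron l = ⋂ f ∈ l, f.half.gap ⁻¹' Set.Ici 0 := by
    ext x; simp [polyhedron]
  rw [this]
  exact isClosed_biInter fun f _ => isClosed_Ici.preimage f.half.continuous_gap

/-- A linear function on a bounded planar polyhedron attains at least any of its values at a vertex. -/
theorem exists_vertex_ge {l : List (Facet ℝ)} {a p c : Fin 3 → ℝ}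
    (hb : Bornology.IsBounded {x ∈ polyhedron l | dotProduct a x = 1}) (hc : c ∈ polyhedron l)
    (hac : dotProduct a c = 1) :
    ∃ x ∈ polyhedron l, dotProduct a x = 1 ∧ dotProduct p c ≤ dotProduct p x ∧
      ∀ d, dotProduct a d = 0 →
        (∀ f ∈ l, f.half.gap x = 0 → dotProduct f.half.normal d = 0) → d = 0 := by
  have cont (b : Fin 3 → ℝ) : Continuous fun x => dotProduct b x := by unfold dotProduct; fun_prop
  set Q := {x ∈ polyhedron l | dotProduct a x = 1}
  have hQ : IsCompact Q := Metric.isCompact_of_isClosed_isBounded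
    ((isClosed_polyhedron l).inter (isClosed_eq (cont a) continuous_const)) hb
  obtain ⟨m, hm, hmax⟩ := hQ.exists_isMaxOn ⟨c, hc, hac⟩ (cont p).continuousOn
  -- The maximisers form a compact set, so it has an extreme point; this is the vertex.
  have hE : IsCompact (Q ∩ {x | dotProduct p x = dotProduct p m}) :=
    hQ.inter_right (isClosed_eq (cont p) continuous_const)
  obtain ⟨x, hx⟩ := hE.extremePoints_nonempty ⟨m, hm, rfl⟩
  obtain ⟨⟨hxQ, hxm⟩, hext⟩ := mem_extremePoints.1 hx
  refine ⟨x, hxQ.1, hxQ.2, (hmax ⟨hc, hac⟩).trans_eq hxm.symm, fun d had hd => ?_⟩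
  obtain ⟨ε₁, hε₁, h1⟩ := exists_small_step l x d
  obtain ⟨ε₂, hε₂, h2⟩ := exists_small_step l x (-d)
  set ε := min ε₁ ε₂
  have hε : 0 < ε := lt_min hε₁ hε₂
  have mem (s : Fin 3 → ℝ) (hs : s = d ∨ s = -d) : x + ε • s ∈ Q := by
    constructor
    · intro g hg
      rcases (hxQ.1 g hg).eq_or_lt with h0 | h0
      · rw [Halfspace.gap_add_smul, ← h0]
        rcases hs with rfl | rfl
        · rw [hd g hg h0.symm]; simp
        · rw [dotProduct_neg, hd g hg h0.symm]; simp
      · rcases hs with rfl | rfl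
        · exact (h1 ε hε.le (min_le_left _ _) g hg h0).le
        · exact (h2 ε hε.le (min_le_right _ _) g hg h0).le
    · rw [dotProduct_add, dotProduct_smul, hxQ.2]
      rcases hs with rfl | rfl
      · rw [had]; simp
      · rw [dotProduct_neg, had]; simp
  have m1 := mem d (Or.inl rfl)
  have m2 := mem (-d) (Or.inr rfl)
  have v1 : dotProduct p (x + ε • d) ≤ dotProduct p m := hmax m1
  have v2 : dotProduct p (x + ε • (-d)) ≤ dotProduct p m := hmax m2
  have hxm' : dotProduct p x = dotProduct p m := hxm
  -- The values at `x + ε d` and `x - ε d` average to the maximum and do not exceed it, so both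
  -- points are maximisers, and extremality of `x` forces `d = 0`.
  have e1 : dotProduct p (x + ε • d) = dotProduct p m := by
    rw [dotProduct_add, dotProduct_smul, smul_eq_mul] at v1 v2 ⊢
    rw [dotProduct_neg] at v2
    linarith
  have e2 : dotProduct p (x + ε • (-d)) = dotProduct p m := by
    rw [dotProduct_add, dotProduct_smul, smul_eq_mul] at v1 v2 e1 ⊢
    rw [dotProduct_neg] at v2 ⊢
    linarith
  have := hext _ ⟨m1, e1⟩ _ ⟨m2, e2⟩
    ⟨1 / 2, 1 / 2, by norm_num, by norm_num, by norm_num, by module⟩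
  have h0 : ε • d = 0 := by simpa using this
  exact (smul_eq_zero.1 h0).resolve_left hε.ne'

/-- For a facet `f` whose plane misses the origin, the halfspace of the directions `x` for which the
point of the line of `x` on the plane of `f` belongs to the halfspace of `g`, provided that it lies on
the same side of the origin as `x`. -/
noncomputable def coneFacet (f g : Facet ℝ) : Facet ℝ :=
  ⟨⟨g.half.normal - (g.half.offset / f.half.offset) • f.half.normal, 0⟩, []⟩

theorem gap_coneFacet (f g : Facet ℝ) (x : Fin 3 → ℝ) : (coneFacet f g).half.gap x =
    g.half.offset / f.half.offset * dotProduct f.half.normal x - dotProduct g.half.normal x := by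
  simp only [coneFacet, Halfspace.gap, sub_dotProduct, smul_dotProduct, smul_eq_mul]
  ring

theorem dotProduct_coneFacet_normal (f g : Facet ℝ) (x : Fin 3 → ℝ) :
    dotProduct (coneFacet f g).half.normal x = - (coneFacet f g).half.gap x := by
  simp [coneFacet, Halfspace.gap]

theorem gap_coneFacet_smul (f g : Facet ℝ) (t : ℝ) (x : Fin 3 → ℝ) :
    (coneFacet f g).half.gap (t • x) = t * (coneFacet f g).half.gap x := by
  rw [gap_coneFacet, gap_coneFacet, dotProduct_smul, dotProduct_smul, smul_eq_mul, smul_eq_mul]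
  ring

/-- Thus the cone constraints active at a direction are the facet constraints active at its point on
the face of `f`. -/
theorem gap_coneFacet_of_gap_eq_zero {f : Facet ℝ} (hb : f.half.offset ≠ 0) (g : Facet ℝ)
    {x : Fin 3 → ℝ} (hx : f.half.gap x = 0) : (coneFacet f g).half.gap x = g.half.gap x := by
  rw [Halfspace.gap, sub_eq_zero] at hx
  rw [gap_coneFacet, Halfspace.gap, ← hx, div_mul_cancel₀ _ hb]

/-- Central projection maps a segment of positive luminosity into a segment; the weights of the
endpoints are rescaled by their luminosities. -/
theorem exists_chromaticity_lineMap {luma x y : Fin 3 → ℝ} {s : ℝ} (s0 : 0 ≤ s) (s1 : s ≤ 1)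
    (hx : 0 < dotProduct luma x) (hy : 0 < dotProduct luma y) :
    ∃ σ : ℝ, 0 ≤ σ ∧ σ ≤ 1 ∧ chromaticity luma (x + s • (y - x)) =
      chromaticity luma x + σ • (chromaticity luma y - chromaticity luma x) := by
  have hval : dotProduct luma (x + s • (y - x)) =
      (1 - s) * dotProduct luma x + s * dotProduct luma y := by
    rw [dotProduct_add, dotProduct_smul, dotProduct_sub, smul_eq_mul]; ring
  set z := dotProduct luma (x + s • (y - x)) with hz
  have hz0 : 0 < z := by
    rcases s0.eq_or_lt with rfl | h
    · rw [hval]; simpa using hx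
    · rw [hval]
      have := mul_pos h hy
      have := mul_nonneg (sub_nonneg.2 s1) hx.le
      linarith
  refine ⟨s * dotProduct luma y / z, by positivity, ?_, ?_⟩
  · rw [div_le_one hz0, hval]
    have := mul_nonneg (sub_nonneg.2 s1) hx.le
    linarith
  · have h1 : 1 - s * dotProduct luma y / z = (1 - s) * dotProduct luma x / z := by
      rw [eq_div_iff hz0.ne', sub_mul, div_mul_cancel₀ _ hz0.ne', hval]; ring
    have h2 : chromaticity luma x + (s * dotProduct luma y / z) •
        (chromaticity luma y - chromaticity luma x) =
        (1 - s * dotProduct luma y / z) • chromaticity luma x +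
          (s * dotProduct luma y / z) • chromaticity luma y := by module
    rw [h2, h1, mul_div_right_comm, mul_div_right_comm, mul_smul, mul_smul, smul_chromaticity hx,
      smul_chromaticity hy]
    have h3 : chromaticity luma (x + s • (y - x)) = z⁻¹ • (x + s • (y - x)) := rfl
    rw [h3, div_eq_mul_inv, div_eq_mul_inv]
    module

/-- The origin has luminosity zero, so it is outside. Moving towards it, one leaves through a
halfspace that it violates, that is, through a near facet. -/
theorem exists_near_facet {l : List (Facet ℝ)} {luma : Fin 3 → ℝ}
    (hL : ∀ x ∈ polyhedron l, 0 < dotProduct luma x) {x : Fin 3 → ℝ} (hx : x ∈ polyhedron l) :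
    ∃ f ∈ l, f.half.offset < 0 ∧ ∃ α : ℝ, 0 < α ∧ α ≤ 1 ∧ α • x ∈ polyhedron l ∧
      f.half.gap (α • x) = 0 := by
  have h0 : (0 : Fin 3 → ℝ) ∉ polyhedron l := fun h => by simpa using hL 0 h
  obtain ⟨t, t0, t1, hp, g, hg, hgp, hg0⟩ := exists_exit hx h0
  have e : x + t • (0 - x) = (1 - t) • x := by module
  rw [e] at hp hgp
  refine ⟨g, hg, ?_, 1 - t, by linarith, by linarith, hp, hgp⟩
  simpa [Halfspace.gap] using hg0

namespace IsRepresentation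

variable {c₀ : Fin 3 → ℝ} {l : List (Facet ℝ)} (H : IsRepresentation c₀ l) {luma : Fin 3 → ℝ}
  (hL : ∀ x ∈ polyhedron l, 0 < dotProduct luma x)
include H hL

/-- The face of a polyhedron on the plane of a facet that misses the origin, in terms of directions. -/
theorem exists_smul_mem_of_cone {f : Facet ℝ} (hf : f ∈ l) (hb : f.half.offset ≠ 0)
    {c : Fin 3 → ℝ} (hc : dotProduct luma c = 1)
    (hcone : ∀ g ∈ l, 0 ≤ (coneFacet f g).half.gap c) :
    ∃ κ : ℝ, 0 < κ ∧ κ • c ∈ polyhedron l ∧ f.half.gap (κ • c) = 0 ∧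
      κ * dotProduct f.half.normal c = f.half.offset := by
  -- The ray of `c` should meet the plane of `f` at parameter `1 / u`; the cone constraints say that
  -- this point satisfies all the others, once `u` is known to be positive.
  set u := dotProduct f.half.normal c / f.half.offset with hu
  have hcone' : ∀ g ∈ l, dotProduct g.half.normal c ≤ g.half.offset * u := by
    intro g hg
    have := hcone g hg
    rw [gap_coneFacet] at this
    rw [hu]
    have e : g.half.offset * (dotProduct f.half.normal c / f.half.offset) =
      g.half.offset / f.half.offset * dotProduct f.half.normal c := by ring
    linarith
  obtain ⟨K, fK, hK⟩ := H.strict f hf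
  have KP := mem_polyhedron_of_strict fK hK
  -- For `u ≤ 0` the vector `c - u K` would be a direction in which the polyhedron is unbounded; it
  -- is nonzero as its luminosity is positive.
  have hu0 : 0 < u := by
    by_contra! hu0
    set y := c + (-u) • K with hy
    have hLy : 0 < dotProduct luma y := by
      rw [hy, dotProduct_add, dotProduct_smul, hc, smul_eq_mul]
      have := mul_nonneg (neg_nonneg.2 hu0) (hL K KP).le
      linarith
    have hy0 : y ≠ 0 := fun h => by rw [h, dotProduct_zero] at hLy; exact lt_irrefl _ hLy
    obtain ⟨t, ht, hout⟩ := exists_add_smul_notMem H.bounded K hy0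
    refine hout fun g hg => ?_
    have h1 := KP g hg
    have h2 := hcone' g hg
    have h3 : dotProduct g.half.normal y ≤ 0 := by
      rw [hy, dotProduct_add, dotProduct_smul, smul_eq_mul]
      rw [Halfspace.gap] at h1
      have := mul_nonneg (neg_nonneg.2 hu0) h1
      linarith
    rw [Halfspace.gap_add_smul]
    nlinarith
  have hfc : dotProduct f.half.normal c = u * f.half.offset := by rw [hu, div_mul_cancel₀ _ hb]
  have hk : u⁻¹ * dotProduct f.half.normal c = f.half.offset := by
    rw [hfc, ← mul_assoc, inv_mul_cancel₀ hu0.ne', one_mul]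
  refine ⟨u⁻¹, inv_pos.2 hu0, fun g hg => ?_, by rw [gap_smul, hk, sub_self], hk⟩
  rw [gap_smul, sub_nonneg]
  calc u⁻¹ * dotProduct g.half.normal c ≤ u⁻¹ * (g.half.offset * u) :=
        mul_le_mul_of_nonneg_left (hcone' g hg) (inv_pos.2 hu0).le
    _ = g.half.offset := by rw [mul_comm, mul_assoc, mul_inv_cancel₀ hu0.ne', mul_one]

/-- Every such direction is the chromaticity of a point of the polyhedron, and the continuous image
of a compact set is bounded. -/
theorem isBounded_cone {f : Facet ℝ} (hf : f ∈ l) (hb : f.half.offset ≠ 0) :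
    Bornology.IsBounded
      {c : Fin 3 → ℝ | dotProduct luma c = 1 ∧ ∀ g ∈ l, 0 ≤ (coneFacet f g).half.gap c} := by
  have hP : IsCompact (polyhedron l) :=
    Metric.isCompact_of_isClosed_isBounded (isClosed_polyhedron l) H.bounded
  have hcont : ContinuousOn (chromaticity luma) (polyhedron l) := by
    have hlum : ContinuousOn (luminosity luma) (polyhedron l) := by
      unfold luminosity; fun_prop
    exact (hlum.inv₀ fun x hx => (hL x hx).ne').smul continuousOn_id
  refine (hP.image_of_continuousOn hcont).isBounded.subset ?_
  rintro c ⟨hc, hcone⟩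
  obtain ⟨κ, hκ, hκP, -, -⟩ := H.exists_smul_mem_of_cone hL hf hb hc hcone
  refine ⟨κ • c, hκP, ?_⟩
  have h1 : luminosity luma c = 1 := hc
  rw [chromaticity_smul hκ, chromaticity, h1, inv_one, one_smul]

/-- Moving away from the origin, one leaves by boundedness. The gap of the exit facet decreases
along the ray and is zero at a positive parameter, so its offset is positive. -/
theorem exists_far_facet {x : Fin 3 → ℝ} (hx : x ∈ polyhedron l) :
    ∃ f ∈ l, 0 < f.half.offset ∧ ∃ β : ℝ, 1 ≤ β ∧ β • x ∈ polyhedron l ∧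
      f.half.gap (β • x) = 0 := by
  have hx0 : x ≠ 0 := by rintro rfl; simpa using hL 0 hx
  obtain ⟨T, hT, hout⟩ := exists_add_smul_notMem H.bounded x hx0
  obtain ⟨t, t0, t1, hp, g, hg, hgp, hg0⟩ := exists_exit hx hout
  have e : x + t • (x + T • x - x) = (1 + t * T) • x := by module
  have e' : x + T • x = (1 + T) • x := by module
  rw [e] at hp hgp
  rw [e'] at hg0
  have hβ : 1 ≤ 1 + t * T := by nlinarith
  refine ⟨g, hg, ?_, 1 + t * T, hβ, hp, hgp⟩
  rw [gap_smul] at hgp hg0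
  have h1 : 0 < T * (1 - t) := mul_pos hT (by linarith)
  have h2 : 0 < dotProduct g.half.normal x := by
    by_contra! h
    nlinarith
  nlinarith

/-- A point of a facet is an endpoint of an edge, or it has no other facet, or it is an inner point of
an edge, and then the chromaticities of the edge give the only direction in which it can move
with all its facets. -/
theorem facet_point_cases {f : Facet ℝ} (hf : f ∈ l) (hb : f.half.offset ≠ 0) {c : Fin 3 → ℝ}
    {κ : ℝ} (hκP : κ • c ∈ polyhedron l) (fκ : f.half.gap (κ • c) = 0) :
    (∃ e ∈ f.edges, κ • c = e.1 ∨ κ • c = e.2) ∨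
    (∀ d, ∀ g ∈ l, (coneFacet f g).half.gap c = 0 →
      dotProduct (coneFacet f g).half.normal d = 0) ∨
    ∃ e ∈ f.edges, (∃ s : ℝ, 0 ≤ s ∧ s ≤ 1 ∧ κ • c = e.1 + s • (e.2 - e.1)) ∧
      chromaticity luma e.2 - chromaticity luma e.1 ≠ 0 ∧
      ∀ g ∈ l, (coneFacet f g).half.gap c = 0 → dotProduct (coneFacet f g).half.normal
        (chromaticity luma e.2 - chromaticity luma e.1) = 0 := by
  have hact : ∀ g, (coneFacet f g).half.gap c = 0 → g.half.gap (κ • c) = 0 := by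
    intro g hg
    rw [← gap_coneFacet_of_gap_eq_zero hb g fκ, gap_coneFacet_smul, hg, mul_zero]
  by_cases hex : ∃ g ∈ l, g.half ≠ f.half ∧ g.half.gap (κ • c) = 0
  · obtain ⟨g, hg, hgf, gκ⟩ := hex
    obtain ⟨e, he, hmem⟩ := H.exists_edge_of_mem hf hg hgf hκP fκ gκ
    obtain ⟨s, s0, s1, hs⟩ := mem_segment_iff_lineMap.1 hmem
    rcases s0.eq_or_lt with rfl | s0'
    · exact Or.inl ⟨e, he, Or.inl (by rw [hs, zero_smul, add_zero])⟩
    rcases s1.eq_or_lt with rfl | s1'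
    · exact Or.inl ⟨e, he, Or.inr (by rw [hs, one_smul, add_sub_cancel])⟩
    obtain ⟨p1, f1⟩ := H.endpoint_mem hf he (Or.inl rfl)
    obtain ⟨p2, f2⟩ := H.endpoint_mem hf he (Or.inr rfl)
    have q1 := hL _ p1
    have q2 := hL _ p2
    refine Or.inr (Or.inr ⟨e, he, ⟨s, s0, s1, hs⟩, fun h => ?_, fun g hg hgc => ?_⟩)
    -- Endpoints of equal chromaticity are on one ray, which meets the plane of `f` only once
    -- because the plane misses the origin.
    · have hcc := sub_eq_zero.1 h
      have k1 := smul_chromaticity q1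
      have k2 := smul_chromaticity q2
      rw [hcc] at k2
      have f1' := f1
      have f2' := f2
      rw [← k1, gap_smul] at f1'
      rw [← k2, gap_smul] at f2'
      have hnz : dotProduct f.half.normal (chromaticity luma e.1) ≠ 0 := by
        intro h0
        rw [h0] at f1'
        exact hb (by linarith)
      have : dotProduct luma e.1 = dotProduct luma e.2 :=
        mul_right_cancel₀ hnz (by linarith)
      exact H.edge_ne f hf e he (by rw [← k1, this]; exact k2)
    · have hg0 := hact g hgc
      rw [hs] at hg0
      obtain ⟨g1, g2⟩ := gap_eq_zero_of_openSegment s0' s1' (p1 g hg) (p2 g hg) hg0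
      rw [dotProduct_sub, dotProduct_coneFacet_normal, dotProduct_coneFacet_normal, chromaticity,
        chromaticity, gap_coneFacet_smul, gap_coneFacet_smul, gap_coneFacet_of_gap_eq_zero hb g f1,
        gap_coneFacet_of_gap_eq_zero hb g f2, g1, g2]
      simp
  · refine Or.inr (Or.inl fun d g hg hgc => ?_)
    push Not at hex
    have hgf : g.half = f.half := by
      by_contra hne
      exact hex g hg hne (hact g hgc)
    rw [dotProduct_coneFacet_normal, gap_coneFacet, hgf, div_self hb]
    simp

end IsRepresentation

theorem rayPlane_of_mul_eq {f : Facet ℝ} {c : Fin 3 → ℝ} {κ : ℝ} (hb : f.half.offset ≠ 0)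
    (hκ : 0 < κ) (h : κ * dotProduct f.half.normal c = f.half.offset) :
    (rayPlane c f).val = some κ := by
  have h0 : dotProduct f.half.normal c ≠ 0 := fun h0 => hb (by rw [← h, h0, mul_zero])
  exact rayPlane_eq_some.2 ⟨h0, hκ, by rw [← h, mul_div_cancel_right₀ _ h0]⟩

namespace IsRepresentation

variable {c₀ : Fin 3 → ℝ} {l : List (Facet ℝ)} (H : IsRepresentation c₀ l) {luma : Fin 3 → ℝ}
  (hL : ∀ x ∈ polyhedron l, 0 < dotProduct luma x)
include H hL

/-- Non-parallelism makes the determinant nonzero, and uniqueness in Cramer's rule shows that the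
computed crossing is `c`. -/
theorem crossingPair_eq_some (h2 : luma 2 ≠ 0) {f g : Facet ℝ} (hf : f ∈ l) (hg : g ∈ l)
    (hbf : f.half.offset ≠ 0) (hbg : g.half.offset ≠ 0) {c : Fin 3 → ℝ}
    (hc : dotProduct luma c = 1) {κ μ : ℝ} (hκ : 0 < κ) (hμ : 0 < μ)
    (fκ : κ * dotProduct f.half.normal c = f.half.offset)
    (gμ : μ * dotProduct g.half.normal c = g.half.offset)
    {e : (Fin 3 → ℝ) × (Fin 3 → ℝ)} (he : e ∈ f.edges)
    {e' : (Fin 3 → ℝ) × (Fin 3 → ℝ)} (he' : e' ∈ g.edges)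
    (hs : ∃ s : ℝ, 0 ≤ s ∧ s ≤ 1 ∧ κ • c = e.1 + s • (e.2 - e.1))
    (hs' : ∃ s : ℝ, 0 ≤ s ∧ s ≤ 1 ∧ μ • c = e'.1 + s • (e'.2 - e'.1))
    (hpar : ¬ ∃ t : ℝ, chromaticity luma e.2 - chromaticity luma e.1 =
      t • (chromaticity luma e'.2 - chromaticity luma e'.1))
    (hne : chromaticity luma e'.2 - chromaticity luma e'.1 ≠ 0) :
    (crossingPair luma e e').val = some (κ • c, μ • c) := by
  have p1 := hL _ (H.endpoint_mem hf he (Or.inl rfl)).1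
  have p2 := hL _ (H.endpoint_mem hf he (Or.inr rfl)).1
  have p3 := hL _ (H.endpoint_mem hg he' (Or.inl rfl)).1
  have p4 := hL _ (H.endpoint_mem hg he' (Or.inr rfl)).1
  have hcc : chromaticity luma c = c := by
    have h1 : luminosity luma c = 1 := hc
    rw [chromaticity, h1, inv_one, one_smul]
  obtain ⟨s, s0, s1, hs⟩ := hs
  obtain ⟨s', s0', s1', hs'⟩ := hs'
  obtain ⟨σ, σ0, σ1, hσ⟩ := exists_chromaticity_lineMap s0 s1 p1 p2
  obtain ⟨τ, τ0, τ1, hτ⟩ := exists_chromaticity_lineMap s0' s1' p3 p4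
  rw [← hs, chromaticity_smul hκ, hcc] at hσ
  rw [← hs', chromaticity_smul hμ, hcc] at hτ
  have hden : (chromaticity luma e.2 - chromaticity luma e.1) 0 *
      (chromaticity luma e'.2 - chromaticity luma e'.1) 1 -
      (chromaticity luma e.2 - chromaticity luma e.1) 1 *
      (chromaticity luma e'.2 - chromaticity luma e'.1) 0 ≠ 0 := fun h0 =>
    hpar (exists_eq_smul_of_det_eq_zero h2
      (by rw [dotProduct_sub, dotProduct_chromaticity p1, dotProduct_chromaticity p2, sub_self])
      (by rw [dotProduct_sub, dotProduct_chromaticity p3, dotProduct_chromaticity p4, sub_self])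
      hne h0)
  obtain ⟨h3, h4⟩ := cramer_of_add_smul_eq (hσ.symm.trans hτ) rfl hden
  rw [val_crossingPair luma e e' (chroma_eq_chromaticity _ _) (chroma_eq_chromaticity _ _)
    (chroma_eq_chromaticity _ _) (chroma_eq_chromaticity _ _) rfl h3 h4, if_neg hden,
    if_pos ⟨σ0, σ1, τ0, τ1⟩, ← hσ]
  -- The computed point and `ν • c` are both on the ray of `c` and on the plane of `k`, which meets
  -- that ray only once.
  have point {k : Facet ℝ} (hk : k ∈ l) (hb : k.half.offset ≠ 0) {ν : ℝ}
      (hν : ν * dotProduct k.half.normal c = k.half.offset) {d : (Fin 3 → ℝ) × (Fin 3 → ℝ)}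
      (hd : d ∈ k.edges) {ρ : ℝ} (ρ0 : 0 ≤ ρ) (ρ1 : ρ ≤ 1)
      (hρ : c = chromaticity luma d.1 + ρ • (chromaticity luma d.2 - chromaticity luma d.1)) :
      (pointOnEdge luma d.1 d.2 c ρ).val = ν • c := by
    obtain ⟨hmem, t, -, ht⟩ := pointOnEdge_spec (c := c)
      (hL _ (H.endpoint_mem hk hd (Or.inl rfl)).1) (hL _ (H.endpoint_mem hk hd (Or.inr rfl)).1)
      ρ0 ρ1 (by
        rw [chroma_eq_chromaticity, chroma_eq_chromaticity]; exact hρ)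
    have h := (H.mem_of_mem_edge hk hd hmem).2
    have h0 : dotProduct k.half.normal c ≠ 0 := fun h0 => hb (by rw [← hν, h0, mul_zero])
    rw [ht, gap_smul, ← hν, sub_eq_zero] at h
    rw [ht, mul_right_cancel₀ h0 h]
  rw [point hf hbf fκ he σ0 σ1 hσ, point hg hbg gμ he' τ0 τ1 hτ]

/-- If `κ • c` or `μ • c` is a vertex, step 2 or 3 records a pair at least as good. Otherwise each
point lies on no other facet or inside an edge; `hvertex` leaves only two nonparallel edges, which
step 4 crosses at `c`. -/
theorem exists_recordedPairs_of_vertex (h2 : luma 2 ≠ 0) {f g : Facet ℝ} (hf : f ∈ l) (hg : g ∈ l)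
    (hbf : f.half.offset < 0) (hbg : 0 < g.half.offset) {c : Fin 3 → ℝ}
    (hc : dotProduct luma c = 1) {κ μ : ℝ} (hκ : 0 < κ) (hμ : 0 < μ)
    (κP : κ • c ∈ polyhedron l) (μP : μ • c ∈ polyhedron l)
    (fκ : κ * dotProduct f.half.normal c = f.half.offset)
    (gμ : μ * dotProduct g.half.normal c = g.half.offset)
    (hvertex : ∀ d, dotProduct luma d = 0 →
      (∀ k ∈ l, (coneFacet f k).half.gap c = 0 → dotProduct (coneFacet f k).half.normal d = 0) →
      (∀ k ∈ l, (coneFacet g k).half.gap c = 0 → dotProduct (coneFacet g k).half.normal d = 0) →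
      d = 0) :
    ∃ vw ∈ recordedPairs luma l, μ / κ ≤ dotProduct luma vw.2 / dotProduct luma vw.1 := by
  have hcc : chromaticity luma c = c := by
    have h1 : luminosity luma c = 1 := hc
    rw [chromaticity, h1, inv_one, one_smul]
  have hLs (t : ℝ) : dotProduct luma (t • c) = t := by
    rw [dotProduct_smul, hc, smul_eq_mul, mul_one]
  have hrf := rayPlane_of_mul_eq hbf.ne hκ fκ
  have hrg := rayPlane_of_mul_eq hbg.ne' hμ gμ
  have hdir {k : Facet ℝ} (hk : k ∈ l) {e : (Fin 3 → ℝ) × (Fin 3 → ℝ)} (he : e ∈ k.edges) :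
      dotProduct luma (chromaticity luma e.2 - chromaticity luma e.1) = 0 := by
    rw [dotProduct_sub, dotProduct_chromaticity (hL _ (H.endpoint_mem hk he (Or.inl rfl)).1),
      dotProduct_chromaticity (hL _ (H.endpoint_mem hk he (Or.inr rfl)).1), sub_self]
  rcases H.facet_point_cases hL hf hbf.ne κP (by rw [gap_smul, fκ, sub_self]) with
    ⟨e, he, hv⟩ | hfree | ⟨e, he, hs, hne, hact⟩
  · cases hn : (nearestOnRay c (partitionFacets l).val.2).val with
    | none =>
      have := (nearestOnRay_spec _ _).1 hn g (mem_far.2 ⟨hg, hbg⟩)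
      rw [hrg] at this
      simp at this
    | some t =>
      obtain ⟨⟨k, hk, hkt⟩, hmin⟩ := (nearestOnRay_spec _ _).2 t hn
      have ht := (nearest_mem_polyhedron hμ μP
        ⟨k, (mem_far.1 hk).1, (mem_far.1 hk).2, hkt⟩
        fun k hk hk' => hmin k (mem_far.2 ⟨hk, hk'⟩)).1
      refine ⟨(κ • c, t • c), mem_recordedPairs.2 (Or.inl ⟨f, hf, hbf, e, he, κ • c, hv, t, ?_⟩), ?_⟩
      · rw [chromaticity_smul hκ, hcc]
        exact ⟨hn, rfl⟩
      · simp only [hLs]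
        exact div_le_div_of_nonneg_right ht hκ.le
  all_goals
    rcases H.facet_point_cases hL hg hbg.ne' μP (by rw [gap_smul, gμ, sub_self]) with
      ⟨e', he', hw⟩ | hfree' | ⟨e', he', hs', hne', hact'⟩
  case inr.inl.inl | inr.inr.inl =>
    cases hn : (farthestOnRay c (partitionFacets l).val.1).val with
    | none =>
      have := (farthestOnRay_spec _ _).1 hn f (mem_near.2 ⟨hf, hbf⟩)
      rw [hrf] at this
      simp at this
    | some t =>
      obtain ⟨⟨k, hk, hkt⟩, hmax⟩ := (farthestOnRay_spec _ _).2 t hn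
      obtain ⟨ht, ht0, -⟩ := farthest_mem_polyhedron κP
        ⟨k, (mem_near.1 hk).1, (mem_near.1 hk).2, hkt⟩
        fun k hk hk' => hmax k (mem_near.2 ⟨hk, hk'⟩)
      refine ⟨(t • c, μ • c),
        mem_recordedPairs.2 (Or.inr (Or.inl ⟨g, hg, hbg, e', he', μ • c, hw, t, ?_⟩)), ?_⟩
      · rw [chromaticity_smul hμ, hcc]
        exact ⟨hn, rfl⟩
      · simp only [hLs]
        exact div_le_div_of_nonneg_left hμ.le ht0 ht
  -- Neither point is on another facet, so every direction of zero luminosity would contradict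
  -- `hvertex`.
  · obtain ⟨w, hw, hLw, -⟩ := exists_orthogonal luma luma
    exact absurd (hvertex w hLw (hfree w) (hfree' w)) hw
  · exact absurd (hvertex _ (hdir hg he') (hfree _) hact') hne'
  · exact absurd (hvertex _ (hdir hf he) hact (hfree' _)) hne
  · refine ⟨(κ • c, μ • c), mem_recordedPairs.2 (Or.inr (Or.inr
      ⟨f, hf, hbf, e, he, g, hg, hbg, e', he', ?_⟩)), by simp only [hLs]; exact le_rfl⟩
    refine H.crossingPair_eq_some hL h2 hf hg hbf.ne hbg.ne' hc hκ hμ fκ gμ he he' hs hs' ?_ hne'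
    rintro ⟨t, ht⟩
    refine hne (hvertex _ (hdir hf he) hact fun k hk hkc => ?_)
    rw [ht, dotProduct_smul, hact' k hk hkc, smul_zero]

/-- Extending `x` to the near side and `y` to the far side only increases the ratio, to `b / a`. The
comparison with `b / a` becomes a linear inequality on the polygon of rays through the same two
faces, and so can be moved to a vertex. -/
theorem exists_recordedPairs_ge (h2 : luma 2 ≠ 0) {x y : Fin 3 → ℝ} (hx : x ∈ polyhedron l)
    (hy : y ∈ polyhedron l) (hxy : chromaticity luma x = chromaticity luma y) :
    ∃ vw ∈ recordedPairs luma l,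
      dotProduct luma y / dotProduct luma x ≤ dotProduct luma vw.2 / dotProduct luma vw.1 := by
  have px := hL x hx
  have py := hL y hy
  obtain ⟨f, hf, hbf, α, α0, α1, αP, fα⟩ := exists_near_facet hL hx
  obtain ⟨g, hg, hbg, β, β1, βP, gβ⟩ := H.exists_far_facet hL hy
  set c := chromaticity luma x with hcdef
  have hc : dotProduct luma c = 1 := dotProduct_chromaticity px
  have ex := smul_chromaticity px
  have ey := smul_chromaticity py
  rw [← hcdef] at ex
  rw [← hxy] at ey
  set a := α * dotProduct luma x with ha
  set b := β * dotProduct luma y with hb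
  have a0 : 0 < a := mul_pos α0 px
  have b0 : 0 < b := mul_pos (by linarith) py
  rw [← ex, smul_smul, ← ha] at αP fα
  rw [← ey, smul_smul, ← hb] at βP gβ
  have hM : dotProduct luma y / dotProduct luma x ≤ b / a :=
    div_le_div₀ b0.le (le_mul_of_one_le_left py.le β1) a0 (mul_le_of_le_one_left px.le α1)
  have hcone {k : Facet ℝ} (hk : k.half.offset ≠ 0) {t : ℝ} (t0 : 0 < t)
      (tP : t • c ∈ polyhedron l) (kt : k.half.gap (t • c) = 0) :
      ∀ m ∈ l, 0 ≤ (coneFacet k m).half.gap c := by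
    intro m hm
    have h := tP m hm
    rw [← gap_coneFacet_of_gap_eq_zero hk m kt, gap_coneFacet_smul] at h
    exact nonneg_of_mul_nonneg_right h t0
  have hval {k : Facet ℝ} (hk : k.half.offset ≠ 0) {t : ℝ} {z : Fin 3 → ℝ}
      (t0 : 0 < t) (kt : t * dotProduct k.half.normal z = k.half.offset) :
      dotProduct k.half.normal z / k.half.offset = 1 / t := by
    rw [div_eq_div_iff hk t0.ne', one_mul, ← kt]; ring
  rw [gap_smul, sub_eq_zero] at fα gβ
  -- The concatenated cone constraints describe the directions of rays that meet both the face of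
  -- `f` and the face of `g`.
  have hmem : c ∈ polyhedron (l.map (coneFacet f) ++ l.map (coneFacet g)) := by
    intro k hk
    rcases List.mem_append.1 hk with hk | hk <;> obtain ⟨m, hm, rfl⟩ := List.mem_map.1 hk
    · exact hcone hbf.ne a0 αP (by rw [gap_smul, sub_eq_zero]; exact fα) m hm
    · exact hcone hbg.ne' b0 βP (by rw [gap_smul, sub_eq_zero]; exact gβ) m hm
  -- On these directions the objective is `1 / κ - (b / a) * (1 / μ)`; it is zero at `c`, so it is
  -- nonnegative at the vertex `z`.
  obtain ⟨z, hz, hz1, hpz, hvertex⟩ := exists_vertex_ge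
    (p := f.half.offset⁻¹ • f.half.normal - (b / a * g.half.offset⁻¹) • g.half.normal)
    ((H.isBounded_cone hL hf hbf.ne).subset fun z hz => ⟨hz.2, fun m hm => hz.1 _
      (List.mem_append_left _ (List.mem_map_of_mem hm))⟩) hmem hc
  obtain ⟨κ, κ0, κP, -, fκ⟩ := H.exists_smul_mem_of_cone hL hf hbf.ne hz1 fun m hm => hz _
    (List.mem_append_left _ (List.mem_map_of_mem hm))
  obtain ⟨μ, μ0, μP, -, gμ⟩ := H.exists_smul_mem_of_cone hL hg hbg.ne' hz1 fun m hm => hz _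
    (List.mem_append_right _ (List.mem_map_of_mem hm))
  have hp (v : Fin 3 → ℝ) :
      dotProduct (f.half.offset⁻¹ • f.half.normal - (b / a * g.half.offset⁻¹) • g.half.normal) v =
        dotProduct f.half.normal v / f.half.offset -
          b / a * (dotProduct g.half.normal v / g.half.offset) := by
    rw [sub_dotProduct, smul_dotProduct, smul_dotProduct, smul_eq_mul, smul_eq_mul]; ring
  rw [hp, hp, hval hbf.ne a0 fα.symm, hval hbg.ne' b0 gβ.symm, hval hbf.ne κ0 fκ,
    hval hbg.ne' μ0 gμ] at hpz
  have h0 : 1 / a - b / a * (1 / b) = 0 := by field_simp; ring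
  have hle : b / a ≤ μ / κ := by
    have h1 : b / a * (1 / μ) ≤ 1 / κ := by linarith
    calc b / a = b / a * (1 / μ) * μ := by field_simp
      _ ≤ 1 / κ * μ := mul_le_mul_of_nonneg_right h1 μ0.le
      _ = μ / κ := by ring
  obtain ⟨vw, hvw, hr⟩ := H.exists_recordedPairs_of_vertex hL h2 hf hg hbf hbg hz1 κ0 μ0 κP μP fκ gμ
    fun d hd h3 h4 => hvertex d hd fun k hk hkz => by
      rcases List.mem_append.1 hk with hk | hk <;> obtain ⟨m, hm, rfl⟩ := List.mem_map.1 hk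
      · exact h3 m hm hkz
      · exact h4 m hm hkz
  exact ⟨vw, hvw, hM.trans (hle.trans hr)⟩

theorem bestPair_isOptimal (h2 : luma 2 ≠ 0) : ∃ K W : Fin 3 → ℝ,
    (bestPair luma (recordedPairs luma l)).val = some (K, W) ∧
      IsOptimalBlackWhite (polyhedron l) luma K W := by
  have hc₀ : c₀ ∈ polyhedron l := fun f hf => (H.center f hf).le
  -- The interior point, paired with itself, shows that some pair is recorded.
  obtain ⟨p, hp, -⟩ := H.exists_recordedPairs_ge hL h2 hc₀ hc₀ rfl
  obtain ⟨⟨K, W⟩, hKW, hbest, hmax⟩ := bestPair_spec luma (recordedPairs luma l)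
    (List.ne_nil_of_mem hp)
  obtain ⟨hK, hW, hchrom⟩ := H.mem_of_mem_recordedPairs hL h2 hKW
  refine ⟨K, W, hbest, hK, hW, hchrom, fun x hx y hy hxy => ?_⟩
  obtain ⟨vw, hvw, hle⟩ := H.exists_recordedPairs_ge hL h2 hx hy hxy
  exact hle.trans (hmax vw hvw)

end IsRepresentation

theorem lemma2 :
    ∃ C : ℕ, ∀ (luma : Fin 3 → ℝ) (ps : List (Projector ℝ)),
      (∀ i, 0 < luma i) →
      (interior (gamutIntersection ps)).Nonempty →
      (∀ x ∈ gamutIntersection ps, 0 < luminosity luma x) →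
      IsBoundaryRepresentation (gamutIntersection ps) (constructPolyhedron ps).val ∧
      (∃ K W : Fin 3 → ℝ, (overlayAlgorithm luma ps).val = some (K, W) ∧
        IsOptimalBlackWhite (gamutIntersection ps) luma K W) ∧
      (overlayAlgorithm luma ps).time ≤ C * ps.length ^ 2 := by
  refine ⟨1000000, fun luma ps hluma ⟨c, hc⟩ hL => ?_⟩
  -- Without projectors the intersection is the whole space and contains the origin, whose
  -- luminosity is zero.
  have hps : ps ≠ [] := by
    rintro rfl
    have := hL 0 (by simp [gamutIntersection])
    simp [luminosity] at this
  obtain ⟨H, hP, -, -⟩ := constructPolyhedron_spec hps hc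
  rw [← hP] at hL
  refine ⟨hP ▸ H.isBoundaryRepresentation, ?_, time_overlayAlgorithm_le hps hc luma⟩
  rw [← hP]
  exact H.bestPair_isOptimal hL (hluma 2).ne'
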